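/- **Setting.** A ReLU network is a fully connected feed-forward network whose hidden layers are $x\mapsto\max(Wx+b,0)$ and whose output layer is affine; its parameters are all entries of its matrices and bias vectors, and its depth is the number of affine maps. Let $f:\{\pm1\}^d\to\{\pm1\}^{d'}$, $R>0$, $\varepsilon>0$. For $b\in\{\pm1\}$ let $\psi_b$ be the standard Gaussian discretized to the points $k\varepsilon+\frac{\varepsilon}{2}\cdot\frac{1-b}{2}$, $k\in\mathbb Z$, i.e. the probability measure on these points with weights proportional to the standard Gaussian density. For $s\in\{\pm1\}^d$ let $g_s$ be the product distribution on $\mathbb R^{d+d'}$ with $x_i\sim N(Rs_i,1)$ for $i\le d$ and $x_i\sim\psi_{f(s)_{i-d}}$ for $i>d$; let $g$ be the uniform mixture of the $g_s$ over $s\in\{\pm1\}^d$, and let $\widetilde g$ be the law of $x/R$ for $x\sim g$. For a distribution $p$ on $\mathbb R^n$ let $p_\sigma=p*N(0,\sigma^2I_n)$ and $s_\sigma=\nabla\log p_\sigma$. For a constant $c>0$, a distribution $p$ on $\mathbb R^n$ with covariance $\Sigma$ is *$c$-well-modeled* if $\|\Sigma\|\lesssim1$ and for every $n^{-c}\le\sigma\le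 n^{c}$ there is a ReLU network $\widehat s_\sigma$ with $\mathrm{poly}(n)$ parameters, all bounded by $\mathrm{poly}(n)$ in absolute value, such that $\mathbb E_{x\sim p_\sigma}\|\widehat s_\sigma(x)-s_\sigma(x)\|^2<\frac1{n^c\sigma^2}$. **Assumptions.** Below, $d'=O(d)$, $f$ is computed on $\{\pm1\}^d$ by a ReLU network $N$ with $\mathrm{poly}(d)$ parameters bounded by $\mathrm{poly}(d)$ in absolute value, $\frac1{\mathrm{poly}(d)}<\varepsilon<\frac1{C\sqrt{\log d}}$, and $d$ is sufficiently large. More precisely, $d'\le kd$ and the three $\mathrm{poly}(d)$'s here are $d^k$, for an arbitrary constant $k$; all bounds are uniform in $d$, $d'$, $f$, $N$ and $\varepsilon$. **Corollary (Lower Bound Distribution is Well-Modeled).** With $R=C\log d$, the scaled distribution $\widetilde g$ on $\mathbb R^{d+d'}$ is $O(C)$-well-modeled, in the following sense: for every constant $a>0$, whenever $C$ is sufficiently large (depending only on $a$), $\widetilde g$ is $aC$-well-modeled. The constant in $\|\Sigma\|\lesssim1$ is absolute, and the polynomials in $n=d+d'$ bounding the score networks, as well as the threshold for $d$, depend only on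 $a$, $C$, $k$. **Theorem (ReLU score approximation).** For every sufficiently large constant $C$, every $R$ with $C\log d<R\le d^k$ and every $\sigma\ge d^{-C}$, there is a ReLU network $h$ on $\mathbb R^{d+d'}$ with $\mathrm{poly}(d)$ parameters bounded by $\mathrm{poly}(d)$ in absolute value (the polynomial and the threshold for $d$ depend only on $C$ and $k$), whose depth exceeds that of $N$ by at most an absolute constant (so $h$ has constant depth if $N$ has), such that the $\sigma$-smoothed version $g_\sigma$ of $g$, with score $s_\sigma$, satisfies $$\mathbb E_{x\sim g_\sigma}\|s_\sigma(x)-h(x)\|^2\lesssim\frac1{d^{C/200}},$$ with an absolute implied constant. -/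

import Mathlib

open MeasureTheory ProbabilityTheory
open scoped ENNReal NNReal Matrix.Norms.L2Operator

noncomputable section

/-- A fully connected feed-forward ReLU network with output coordinates indexed by `κ` and input
coordinates indexed by the last argument. Hidden layers are finite and nonempty, and each of them
applies `x ↦ ReLU (W x + b)`; the output layer is affine. -/
inductive ReLUNet (κ : Type) : Type → Type 1 where
  | output {ι : Type} (W : Matrix κ ι ℝ) (b : κ → ℝ) : ReLUNet κ ι
  | hidden {ι η : Type} [Fintype η] [Nonempty η] (W : Matrix η ι ℝ) (b : η → ℝ)
      (tail : ReLUNet κ η) : ReLUNet κ ι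

namespace ReLUNet

variable {κ : Type}

/-- The function computed by a network. -/
def eval : {ι : Type} → [Fintype ι] → ReLUNet κ ι → (ι → ℝ) → κ → ℝ
  | _, _, output W b, x => fun i => (∑ j, W i j * x j) + b i
  | _, _, hidden W b tail, x => tail.eval (fun i => max ((∑ j, W i j * x j) + b i) 0)

/-- The number of real parameters (entries of all weight matrices and bias vectors). -/
def paramCount [Fintype κ] : {ι : Type} → [Fintype ι] → ReLUNet κ ι → ℕ
  | ι, _, output _ _ => Fintype.card κ * (Fintype.card ι + 1)
  | ι, _, @hidden _ _ η _ _ _ _ tail =>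
      Fintype.card η * (Fintype.card ι + 1) + tail.paramCount

/-- The number of affine maps in the network. -/
def depth : {ι : Type} → ReLUNet κ ι → ℕ
  | _, output _ _ => 1
  | _, hidden _ _ tail => tail.depth + 1

/-- All parameters of the network have absolute value at most `B`. -/
def ParamsBoundedBy (B : ℝ) : {ι : Type} → ReLUNet κ ι → Prop
  | _, output W b => (∀ i j, |W i j| ≤ B) ∧ ∀ i, |b i| ≤ B
  | _, hidden W b tail => (∀ i j, |W i j| ≤ B) ∧ (∀ i, |b i| ≤ B) ∧ tail.ParamsBoundedBy B

/-- The network computes `f : {±1}^d → {±1}^{d'}` on the vertices of the hypercube. The set `{±1}`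
is the type `ℤˣ` of units of `ℤ`. -/
def Computes {d d' : ℕ} (N : ReLUNet (Fin d') (Fin d))
    (f : (Fin d → ℤˣ) → Fin d' → ℤˣ) : Prop :=
  ∀ s j, N.eval (fun i => ((s i : ℤ) : ℝ)) j = ((f s j : ℤ) : ℝ)

end ReLUNet

section Smoothing

variable {ι : Type} [Fintype ι]

/-- The Lebesgue density `x ↦ ∫ w_σ(x - y) dP(y)` of `P * N(0, σ² I)`. -/
def smoothedDensity (P : Measure (ι → ℝ)) (σ : ℝ) (x : ι → ℝ) : ℝ :=
  ∫ y, ∏ i, gaussianPDFReal (y i) (σ ^ 2).toNNReal (x i) ∂P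

/-- The `σ`-smoothed version `P * N(0, σ² I)` of `P`. -/
def smoothed (P : Measure (ι → ℝ)) (σ : ℝ) : Measure (ι → ℝ) :=
  volume.withDensity fun x => ENNReal.ofReal (smoothedDensity P σ x)

/-- The `σ`-smoothed score of `P`: the vector of partial derivatives of the logarithm of the
density of `P * N(0, σ² I)`. -/
def smoothedScore [DecidableEq ι] (P : Measure (ι → ℝ)) (σ : ℝ) (x : ι → ℝ) (i : ι) : ℝ :=
  deriv (fun t : ℝ => Real.log (smoothedDensity P σ (Function.update x i t))) (x i)

/-- The mean squared Euclidean error `E_{x ∼ P_σ} ‖h(x) - s_σ(x)‖²`, as a number in `[0, ∞]`. -/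
def scoreError [DecidableEq ι] (P : Measure (ι → ℝ)) (σ : ℝ) (h : (ι → ℝ) → ι → ℝ) : ℝ≥0∞ :=
  ∫⁻ x, ENNReal.ofReal (∑ i, (h x i - smoothedScore P σ x i) ^ 2) ∂(smoothed P σ)

/-- The covariance matrix of `P`. -/
def covMatrix (P : Measure (ι → ℝ)) : Matrix ι ι ℝ :=
  Matrix.of fun i j => cov[fun x => x i, fun x => x j; P]

/-- `P` is a `C`-well-modeled distribution on `ℝ^n`, `n = card ι`, where `M` is the constant in
`‖Σ‖ ≲ 1` (`ℓ²` operator norm) and `n ^ K` is the polynomial bounding both the number and the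
absolute values of the parameters of the networks that approximate the scores. -/
structure IsWellModeledWith [DecidableEq ι] (C M : ℝ) (K : ℕ) (P : Measure (ι → ℝ)) : Prop where
  isProbabilityMeasure : IsProbabilityMeasure P
  memLp : ∀ i, MemLp (fun x : ι → ℝ => x i) 2 P
  norm_cov_le : ‖covMatrix P‖ ≤ M
  exists_network : ∀ σ : ℝ, 1 / (Fintype.card ι : ℝ) ^ C ≤ σ → σ ≤ (Fintype.card ι : ℝ) ^ C →
    ∃ h : ReLUNet ι ι, h.paramCount ≤ Fintype.card ι ^ K ∧
      h.ParamsBoundedBy ((Fintype.card ι : ℝ) ^ K) ∧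
      scoreError P σ h.eval < ENNReal.ofReal (1 / ((Fintype.card ι : ℝ) ^ C * σ ^ 2))

end Smoothing

/-- The Dirac comb with period `ε`, translated by `φ`. -/
def diracComb (ε φ : ℝ) : Measure ℝ :=
  Measure.sum fun k : ℤ => Measure.dirac (k * ε + φ)

/-- The product of the standard Gaussian density with the Dirac comb of period `ε` and phase `0`
(if `b = 1`) or `ε / 2` (if `b = -1`). -/
def gaussianComb (ε : ℝ) (b : ℤˣ) : Measure ℝ :=
  (diracComb ε (ε / 2 * ((1 - ((b : ℤ) : ℝ)) / 2))).withDensity (gaussianPDF 0 1)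

/-- The discretized Gaussian `ψ_b`: the measure `gaussianComb ε b` normalized to mass one. -/
def discretizedGaussian (ε : ℝ) (b : ℤˣ) : Measure ℝ :=
  (gaussianComb ε b Set.univ)⁻¹ • gaussianComb ε b

section HardDistribution

variable {d d' : ℕ}

/-- The product distribution `g_s` on `ℝ^{d+d'}`. -/
def hardComponent (f : (Fin d → ℤˣ) → Fin d' → ℤˣ) (R ε : ℝ) (s : Fin d → ℤˣ) :
    Measure (Fin d ⊕ Fin d' → ℝ) :=
  Measure.pi (Sum.elim (fun i => gaussianReal (R * ((s i : ℤ) : ℝ)) 1)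
    (fun j => discretizedGaussian ε (f s j)))

/-- The distribution `g`: the uniform mixture of `g_s` over `s ∈ {±1}^d`. -/
def hardDist (f : (Fin d → ℤˣ) → Fin d' → ℤˣ) (R ε : ℝ) : Measure (Fin d ⊕ Fin d' → ℝ) :=
  ∑ s : Fin d → ℤˣ, ((2 : ℝ≥0∞) ^ d)⁻¹ • hardComponent f R ε s

/-- The scaled distribution `g̃(x) = R^{d+d'} g(R x)`, that is, the law of `x / R` for `x ∼ g`. -/
def scaledHardDist (f : (Fin d → ℤˣ) → Fin d' → ℤˣ) (R ε : ℝ) :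
    Measure (Fin d ⊕ Fin d' → ℝ) :=
  (hardDist f R ε).map fun x => R⁻¹ • x

end HardDistribution

end

open MeasureTheory ProbabilityTheory
open scoped ENNReal NNReal Matrix.Norms.L2Operator

/-! Gaussian smoothing of a mixture of product measures is again a mixture of product measures, so
its score at `x` is the average of the component scores under the posterior of `s` given `x`
(`smoothedScore_productMixture`). The component score of the first block is `(R s_i - x_i) / (1 +
σ²)`. On the second block, completing the square turns the smoothed comb into a Gaussian of variance
`1 + σ²` times a Gaussian sum over a translate of `ε ℤ` (`gaussianSmoothing_discretizedGaussian`).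
Its score is therefore linear up to a periodic correction `latticeScore`, whose phase is determined
by `f(s)`. There are two regimes.

Small noise. The signs of the first block reveal `s` except on an event of probability exponentially
small in `R² / (1 + σ²)`. A network clips the first block to `[-1, 1]`, feeds it to `N`, and
evaluates a piecewise linear interpolant of `latticeScore` at the resulting phase. By Cauchy–Schwarz
the error against the mixture score is at most the average error against the component scores
(`scoreError_productMixture_le`), which is controlled by the Chernoff bound on wrong signs, the
second moment outside the interpolation range, and the interpolation error. Interpolation with
polynomially many nodes is possible because `latticeScore` is bounded and has a polynomial Lipschitz
constant: up to a quadratic, the logarithm of the lattice sum is a cumulant generating function, so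
its second derivative is governed by a variance (`abs_latticeScore_le`, `abs_latticeScore_sub_le`).

Large noise. For `σ ≥ 1`, Poisson summation makes the lattice sum constant up to a relative error
`exp(-Ω(1/ε²))`, a large negative power of `d` because `ε < 1 / (C √(log d))`. Then the second block
carries almost no information on `s` and its score is nearly `-x / (1 + σ²)`. The first block nearly
decouples into two-point Gaussian mixtures, in which the posterior mean of a sign is `tanh (R x / (1
+ σ²))` (`abs_smoothedScore_inl_sub_le`, `sq_smoothedScore_inr_add_le`). One hidden layer that
interpolates `tanh` suffices.

The score theorem splits the regimes at `1 + σ² = R`. The corollary rescales by `R`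
(`scoreError_map_smul`) and splits at effective noise level one. Its covariance matrix is diagonal
with bounded entries, since the second block has conditional mean zero and the signs are
uncorrelated. -/

noncomputable section

/-! ### Gaussian smoothing of measures on the line. -/

/-- The Lebesgue density of `μ * N(0, σ²)` for a measure `μ` on the line. -/
def gaussianSmoothing (μ : Measure ℝ) (σ x : ℝ) : ℝ :=
  ∫ y, gaussianPDFReal y (σ ^ 2).toNNReal x ∂μ

/-- The measure on the line with density `gaussianSmoothing μ σ`. -/
def smoothedReal (μ : Measure ℝ) (σ : ℝ) : Measure ℝ :=
  volume.withDensity fun x => ENNReal.ofReal (gaussianSmoothing μ σ x)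

lemma toNNReal_sq_ne_zero {σ : ℝ} (hσ : 0 < σ) : (σ ^ 2).toNNReal ≠ 0 := by
  simpa using hσ.ne'

lemma measurable_gaussianPDFReal_uncurry (v : ℝ≥0) :
    Measurable fun p : ℝ × ℝ => gaussianPDFReal p.1 v p.2 := by
  unfold gaussianPDFReal
  fun_prop

lemma gaussianPDFReal_le (m : ℝ) (v : ℝ≥0) (x : ℝ) :
    gaussianPDFReal m v x ≤ (√(2 * Real.pi * v))⁻¹ := by
  unfold gaussianPDFReal
  refine mul_le_of_le_one_right (by positivity) (Real.exp_le_one_iff.2 ?_)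
  rw [neg_div]
  exact neg_nonpos.2 (by positivity)

lemma integrable_gaussianPDFReal_mean (μ : Measure ℝ) [IsFiniteMeasure μ] (v : ℝ≥0) (x : ℝ) :
    Integrable (fun y => gaussianPDFReal y v x) μ := by
  refine Integrable.of_bound (C := (√(2 * Real.pi * v))⁻¹) ?_ (ae_of_all _ fun y => ?_)
  · exact ((measurable_gaussianPDFReal_uncurry v).comp
      (measurable_id.prodMk measurable_const)).aestronglyMeasurable
  · rw [Real.norm_of_nonneg (gaussianPDFReal_nonneg _ _ _)]
    exact gaussianPDFReal_le _ _ _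

lemma measurable_gaussianSmoothing (μ : Measure ℝ) [SFinite μ] (σ : ℝ) :
    Measurable (gaussianSmoothing μ σ) := by
  have h : StronglyMeasurable fun p : ℝ × ℝ => gaussianPDFReal p.2 (σ ^ 2).toNNReal p.1 :=
    ((measurable_gaussianPDFReal_uncurry _).comp measurable_swap).stronglyMeasurable
  exact (h.integral_prod_right (ν := μ)).measurable

lemma gaussianSmoothing_nonneg (μ : Measure ℝ) (σ x : ℝ) : 0 ≤ gaussianSmoothing μ σ x :=
  integral_nonneg fun _ => gaussianPDFReal_nonneg _ _ _

lemma ofReal_gaussianSmoothing (μ : Measure ℝ) [IsFiniteMeasure μ] (σ x : ℝ) :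
    ENNReal.ofReal (gaussianSmoothing μ σ x) = ∫⁻ y, gaussianPDF y (σ ^ 2).toNNReal x ∂μ :=
  ofReal_integral_eq_lintegral_ofReal (integrable_gaussianPDFReal_mean μ _ x)
    (ae_of_all _ fun _ => gaussianPDFReal_nonneg _ _ _)

/-- Tonelli: a sample of the smoothed measure is a draw `y` from `μ` followed by a draw from `N(y,
σ²)`. The total mass and the second moments are read off from this form. -/
lemma lintegral_smoothedReal (μ : Measure ℝ) [IsFiniteMeasure μ] {σ : ℝ} (hσ : 0 < σ)
    {φ : ℝ → ℝ≥0∞} (hφ : Measurable φ) :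
    ∫⁻ x, φ x ∂(smoothedReal μ σ) = ∫⁻ y, ∫⁻ x, φ x ∂(gaussianReal y (σ ^ 2).toNNReal) ∂μ := by
  have hm : Measurable fun p : ℝ × ℝ => gaussianPDF p.2 (σ ^ 2).toNNReal p.1 :=
    ((measurable_gaussianPDFReal_uncurry _).comp measurable_swap).ennreal_ofReal
  rw [smoothedReal, lintegral_withDensity_eq_lintegral_mul _
    (measurable_gaussianSmoothing μ σ).ennreal_ofReal hφ]
  simp only [Pi.mul_apply, ofReal_gaussianSmoothing]
  have h1 : ∀ x, (∫⁻ y, gaussianPDF y (σ ^ 2).toNNReal x ∂μ) * φ x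
      = ∫⁻ y, gaussianPDF y (σ ^ 2).toNNReal x * φ x ∂μ := fun x =>
    (lintegral_mul_const _ (hm.comp (measurable_const.prodMk measurable_id))).symm
  simp only [h1]
  rw [lintegral_lintegral_swap (f := fun x y => gaussianPDF y (σ ^ 2).toNNReal x * φ x)]
  · refine lintegral_congr fun y => ?_
    rw [gaussianReal_of_var_ne_zero _ (toNNReal_sq_ne_zero hσ),
      lintegral_withDensity_eq_lintegral_mul _ (measurable_gaussianPDF _ _) hφ]
    rfl
  · exact (hm.mul (hφ.comp measurable_fst)).aemeasurable

lemma isProbabilityMeasure_smoothedReal (μ : Measure ℝ) [IsProbabilityMeasure μ] {σ : ℝ}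
    (hσ : 0 < σ) : IsProbabilityMeasure (smoothedReal μ σ) := by
  constructor
  rw [← lintegral_one, lintegral_smoothedReal μ hσ measurable_const]
  simp

lemma gaussianSmoothing_pos (μ : Measure ℝ) [IsProbabilityMeasure μ] {σ : ℝ} (hσ : 0 < σ)
    (x : ℝ) : 0 < gaussianSmoothing μ σ x := by
  refine (integral_pos_iff_support_of_nonneg (fun _ => gaussianPDFReal_nonneg _ _ _)
    (integrable_gaussianPDFReal_mean μ _ x)).2 ?_
  have : Function.support (fun y => gaussianPDFReal y (σ ^ 2).toNNReal x) = Set.univ := by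
    ext y
    simpa using (gaussianPDFReal_pos y _ x (toNNReal_sq_ne_zero hσ)).ne'
  rw [this]
  simp

/-! ### Smoothing and scores of mixtures of product measures. -/

section Mixture

variable {ι : Type} [Fintype ι]

/-- Both measures are compared on boxes, where the indicator of the box factors and Fubini applies.
Finiteness of the factors supplies the integrability. -/
lemma pi_withDensity_ofReal {q : ι → ℝ → ℝ} (hm : ∀ i, Measurable (q i)) (h0 : ∀ i x, 0 ≤ q i x)
    (hf : ∀ i, IsFiniteMeasure ((volume : Measure ℝ).withDensity fun x => ENNReal.ofReal (q i x))) :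
    (volume : Measure (ι → ℝ)).withDensity (fun x => ENNReal.ofReal (∏ i, q i (x i)))
      = Measure.pi fun i => volume.withDensity fun x => ENNReal.ofReal (q i x) := by
  classical
  have hint : ∀ i, Integrable (q i) := fun i => by
    refine ⟨(hm i).aestronglyMeasurable, ?_⟩
    rw [hasFiniteIntegral_iff_ofReal (ae_of_all _ (h0 i))]
    have := (hf i).measure_univ_lt_top
    rwa [withDensity_apply _ MeasurableSet.univ, Measure.restrict_univ] at this
  refine (Measure.pi_eq fun s hs => ?_).symm
  rw [withDensity_apply _ (MeasurableSet.univ_pi hs), ← lintegral_indicator (MeasurableSet.univ_pi hs)]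
  have h1 : ∀ x : ι → ℝ, (Set.univ.pi s).indicator
      (fun x => ENNReal.ofReal (∏ i, q i (x i))) x
      = ENNReal.ofReal (∏ i, (s i).indicator (q i) (x i)) := by
    intro x
    by_cases hx : x ∈ Set.univ.pi s
    · rw [Set.indicator_of_mem hx]
      congr 1
      refine Finset.prod_congr rfl fun i _ => ?_
      rw [Set.indicator_of_mem (hx i trivial)]
    · rw [Set.indicator_of_notMem hx]
      simp only [Set.mem_pi, Set.mem_univ, true_implies, not_forall] at hx
      obtain ⟨i, hi⟩ := hx
      rw [Finset.prod_eq_zero (Finset.mem_univ i) (Set.indicator_of_notMem hi _),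
        ENNReal.ofReal_zero]
  simp only [h1]
  have hint' : ∀ i, Integrable ((s i).indicator (q i)) := fun i => (hint i).indicator (hs i)
  have h0' : ∀ i x, 0 ≤ (s i).indicator (q i) x := fun i x =>
    Set.indicator_nonneg (fun y _ => h0 i y) x
  rw [← ofReal_integral_eq_lintegral_ofReal
    (by simpa only [volume_pi] using Integrable.fintype_prod (fun i => hint' i))
    (ae_of_all _ fun x => Finset.prod_nonneg fun i _ => h0' i _),
    integral_fintype_prod_volume_eq_prod,
    ENNReal.ofReal_prod_of_nonneg fun i _ => integral_nonneg (h0' i)]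
  refine Finset.prod_congr rfl fun i _ => ?_
  rw [withDensity_apply _ (hs i), ofReal_integral_eq_lintegral_ofReal (hint' i)
    (ae_of_all _ (h0' i)), ← lintegral_indicator (hs i)]
  refine lintegral_congr fun x => ?_
  by_cases hx : x ∈ s i
  · simp [hx]
  · simp [hx]

variable {S : Type} [Fintype S] (c : ℝ≥0∞) (μ : S → ι → Measure ℝ)

/-- The mixture of the product measures `∏ i, μ s i`, with the same weight `c` for all `s`. -/
def productMixture : Measure (ι → ℝ) := ∑ s, c • Measure.pi (μ s)

variable [∀ s i, IsProbabilityMeasure (μ s i)]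

/-- The isotropic Gaussian kernel is a product over coordinates, so smoothing acts on each factor of
each component separately. -/
lemma smoothedDensity_productMixture (hc : c ≠ ∞) (σ : ℝ) (x : ι → ℝ) :
    smoothedDensity (productMixture c μ) σ x
      = c.toReal * ∑ s, ∏ i, gaussianSmoothing (μ s i) σ (x i) := by
  have hint : ∀ s, Integrable (fun y : ι → ℝ =>
      ∏ i, gaussianPDFReal (y i) (σ ^ 2).toNNReal (x i)) (Measure.pi (μ s)) := fun s =>
    Integrable.fintype_prod
      (f := fun i y => gaussianPDFReal y (σ ^ 2).toNNReal (x i))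
      fun i => integrable_gaussianPDFReal_mean _ _ _
  rw [smoothedDensity, productMixture, integral_finsetSum_measure
    fun s _ => (hint s).smul_measure hc, Finset.mul_sum]
  refine Finset.sum_congr rfl fun s _ => ?_
  rw [integral_smul_measure, smul_eq_mul,
    integral_fintype_prod_eq_prod (fun i y => gaussianPDFReal y (σ ^ 2).toNNReal (x i))]
  rfl

lemma smoothed_productMixture (hc : c ≠ ∞) {σ : ℝ} (hσ : 0 < σ) :
    smoothed (productMixture c μ) σ = ∑ s, c • Measure.pi fun i => smoothedReal (μ s i) σ := by
  have h1 : ∀ s, (Measure.pi fun i => smoothedReal (μ s i) σ)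
      = (volume : Measure (ι → ℝ)).withDensity
        (fun x => ENNReal.ofReal (∏ i, gaussianSmoothing (μ s i) σ (x i))) := fun s =>
    (pi_withDensity_ofReal (fun i => measurable_gaussianSmoothing _ _)
      (fun i => gaussianSmoothing_nonneg _ _) fun i => by
        have := isProbabilityMeasure_smoothedReal (μ s i) hσ
        exact inferInstanceAs (IsFiniteMeasure (smoothedReal (μ s i) σ))).symm
  have hmeas : ∀ s, Measurable fun x : ι → ℝ =>
      ENNReal.ofReal (∏ i, gaussianSmoothing (μ s i) σ (x i)) := fun s =>
    (Finset.measurable_prod _ fun i _ =>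
      (measurable_gaussianSmoothing _ _).comp (measurable_pi_apply i)).ennreal_ofReal
  ext A hA
  rw [smoothed, withDensity_apply _ hA, Measure.finsetSum_apply]
  simp only [Measure.smul_apply, h1, withDensity_apply _ hA, smul_eq_mul]
  rw [← Finset.sum_congr rfl fun s _ => lintegral_const_mul c (hmeas s),
    ← lintegral_finsetSum _ fun s _ => (hmeas s).const_mul c]
  refine lintegral_congr fun x => ?_
  rw [smoothedDensity_productMixture c μ hc, ENNReal.ofReal_mul ENNReal.toReal_nonneg,
    ENNReal.ofReal_toReal hc, ENNReal.ofReal_sum_of_nonneg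
      fun s _ => Finset.prod_nonneg fun i _ => gaussianSmoothing_nonneg _ _ _, Finset.mul_sum]

lemma smoothed_productMixture_univ (hc : c ≠ ∞) (hc1 : Fintype.card S * c = 1) {σ : ℝ}
    (hσ : 0 < σ) : smoothed (productMixture c μ) σ Set.univ = 1 := by
  have := fun s i => isProbabilityMeasure_smoothedReal (μ s i) hσ
  rw [smoothed_productMixture c μ hc hσ, Measure.finsetSum_apply]
  simpa using hc1

variable [DecidableEq ι]

/-- Here `t s` is the logarithmic derivative of the `i`-th factor of the component `s`.
Differentiating the logarithm of a sum weights these by the densities of the components at `x`, that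
is, by the posterior of `s`; the common weight `c` cancels. -/
lemma smoothedScore_productMixture [Nonempty S] (hc0 : c ≠ 0) (hc : c ≠ ∞) {σ : ℝ} (hσ : 0 < σ)
    (x : ι → ℝ) (i : ι) {t : S → ℝ}
    (ht : ∀ s, HasDerivAt (gaussianSmoothing (μ s i) σ)
      (gaussianSmoothing (μ s i) σ (x i) * t s) (x i)) :
    smoothedScore (productMixture c μ) σ x i
      = (∑ s, (∏ j, gaussianSmoothing (μ s j) σ (x j)) * t s)
        / ∑ s, ∏ j, gaussianSmoothing (μ s j) σ (x j) := by
  have hcpos : 0 < c.toReal := ENNReal.toReal_pos hc0 hc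
  have hpos : 0 < ∑ s, ∏ j, gaussianSmoothing (μ s j) σ (x j) :=
    Finset.sum_pos (fun s _ => Finset.prod_pos fun j _ => gaussianSmoothing_pos _ hσ _)
      Finset.univ_nonempty
  have hfun : ∀ u, smoothedDensity (productMixture c μ) σ (Function.update x i u)
      = c.toReal * ∑ s, gaussianSmoothing (μ s i) σ u
        * ∏ j ∈ Finset.univ.erase i, gaussianSmoothing (μ s j) σ (x j) := by
    intro u
    rw [smoothedDensity_productMixture c μ hc]
    congr 1
    refine Finset.sum_congr rfl fun s _ => ?_
    rw [← Finset.mul_prod_erase _ _ (Finset.mem_univ i), Function.update_self]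
    congr 1
    refine Finset.prod_congr rfl fun j hj => ?_
    rw [Function.update_of_ne (Finset.ne_of_mem_erase hj)]
  have hd : HasDerivAt (fun u => smoothedDensity (productMixture c μ) σ (Function.update x i u))
      (c.toReal * ∑ s, (∏ j, gaussianSmoothing (μ s j) σ (x j)) * t s) (x i) := by
    rw [show (fun u => smoothedDensity (productMixture c μ) σ (Function.update x i u)) = _ from
      funext hfun]
    have := (HasDerivAt.fun_sum (u := Finset.univ) fun s _ => (ht s).mul_const
      (∏ j ∈ Finset.univ.erase i, gaussianSmoothing (μ s j) σ (x j))).const_mul c.toReal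
    convert! this using 1
    congr 1
    refine Finset.sum_congr rfl fun s _ => ?_
    rw [← Finset.mul_prod_erase _ _ (Finset.mem_univ i)]
    ring
  have hval : smoothedDensity (productMixture c μ) σ (Function.update x i (x i))
      = c.toReal * ∑ s, ∏ j, gaussianSmoothing (μ s j) σ (x j) := by
    rw [Function.update_eq_self, smoothedDensity_productMixture c μ hc]
  rw [smoothedScore, (hd.log (by rw [hval]; positivity)).deriv, hval,
    mul_div_mul_left _ _ hcpos.ne']

/-- The score error of a mixture is at most the average over the components of the error with
respect to the score of the component. -/
lemma scoreError_productMixture_le [Nonempty S] (hc0 : c ≠ 0) (hc : c ≠ ∞) {σ : ℝ} (hσ : 0 < σ)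
    {t : S → ι → ℝ → ℝ}
    (ht : ∀ s i u, HasDerivAt (gaussianSmoothing (μ s i) σ)
      (gaussianSmoothing (μ s i) σ u * t s i u) u)
    (htm : ∀ s i, Measurable (t s i)) {h : (ι → ℝ) → ι → ℝ} (hh : Measurable h) :
    scoreError (productMixture c μ) σ h ≤ ∑ s, c * ∫⁻ x,
      ENNReal.ofReal (∑ i, (h x i - t s i (x i)) ^ 2)
        ∂(Measure.pi fun i => smoothedReal (μ s i) σ) := by
  have hprob := fun s i => isProbabilityMeasure_smoothedReal (μ s i) hσ
  set W : S → (ι → ℝ) → ℝ := fun s x => ∏ i, gaussianSmoothing (μ s i) σ (x i) with hW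
  have hWpos : ∀ s x, 0 < W s x := fun s x =>
    Finset.prod_pos fun i _ => gaussianSmoothing_pos _ hσ _
  have hWm : ∀ s, Measurable (W s) := fun s => Finset.measurable_prod _ fun i _ =>
    (measurable_gaussianSmoothing _ _).comp (measurable_pi_apply i)
  have hGm : ∀ s, Measurable fun x : ι → ℝ => ∑ i, (h x i - t s i (x i)) ^ 2 := fun s =>
    Finset.measurable_sum _ fun i _ =>
      (((measurable_pi_apply i).comp hh).sub ((htm s i).comp (measurable_pi_apply i))).pow_const 2
  have hpi : ∀ s, (Measure.pi fun i => smoothedReal (μ s i) σ)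
      = volume.withDensity fun x => ENNReal.ofReal (W s x) := fun s =>
    (pi_withDensity_ofReal (fun i => measurable_gaussianSmoothing _ _)
      (fun i => gaussianSmoothing_nonneg _ _) fun i => by
        exact inferInstanceAs (IsFiniteMeasure (smoothedReal (μ s i) σ))).symm
  have hden : ∀ x, smoothedDensity (productMixture c μ) σ x = c.toReal * ∑ s, W s x :=
    smoothedDensity_productMixture c μ hc σ
  have hdm : Measurable fun x => ENNReal.ofReal (smoothedDensity (productMixture c μ) σ x) := by
    simp only [hden]
    exact ((Finset.measurable_sum _ fun s _ => hWm s).const_mul _).ennreal_ofReal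
  simp only [hpi]
  -- The integrand contains the score of the mixture, defined by `deriv`. This form of the density
  -- formula asks only for a measurable, finite density and spares a proof that the integrand is
  -- measurable.
  rw [scoreError, smoothed, lintegral_withDensity_eq_lintegral_mul_non_measurable _ hdm
    (ae_of_all _ fun _ => ENNReal.ofReal_lt_top)]
  simp only [lintegral_withDensity_eq_lintegral_mul _ (hWm _).ennreal_ofReal
    (hGm _).ennreal_ofReal]
  rw [← Finset.sum_congr rfl fun s _ => lintegral_const_mul c
      ((hWm s).ennreal_ofReal.mul (hGm s).ennreal_ofReal),
    ← lintegral_finsetSum _ fun s _ => ((hWm s).ennreal_ofReal.mul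
      (hGm s).ennreal_ofReal).const_mul c]
  refine lintegral_mono fun x => ?_
  simp only [Pi.mul_apply, hden]
  have hcc : ∀ s, c * (ENNReal.ofReal (W s x) * ENNReal.ofReal (∑ i, (h x i - t s i (x i)) ^ 2))
      = ENNReal.ofReal (c.toReal * (W s x * ∑ i, (h x i - t s i (x i)) ^ 2)) := fun s => by
    rw [ENNReal.ofReal_mul ENNReal.toReal_nonneg, ENNReal.ofReal_toReal hc,
      ENNReal.ofReal_mul (hWpos s x).le]
  have hsum : 0 < ∑ s, W s x := Finset.sum_pos (fun s _ => hWpos s x) Finset.univ_nonempty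
  rw [Finset.sum_congr rfl fun s _ => hcc s, ← ENNReal.ofReal_sum_of_nonneg fun s _ => by
      have := hWpos s x
      positivity,
    ← ENNReal.ofReal_mul (by positivity), ← Finset.mul_sum, mul_assoc]
  refine ENNReal.ofReal_le_ofReal (mul_le_mul_of_nonneg_left ?_ ENNReal.toReal_nonneg)
  simp only [Finset.mul_sum]
  rw [Finset.sum_comm]
  refine Finset.sum_le_sum fun i _ => ?_
  rw [smoothedScore_productMixture c μ hc0 hc hσ x i fun s => ht s i (x i)]
  -- Cauchy–Schwarz with the posterior weights `W s`: the error against the posterior mean is the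
  -- posterior mean of the errors, and its square is at most the posterior mean of the squares.
  have hcs := Finset.sum_sq_le_sum_mul_sum_of_sq_le_mul Finset.univ
    (r := fun s => W s x * (h x i - t s i (x i))) (f := fun s => W s x)
    (g := fun s => W s x * (h x i - t s i (x i)) ^ 2) (fun s _ => (hWpos s x).le)
    (fun s _ => mul_nonneg (hWpos s x).le (sq_nonneg _)) fun s _ => le_of_eq (by ring)
  have hrw : ∑ s, W s x * (h x i - t s i (x i))
      = (∑ s, W s x) * (h x i - (∑ s, W s x * t s i (x i)) / ∑ s, W s x) := by
    rw [mul_sub, mul_div_cancel₀ _ hsum.ne']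
    simp only [mul_sub, Finset.sum_sub_distrib, Finset.sum_mul]
  rw [hrw, mul_pow, sq (∑ s, W s x), mul_assoc] at hcs
  exact le_of_mul_le_mul_left hcs hsum

/-- The smoothed mixture has mass one. The large noise estimate is uniform in `x` and enters through
this lemma. -/
lemma scoreError_le_of_forall_le (hc : c ≠ ∞) (hc1 : Fintype.card S * c = 1) {σ : ℝ} (hσ : 0 < σ)
    {h : (ι → ℝ) → ι → ℝ} {b : ℝ}
    (hb : ∀ x, ∑ i, (h x i - smoothedScore (productMixture c μ) σ x i) ^ 2 ≤ b) :
    scoreError (productMixture c μ) σ h ≤ ENNReal.ofReal b := by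
  calc scoreError (productMixture c μ) σ h
      ≤ ∫⁻ _, ENNReal.ofReal b ∂(smoothed (productMixture c μ) σ) :=
        lintegral_mono fun x => ENNReal.ofReal_le_ofReal (hb x)
    _ = ENNReal.ofReal b := by
        rw [lintegral_const, smoothed_productMixture_univ c μ hc hc1 hσ, mul_one]

end Mixture

/-! ### Gaussian sums over a lattice and their logarithmic derivative. -/

/-- The sum over the lattice `ε ℤ` of the unnormalized Gaussian density with mean `u` and
variance `v`. -/
def latticeGaussian (v ε u : ℝ) : ℝ := ∑' k : ℤ, Real.exp (-(k * ε - u) ^ 2 / (2 * v))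

/-- The logarithmic derivative of `latticeGaussian v ε`. -/
def latticeScore (v ε : ℝ) : ℝ → ℝ := deriv fun u => Real.log (latticeGaussian v ε u)

/-- The measure on the lattice `ε ℤ` whose exponential tilts are the discrete Gaussians. -/
def latticeMeasure (v ε : ℝ) : Measure ℝ :=
  Measure.sum fun k : ℤ => ENNReal.ofReal (Real.exp (-(k * ε) ^ 2 / (2 * v))) •
    Measure.dirac (k * ε)

section Lattice

variable {v ε : ℝ}

lemma summable_latticeGaussian (hv : 0 < v) (hε : 0 < ε) (u : ℝ) :
    Summable fun k : ℤ => Real.exp (-(k * ε - u) ^ 2 / (2 * v)) := by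
  -- After discarding `-u²` and replacing `k u` by `|k| |u|` in the exponent, the terms are those of
  -- the majorant of the two-variable theta series.
  have h := summable_pow_mul_jacobiTheta₂_term_bound (ε * |u| / (2 * Real.pi * v))
    (T := ε ^ 2 / (2 * Real.pi * v)) (by positivity) 0
  refine Summable.of_nonneg_of_le (fun k => (Real.exp_pos _).le) (fun k => ?_) h
  rw [pow_zero, one_mul]
  refine Real.exp_le_exp.2 ?_
  have h1 : (k : ℝ) * u ≤ |(k : ℝ)| * |u| := by rw [← abs_mul]; exact le_abs_self _
  have h2 : -Real.pi * (ε ^ 2 / (2 * Real.pi * v) * (k : ℝ) ^ 2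
      - 2 * (ε * |u| / (2 * Real.pi * v)) * ((|k| : ℤ) : ℝ))
      = (-(ε ^ 2 * (k : ℝ) ^ 2) + 2 * ε * (|(k : ℝ)| * |u|)) / (2 * v) := by
    have := Real.pi_pos
    push_cast
    field_simp
    ring
  rw [h2]
  gcongr
  nlinarith [sq_nonneg u]

lemma latticeGaussian_pos (hv : 0 < v) (hε : 0 < ε) (u : ℝ) : 0 < latticeGaussian v ε u :=
  (summable_latticeGaussian hv hε u).tsum_pos (fun _ => (Real.exp_pos _).le) 0 (Real.exp_pos _)

lemma latticeGaussian_periodic (v ε : ℝ) : Function.Periodic (latticeGaussian v ε) ε := by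
  intro u
  unfold latticeGaussian
  rw [← (Equiv.addRight (1 : ℤ)).tsum_eq]
  refine tsum_congr fun k => ?_
  simp only [Equiv.coe_addRight]
  push_cast
  ring_nf

lemma latticeGaussian_neg (v ε u : ℝ) : latticeGaussian v ε (-u) = latticeGaussian v ε u := by
  unfold latticeGaussian
  rw [← (Equiv.neg ℤ).tsum_eq]
  refine tsum_congr fun k => ?_
  simp only [Equiv.neg_apply]
  push_cast
  ring_nf

/-- Completing the square: the exponential tilt with parameter `u / v` moves the centre of the
Gaussian weight from `0` to `u`. -/
lemma exp_mul_latticeWeight (hv : 0 < v) (u y : ℝ) :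
    Real.exp (-y ^ 2 / (2 * v)) * Real.exp (u / v * y)
      = Real.exp (u ^ 2 / (2 * v)) * Real.exp (-(y - u) ^ 2 / (2 * v)) := by
  rw [← Real.exp_add, ← Real.exp_add]
  congr 1
  field_simp
  ring

lemma integrable_latticeMeasure (hv : 0 < v) (u : ℝ) {g : ℝ → ℝ}
    (hg : Summable fun k : ℤ => ‖g (k * ε)‖ * Real.exp (-(k * ε - u) ^ 2 / (2 * v))) :
    Integrable (fun y => g y * Real.exp (u / v * y)) (latticeMeasure v ε) ∧
    ∫ y, g y * Real.exp (u / v * y) ∂(latticeMeasure v ε)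
      = Real.exp (u ^ 2 / (2 * v))
        * ∑' k : ℤ, g (k * ε) * Real.exp (-(k * ε - u) ^ 2 / (2 * v)) := by
  have hs : Summable fun k : ℤ => (ENNReal.ofReal (Real.exp (-(k * ε) ^ 2 / (2 * v)))).toReal *
      ‖g (k * ε) * Real.exp (u / v * (k * ε))‖ := by
    refine (hg.mul_left (Real.exp (u ^ 2 / (2 * v)))).congr fun k => ?_
    rw [ENNReal.toReal_ofReal (Real.exp_pos _).le, norm_mul, Real.norm_of_nonneg (Real.exp_pos _).le]
    linear_combination ‖g (k * ε)‖ * (-exp_mul_latticeWeight hv u (k * ε))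
  unfold latticeMeasure
  refine ⟨integrable_sum_dirac (x := fun k : ℤ => (k : ℝ) * ε)
    (f := fun y => g y * Real.exp (u / v * y)) (fun _ => ENNReal.ofReal_ne_top) hs, ?_⟩
  rw [integral_sum_dirac_eq_tsum (x := fun k : ℤ => (k : ℝ) * ε)
    (f := fun y => g y * Real.exp (u / v * y)) (fun _ => ENNReal.ofReal_ne_top) hs,
    ← tsum_mul_left]
  refine tsum_congr fun k => ?_
  rw [ENNReal.toReal_ofReal (Real.exp_pos _).le, smul_eq_mul]
  linear_combination g (k * ε) * (exp_mul_latticeWeight hv u (k * ε))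

lemma mgf_latticeMeasure (hv : 0 < v) (hε : 0 < ε) (u : ℝ) :
    mgf id (latticeMeasure v ε) (u / v) = Real.exp (u ^ 2 / (2 * v)) * latticeGaussian v ε u := by
  have := (integrable_latticeMeasure hv u (g := fun _ => 1) (ε := ε)
    (by simpa using summable_latticeGaussian hv hε u)).2
  simpa [mgf, latticeGaussian] using this

lemma mem_interior_integrableExpSet_latticeMeasure (hv : 0 < v) (hε : 0 < ε) (t : ℝ) :
    t ∈ interior (integrableExpSet id (latticeMeasure v ε)) := by
  have : integrableExpSet id (latticeMeasure v ε) = Set.univ := by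
    refine Set.eq_univ_of_forall fun t => ?_
    have := (integrable_latticeMeasure hv (t * v) (g := fun _ => 1) (ε := ε)
      (by simpa using summable_latticeGaussian hv hε (t * v))).1
    rw [mul_div_cancel_right₀ _ hv.ne'] at this
    simpa [integrableExpSet] using this
  rw [this, interior_univ]
  trivial

/-- By the tilting identity the lattice sum is a moment generating function up to the factor `exp
(-u² / (2 v))`. The derivatives of its logarithm are thus expressed by the mean and the variance of
the discrete Gaussian centred at `u`. -/
lemma log_latticeGaussian (hv : 0 < v) (hε : 0 < ε) (u : ℝ) :
    Real.log (latticeGaussian v ε u)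
      = cgf id (latticeMeasure v ε) (u / v) - u ^ 2 / (2 * v) := by
  rw [cgf, mgf_latticeMeasure hv hε, Real.log_mul (Real.exp_pos _).ne'
    (latticeGaussian_pos hv hε u).ne', Real.log_exp]
  ring

lemma hasDerivAt_log_latticeGaussian_cgf (hv : 0 < v) (hε : 0 < ε) (u : ℝ) :
    HasDerivAt (fun u => Real.log (latticeGaussian v ε u))
      ((deriv (cgf id (latticeMeasure v ε)) (u / v) - u) / v) u := by
  simp only [log_latticeGaussian hv hε]
  have h1 : HasDerivAt (cgf id (latticeMeasure v ε))
      (deriv (cgf id (latticeMeasure v ε)) (u / v)) (u / v) :=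
    (analyticAt_cgf (mem_interior_integrableExpSet_latticeMeasure hv hε _)).differentiableAt.hasDerivAt
  have h2 : HasDerivAt (fun u : ℝ => u / v) (1 / v) u := (hasDerivAt_id u).div_const v
  have h3 : HasDerivAt (fun u : ℝ => u ^ 2 / (2 * v)) (2 * u / (2 * v)) u := by
    simpa using (hasDerivAt_pow 2 u).div_const (2 * v)
  convert! (h1.comp u h2).sub h3 using 1
  field_simp

lemma latticeScore_eq (hv : 0 < v) (hε : 0 < ε) (u : ℝ) :
    latticeScore v ε u = (deriv (cgf id (latticeMeasure v ε)) (u / v) - u) / v :=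
  (hasDerivAt_log_latticeGaussian_cgf hv hε u).deriv

lemma hasDerivAt_log_latticeGaussian (hv : 0 < v) (hε : 0 < ε) (u : ℝ) :
    HasDerivAt (fun u => Real.log (latticeGaussian v ε u)) (latticeScore v ε u) u := by
  rw [latticeScore_eq hv hε]
  exact hasDerivAt_log_latticeGaussian_cgf hv hε u

lemma hasDerivAt_latticeGaussian (hv : 0 < v) (hε : 0 < ε) (u : ℝ) :
    HasDerivAt (latticeGaussian v ε) (latticeGaussian v ε u * latticeScore v ε u) u := by
  have h := (hasDerivAt_log_latticeGaussian hv hε u).exp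
  simpa only [Real.exp_log (latticeGaussian_pos hv hε _)] using h

lemma latticeScore_periodic (v ε : ℝ) : Function.Periodic (latticeScore v ε) ε := by
  intro u
  rw [latticeScore, ← deriv_comp_add_const]
  simp only [latticeGaussian_periodic v ε _]

lemma latticeScore_neg (v ε u : ℝ) : latticeScore v ε (-u) = -latticeScore v ε u := by
  have h := deriv_comp_neg (fun u => Real.log (latticeGaussian v ε u)) u
  simp only [latticeGaussian_neg] at h
  rw [latticeScore, h, neg_neg]

lemma hasDerivAt_latticeScore (hv : 0 < v) (hε : 0 < ε) (u : ℝ) :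
    HasDerivAt (latticeScore v ε)
      (iteratedDeriv 2 (cgf id (latticeMeasure v ε)) (u / v) / v ^ 2 - 1 / v) u := by
  rw [show latticeScore v ε = _ from funext (latticeScore_eq hv hε)]
  have h1 : HasDerivAt (deriv (cgf id (latticeMeasure v ε)))
      (iteratedDeriv 2 (cgf id (latticeMeasure v ε)) (u / v)) (u / v) := by
    rw [iteratedDeriv_succ, iteratedDeriv_one]
    exact (analyticAt_cgf
      (mem_interior_integrableExpSet_latticeMeasure hv hε _)).deriv.differentiableAt.hasDerivAt
  have h2 : HasDerivAt (fun u : ℝ => u / v) (1 / v) u := (hasDerivAt_id u).div_const v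
  convert! ((h1.comp u h2).sub (hasDerivAt_id u)).div_const v using 1
  field_simp

lemma iteratedDeriv_two_cgf_latticeMeasure_nonneg (hv : 0 < v) (hε : 0 < ε) (t : ℝ) :
    0 ≤ iteratedDeriv 2 (cgf id (latticeMeasure v ε)) t := by
  rw [iteratedDeriv_two_cgf_eq_integral (mem_interior_integrableExpSet_latticeMeasure hv hε t)]
  exact div_nonneg (integral_nonneg fun y => by positivity) mgf_nonneg

/-- A cumulant generating function is convex: the derivative of the left side is a variance divided
by `v²`. -/
lemma monotone_latticeScore_add (hv : 0 < v) (hε : 0 < ε) :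
    Monotone fun u => latticeScore v ε u + u / v := by
  have hd : ∀ u, HasDerivAt (fun u => latticeScore v ε u + u / v)
      (iteratedDeriv 2 (cgf id (latticeMeasure v ε)) (u / v) / v ^ 2) u := fun u => by
    convert! (hasDerivAt_latticeScore hv hε u).add ((hasDerivAt_id u).div_const v) using 1
    ring
  refine monotone_of_deriv_nonneg (fun u => (hd u).differentiableAt) fun u => ?_
  rw [(hd u).deriv]
  have := iteratedDeriv_two_cgf_latticeMeasure_nonneg hv hε (u / v)
  positivity

/-- The score is odd and `ε`-periodic, so it vanishes at `0` and at `ε`. In between, monotonicity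
after adding `u / v` pins it between `-u / v` and `(ε - u) / v`. -/
lemma abs_latticeScore_le (hv : 0 < v) (hε : 0 < ε) (u : ℝ) : |latticeScore v ε u| ≤ ε / v := by
  obtain ⟨w, hw, huw⟩ := (latticeScore_periodic v ε).exists_mem_Ico₀ hε u
  rw [huw]
  have h0 : latticeScore v ε 0 = 0 := by
    have := latticeScore_neg v ε 0
    rw [neg_zero] at this
    linarith
  have hε0 : latticeScore v ε ε = 0 := by
    have := latticeScore_periodic v ε 0
    rwa [zero_add, h0] at this
  have h1 := monotone_latticeScore_add hv hε hw.1
  have h2 := monotone_latticeScore_add hv hε hw.2.le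
  simp only [h0, hε0, zero_div, zero_add] at h1 h2
  have h3 : 0 ≤ w / v := div_nonneg hw.1 hv.le
  have h4 : w / v ≤ ε / v := by gcongr; exact hw.2.le
  exact abs_le.2 ⟨by linarith, by linarith⟩

lemma latticeGaussian_le_exp_mul (hv : 0 < v) (hε : 0 < ε) (u w : ℝ) :
    latticeGaussian v ε w ≤ Real.exp (ε / v * |w - u|) * latticeGaussian v ε u := by
  have h := Convex.norm_image_sub_le_of_norm_hasDerivWithin_le (s := Set.univ)
    (f := fun u => Real.log (latticeGaussian v ε u)) (C := ε / v)
    (fun x _ => (hasDerivAt_log_latticeGaussian hv hε x).hasDerivWithinAt)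
    (fun x _ => abs_latticeScore_le hv hε x) convex_univ (Set.mem_univ u) (Set.mem_univ w)
  rw [Real.norm_eq_abs, Real.norm_eq_abs] at h
  have h2 := (le_abs_self _).trans h
  rw [← Real.exp_log (latticeGaussian_pos hv hε w),
    ← Real.exp_log (latticeGaussian_pos hv hε u), ← Real.exp_add]
  exact Real.exp_le_exp.2 (by linarith)

lemma sq_le_exp_add_exp_neg (x : ℝ) : x ^ 2 ≤ Real.exp x + Real.exp (-x) := by
  have h : (x / 2) ^ 2 ≤ Real.sinh (x / 2) ^ 2 := by
    rw [← sq_abs (x / 2), ← sq_abs (Real.sinh (x / 2)), Real.abs_sinh]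
    exact pow_le_pow_left₀ (abs_nonneg _) (Real.self_le_sinh_iff.2 (abs_nonneg _)) 2
  have h2 := Real.cosh_two_mul (x / 2)
  have h3 := Real.cosh_sq (x / 2)
  rw [mul_div_cancel₀ _ two_ne_zero, Real.cosh_eq] at h2
  linarith

/-- The square is at most `exp y + exp (-y)`, and multiplication by `exp (± y)` shifts the Gaussian
by `± v` at the cost of `exp (v / 2)`. Second moments of lattice sums thereby reduce to shifted
lattice sums. -/
lemma sq_mul_exp_le (hv : 0 < v) (y : ℝ) :
    y ^ 2 * Real.exp (-y ^ 2 / (2 * v))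
      ≤ Real.exp (v / 2) * (Real.exp (-(y - v) ^ 2 / (2 * v))
        + Real.exp (-(y + v) ^ 2 / (2 * v))) := by
  refine (mul_le_mul_of_nonneg_right (sq_le_exp_add_exp_neg y) (Real.exp_pos _).le).trans
    (le_of_eq ?_)
  rw [add_mul, mul_add, ← Real.exp_add, ← Real.exp_add, ← Real.exp_add, ← Real.exp_add]
  congr 2 <;> field_simp <;> ring

/-- The two sums shifted by `± v` exceed the unshifted one by at most `exp ε`, because the logarithm
of the lattice sum is `ε / v`-Lipschitz. -/
lemma summable_sq_mul_latticeGaussian (hv : 0 < v) (hε : 0 < ε) (u : ℝ) :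
    Summable (fun k : ℤ => (k * ε - u) ^ 2 * Real.exp (-(k * ε - u) ^ 2 / (2 * v))) ∧
    ∑' k : ℤ, (k * ε - u) ^ 2 * Real.exp (-(k * ε - u) ^ 2 / (2 * v))
      ≤ 2 * Real.exp (ε + v / 2) * latticeGaussian v ε u := by
  have hs : Summable fun k : ℤ => Real.exp (v / 2) * (Real.exp (-(k * ε - (u + v)) ^ 2 / (2 * v))
        + Real.exp (-(k * ε - (u - v)) ^ 2 / (2 * v))) :=
    ((summable_latticeGaussian hv hε _).add (summable_latticeGaussian hv hε _)).mul_left _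
  have hle : ∀ k : ℤ, (k * ε - u) ^ 2 * Real.exp (-(k * ε - u) ^ 2 / (2 * v))
      ≤ Real.exp (v / 2) * (Real.exp (-(k * ε - (u + v)) ^ 2 / (2 * v))
        + Real.exp (-(k * ε - (u - v)) ^ 2 / (2 * v))) := fun k => by
    convert sq_mul_exp_le hv (k * ε - u) using 6 <;> ring
  have hs' := Summable.of_nonneg_of_le (fun k : ℤ => by positivity) hle hs
  refine ⟨hs', (hs'.tsum_le_tsum hle hs).trans ?_⟩
  rw [tsum_mul_left, (summable_latticeGaussian hv hε _).tsum_add (summable_latticeGaussian hv hε _)]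
  change Real.exp (v / 2) * (latticeGaussian v ε (u + v) + latticeGaussian v ε (u - v)) ≤ _
  have h1 := latticeGaussian_le_exp_mul hv hε u (u + v)
  have h2 := latticeGaussian_le_exp_mul hv hε u (u - v)
  rw [show u + v - u = v by ring, abs_of_pos hv, div_mul_cancel₀ _ hv.ne'] at h1
  rw [show u - v - u = -v by ring, abs_neg, abs_of_pos hv, div_mul_cancel₀ _ hv.ne'] at h2
  rw [Real.exp_add]
  nlinarith [Real.exp_pos (v / 2)]

/-- A variance is at most the second moment about any point; the point chosen is `u`, where that
moment is already bounded. -/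
lemma iteratedDeriv_two_cgf_latticeMeasure_le (hv : 0 < v) (hε : 0 < ε) (u : ℝ) :
    iteratedDeriv 2 (cgf id (latticeMeasure v ε)) (u / v) ≤ 2 * Real.exp (ε + v / 2) := by
  have hmem := mem_interior_integrableExpSet_latticeMeasure hv hε (u / v)
  have hmgf : 0 < mgf id (latticeMeasure v ε) (u / v) := by
    rw [mgf_latticeMeasure hv hε]
    exact mul_pos (Real.exp_pos _) (latticeGaussian_pos hv hε u)
  have hs := summable_sq_mul_latticeGaussian hv hε u
  have hI := integrable_latticeMeasure hv u (g := fun y => (y - u) ^ 2) (ε := ε) (by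
    refine hs.1.congr fun k => ?_
    rw [Real.norm_of_nonneg (sq_nonneg _)])
  have h1 := integrable_pow_mul_exp_of_mem_interior_integrableExpSet hmem 1
  have h2 := integrable_pow_mul_exp_of_mem_interior_integrableExpSet hmem 2
  have h0 := integrable_pow_mul_exp_of_mem_interior_integrableExpSet hmem 0
  simp only [pow_one, pow_zero, one_mul, id] at h0 h1 h2
  have hexp : ∫ y, (y - u) ^ 2 * Real.exp (u / v * y) ∂(latticeMeasure v ε)
      = ∫ y, y ^ 2 * Real.exp (u / v * y) ∂(latticeMeasure v ε)
        - 2 * u * ∫ y, y * Real.exp (u / v * y) ∂(latticeMeasure v ε)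
        + u ^ 2 * mgf id (latticeMeasure v ε) (u / v) := by
    have e1 := integral_sub h2 (h1.const_mul (2 * u))
    have e2 := integral_add (h2.sub (h1.const_mul (2 * u))) (h0.const_mul (u ^ 2))
    simp only [Pi.sub_apply, integral_const_mul] at e1 e2
    rw [e1] at e2
    simp only [mgf, id]
    rw [← e2]
    refine integral_congr_ae (ae_of_all _ fun y => ?_)
    simp only
    ring
  have hle : ∫ y, (y - u) ^ 2 * Real.exp (u / v * y) ∂(latticeMeasure v ε)
      ≤ 2 * Real.exp (ε + v / 2) * mgf id (latticeMeasure v ε) (u / v) := by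
    rw [hI.2, mgf_latticeMeasure hv hε]
    nlinarith [hs.2, Real.exp_pos (u ^ 2 / (2 * v))]
  rw [iteratedDeriv_two_cgf hmem]
  set D := deriv (cgf id (latticeMeasure v ε)) (u / v) with hD
  have hD' : ∫ y, y * Real.exp (u / v * y) ∂(latticeMeasure v ε)
      = D * mgf id (latticeMeasure v ε) (u / v) := by
    rw [hD, deriv_cgf hmem, div_mul_cancel₀ _ hmgf.ne']
    rfl
  rw [sub_le_iff_le_add, div_le_iff₀ hmgf]
  simp only [id]
  rw [hD'] at hexp
  -- The second moment about `u` exceeds the variance by `(D - u)²`, where `D` is the mean of the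
  -- tilted measure.
  nlinarith [mul_nonneg hmgf.le (sq_nonneg (D - u))]

lemma exp_three_halves_le : Real.exp (3 / 2) ≤ 9 / 2 := by
  have h1 := Real.exp_one_lt_d9
  have h2 : Real.exp (3 / 2) ^ 2 = Real.exp 1 ^ 3 := by
    rw [← Real.exp_nat_mul, ← Real.exp_nat_mul]
    norm_num
  have h3 : Real.exp 1 ^ 3 ≤ 2.7182818286 ^ 3 := by gcongr
  refine abs_le_of_sq_le_sq' ?_ (by norm_num) |>.2
  rw [h2]
  exact h3.trans (by norm_num)

lemma exp_add_half_le (hv1 : v ≤ 1) (hε1 : ε ≤ 1) : Real.exp (ε + v / 2) ≤ 9 / 2 :=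
  (Real.exp_le_exp.2 (by linarith)).trans exp_three_halves_le

/-- The derivative is a variance over `v²` minus `1 / v`. The variance lies in `[0, 9]`, since `2
exp (ε + v / 2) ≤ 9`, and `1 / v ≤ 9 / v²` for `v ≤ 1`. -/
lemma abs_latticeScore_sub_le (hv : 0 < v) (hv1 : v ≤ 1) (hε : 0 < ε) (hε1 : ε ≤ 1) (u w : ℝ) :
    |latticeScore v ε w - latticeScore v ε u| ≤ 9 / v ^ 2 * |w - u| := by
  refine Convex.norm_image_sub_le_of_norm_hasDerivWithin_le (s := Set.univ)
    (fun x _ => (hasDerivAt_latticeScore hv hε x).hasDerivWithinAt)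
    (fun x _ => ?_) convex_univ (Set.mem_univ u) (Set.mem_univ w)
  have h1 := iteratedDeriv_two_cgf_latticeMeasure_nonneg hv hε (x / v)
  have h2 := (iteratedDeriv_two_cgf_latticeMeasure_le hv hε x).trans
    (mul_le_mul_of_nonneg_left (exp_add_half_le hv1 hε1) zero_le_two)
  have h3 : 1 / v ≤ 9 / v ^ 2 := by
    rw [div_le_div_iff₀ hv (by positivity)]
    nlinarith
  have h4 : iteratedDeriv 2 (cgf id (latticeMeasure v ε)) (x / v) / v ^ 2 ≤ 9 / v ^ 2 := by
    gcongr
    linarith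
  have h5 : 0 ≤ iteratedDeriv 2 (cgf id (latticeMeasure v ε)) (x / v) / v ^ 2 := by positivity
  have h6 : 0 < 1 / v := by positivity
  rw [Real.norm_eq_abs, abs_le]
  constructor <;> linarith

end Lattice

/-! ### Poisson summation: flatness of the lattice sum when `ε² / v` is small. -/

section Poisson

variable {v ε : ℝ}

/-- The decay rate of the nonconstant Fourier coefficients of `latticeGaussian v ε`. -/
def latticeDecay (v ε : ℝ) : ℝ := Real.exp (-(2 * Real.pi ^ 2 * v / ε ^ 2))

lemma latticeDecay_pos (v ε : ℝ) : 0 < latticeDecay v ε := Real.exp_pos _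

lemma tsum_exp_neg_mul_sq_le {a : ℝ} (ha : 0 < a) :
    ∑' n : ℤ, Real.exp (-Real.pi * a * n ^ 2) - 1
      ≤ 2 / (1 - Real.exp (-Real.pi * a)) * Real.exp (-Real.pi * a) := by
  have him : (Complex.I * a).im = a := by simp
  have h := norm_jacobiTheta_sub_one_le (τ := Complex.I * a) (by rw [him]; exact ha)
  rw [him] at h
  have h2 : jacobiTheta (Complex.I * a)
      = ((∑' n : ℤ, Real.exp (-Real.pi * a * n ^ 2) : ℝ) : ℂ) := by
    rw [jacobiTheta, Complex.ofReal_tsum]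
    refine tsum_congr fun n => ?_
    rw [Complex.ofReal_exp]
    congr 1
    push_cast
    linear_combination (Real.pi * n ^ 2 * a : ℂ) * Complex.I_mul_I
  rw [h2, ← Complex.ofReal_one, ← Complex.ofReal_sub, Complex.norm_real] at h
  exact (le_abs_self _).trans h

/-- By Poisson summation the normalized sum is `∑ exp (-π a n² + 2 π i n u / ε)` with `a = 2 π v /
ε²`. The term `n = 0` is `1`. The others are bounded in modulus by the tail of the theta series at
`i a`, which is at most `2 q / (1 - q) ≤ 4 q` for `q = exp (-π a) ≤ 1 / 2`. -/
lemma abs_latticeGaussian_sub_one_le (hv : 0 < v) (hε : 0 < ε) (hq : latticeDecay v ε ≤ 1 / 2)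
    (u : ℝ) :
    |ε / √(2 * Real.pi * v) * latticeGaussian v ε u - 1| ≤ 4 * latticeDecay v ε := by
  have hpi := Real.pi_pos
  set a : ℝ := 2 * Real.pi * v / ε ^ 2 with ha_def
  have ha : 0 < a := by positivity
  have hqa : Real.exp (-Real.pi * a) = latticeDecay v ε := by
    rw [latticeDecay, ha_def]
    congr 1
    ring
  set f : ℤ → ℂ := fun n =>
    Complex.exp (-Real.pi * a * n ^ 2 + 2 * Real.pi * (Complex.I * (u / ε)) * n) with hf
  have hnorm : ∀ n : ℤ, ‖f n‖ = Real.exp (-Real.pi * a * n ^ 2) := fun n => by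
    rw [hf, Complex.norm_exp]
    congr 1
    have : (-Real.pi * a * n ^ 2 + 2 * Real.pi * (Complex.I * (u / ε)) * n : ℂ)
        = ((-Real.pi * a * n ^ 2 : ℝ) : ℂ) + ((2 * Real.pi * (u / ε) * n : ℝ) : ℂ) * Complex.I := by
      push_cast
      ring
    rw [this]
    simp only [Complex.add_re, Complex.ofReal_re, Complex.re_ofReal_mul, Complex.I_re, mul_zero,
      add_zero]
  have hsum : Summable fun n : ℤ => Real.exp (-Real.pi * a * n ^ 2) := by
    have := summable_pow_mul_jacobiTheta₂_term_bound 0 ha 0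
    refine this.congr fun n => ?_
    rw [pow_zero, one_mul]
    congr 1
    ring
  have hfs : Summable f := Summable.of_norm (hsum.congr fun n => (hnorm n).symm)
  have hpoisson := Complex.tsum_exp_neg_quadratic (a := (a : ℂ)) (by simpa using ha)
    (Complex.I * (u / ε))
  have hrhs : (1 / (a : ℂ) ^ (1 / 2 : ℂ) * ∑' n : ℤ,
      Complex.exp (-Real.pi / a * (n + Complex.I * (Complex.I * (u / ε))) ^ 2))
      = ((ε / √(2 * Real.pi * v) * latticeGaussian v ε u : ℝ) : ℂ) := by
    have h1 : (1 / (a : ℂ) ^ (1 / 2 : ℂ)) = ((ε / √(2 * Real.pi * v) : ℝ) : ℂ) := by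
      have : ((a : ℂ) ^ (1 / 2 : ℂ)) = ((a ^ (1 / 2 : ℝ) : ℝ) : ℂ) := by
        rw [Complex.ofReal_cpow ha.le]
        norm_num
      rw [this, ← Real.sqrt_eq_rpow, ha_def, Real.sqrt_div (by positivity), Real.sqrt_sq hε.le]
      push_cast
      rw [one_div_div]
    rw [h1, Complex.ofReal_mul, latticeGaussian, Complex.ofReal_tsum]
    congr 1
    refine tsum_congr fun n => ?_
    rw [Complex.ofReal_exp]
    congr 1
    rw [ha_def]
    push_cast
    have hεc : (ε : ℂ) ≠ 0 := by exact_mod_cast hε.ne'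
    have hvc : (v : ℂ) ≠ 0 := by exact_mod_cast hv.ne'
    have hpc : (Real.pi : ℂ) ≠ 0 := by exact_mod_cast hpi.ne'
    rw [← mul_assoc, Complex.I_mul_I]
    field_simp
    ring
  rw [hrhs] at hpoisson
  have hδ : HasSum (fun n : ℤ => if n = 0 then (1 : ℝ) else 0) 1 := hasSum_ite_eq 0 1
  have hδc : HasSum (fun n : ℤ => if n = 0 then (1 : ℂ) else 0) 1 := hasSum_ite_eq 0 1
  have hterm : ∀ n : ℤ, ‖f n - if n = 0 then (1 : ℂ) else 0‖
      = Real.exp (-Real.pi * a * n ^ 2) - if n = 0 then (1 : ℝ) else 0 := fun n => by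
    by_cases hn : n = 0
    · subst hn
      simp [hf]
    · simp only [hn, if_false, sub_zero, hnorm]
  have h3 : ‖∑' n, f n - 1‖ ≤ ∑' n : ℤ, Real.exp (-Real.pi * a * n ^ 2) - 1 := by
    rw [← hδc.tsum_eq, ← hfs.tsum_sub hδc.summable, ← hδ.tsum_eq, ← hsum.tsum_sub hδ.summable,
      ← tsum_congr hterm]
    refine norm_tsum_le_tsum_norm ?_
    simp only [hterm]
    exact hsum.sub hδ.summable
  rw [hf, hpoisson, ← Complex.ofReal_one, ← Complex.ofReal_sub, Complex.norm_real,
    Real.norm_eq_abs] at h3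
  refine h3.trans ((tsum_exp_neg_mul_sq_le ha).trans ?_)
  rw [hqa]
  have hq0 := latticeDecay_pos v ε
  refine mul_le_mul_of_nonneg_right ?_ hq0.le
  rw [div_le_iff₀ (by linarith)]
  linarith

lemma abs_log_le_of_abs_sub_one_le {x δ : ℝ} (hδ : δ ≤ 1 / 2) (hx : |x - 1| ≤ δ) :
    |Real.log x| ≤ 2 * δ := by
  obtain ⟨h1, h2⟩ := abs_le.1 hx
  have hx0 : 0 < x := by linarith
  have h3 := Real.log_le_sub_one_of_pos hx0
  have h4 := Real.one_sub_inv_le_log_of_pos hx0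
  have h5 : -(2 * δ) ≤ 1 - x⁻¹ := by
    have : x⁻¹ ≤ 1 + 2 * δ := by
      rw [inv_le_iff_one_le_mul₀ hx0]
      nlinarith
    linarith
  rw [abs_le]
  constructor <;> linarith

/-- The normalizing constant cancels in the difference. The logarithm doubles the relative error `4
q ≤ 1 / 2`, and two points contribute, hence `16`. -/
lemma abs_log_latticeGaussian_sub_le (hv : 0 < v) (hε : 0 < ε) (hq : latticeDecay v ε ≤ 1 / 8)
    (u w : ℝ) :
    |Real.log (latticeGaussian v ε u) - Real.log (latticeGaussian v ε w)|
      ≤ 16 * latticeDecay v ε := by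
  have hc : ε / √(2 * Real.pi * v) ≠ 0 := by
    have := Real.pi_pos
    positivity
  have h : ∀ u, |Real.log (ε / √(2 * Real.pi * v)) + Real.log (latticeGaussian v ε u)|
      ≤ 2 * (4 * latticeDecay v ε) := fun u => by
    rw [← Real.log_mul hc (latticeGaussian_pos hv hε u).ne']
    exact abs_log_le_of_abs_sub_one_le (by linarith)
      (abs_latticeGaussian_sub_one_le hv hε (by linarith) u)
  have h1 := abs_le.1 (h u)
  have h2 := abs_le.1 (h w)
  rw [abs_le]
  constructor <;> linarith [h1.1, h1.2, h2.1, h2.2]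

/-- Small oscillation of a function does not bound its derivative, but convexity after adding `u² /
(2 v)` does: the derivative at `u` is at most the slope of the chord over `[u, u + r]`. The
oscillation contributes `16 q / r` and the quadratic at most `r`, as `v ≥ 1 / 2`. The choice `r =
√q` gives `17 √q`. -/
lemma latticeScore_le_of_decay (hv : 1 / 2 ≤ v) (hε : 0 < ε) (hq : latticeDecay v ε ≤ 1 / 8)
    (u : ℝ) : latticeScore v ε u ≤ 17 * √(latticeDecay v ε) := by
  have hv0 : 0 < v := by linarith
  have hq0 := latticeDecay_pos v ε
  set r := √(latticeDecay v ε) with hr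
  have hr0 : 0 < r := Real.sqrt_pos.2 hq0
  have hrq : r ^ 2 = latticeDecay v ε := Real.sq_sqrt hq0.le
  have hd : ∀ x, HasDerivAt (fun u => Real.log (latticeGaussian v ε u) + u ^ 2 / (2 * v))
      (latticeScore v ε x + x / v) x := fun x => by
    have h3 : HasDerivAt (fun u : ℝ => u ^ 2 / (2 * v)) (2 * x / (2 * v)) x := by
      simpa using (hasDerivAt_pow 2 x).div_const (2 * v)
    rw [mul_div_mul_left _ _ two_ne_zero] at h3
    exact (hasDerivAt_log_latticeGaussian hv0 hε x).add h3
  obtain ⟨c, hc, hc'⟩ := exists_hasDerivAt_eq_slope _ _ (show u < u + r by linarith)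
    (fun x _ => (hd x).continuousAt.continuousWithinAt) (fun x _ => hd x)
  have hmono := monotone_latticeScore_add hv0 hε hc.1.le
  simp only at hmono
  rw [hc', add_sub_cancel_left, le_div_iff₀ hr0] at hmono
  have hl := (abs_le.1 (abs_log_latticeGaussian_sub_le hv0 hε hq (u + r) u)).2
  have hsq : (u + r) ^ 2 / (2 * v) - u ^ 2 / (2 * v) = u / v * r + r ^ 2 / (2 * v) := by
    field_simp
    ring
  have hr2 : r ^ 2 / (2 * v) ≤ r ^ 2 := div_le_self (sq_nonneg _) (by linarith)
  have : latticeScore v ε u * r ≤ 17 * r * r := by nlinarith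
  exact le_of_mul_le_mul_right this hr0

lemma sq_latticeScore_le_of_decay (hv : 1 / 2 ≤ v) (hε : 0 < ε) (hq : latticeDecay v ε ≤ 1 / 8)
    (u : ℝ) : latticeScore v ε u ^ 2 ≤ 289 * latticeDecay v ε := by
  have h1 := latticeScore_le_of_decay hv hε hq u
  -- By oddness the upper bound at `-u` is the lower bound at `u`; `289 = 17²`.
  have h2 := latticeScore_le_of_decay hv hε hq (-u)
  rw [latticeScore_neg] at h2
  have h3 := sq_le_sq' (by linarith) h1
  rw [mul_pow, Real.sq_sqrt (latticeDecay_pos v ε).le] at h3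
  linarith

end Poisson

/-! ### The discretized Gaussian: mass, moments and smoothed density. -/

section DiscretizedGaussian

variable {ε : ℝ} {b : ℤˣ}

/-- The phase of the comb `gaussianComb ε b`. -/
def combPhase (ε : ℝ) (b : ℤˣ) : ℝ := ε / 2 * ((1 - ((b : ℤ) : ℝ)) / 2)

lemma gaussianComb_eq_sum (ε : ℝ) (b : ℤˣ) : gaussianComb ε b = Measure.sum fun k : ℤ =>
    gaussianPDF 0 1 (k * ε + combPhase ε b) • Measure.dirac (k * ε + combPhase ε b) := by
  rw [gaussianComb, diracComb, withDensity_sum]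
  simp only [dirac_withDensity]
  rfl

lemma gaussianPDFReal_zero_one (y : ℝ) :
    gaussianPDFReal 0 1 y = (√(2 * Real.pi))⁻¹ * Real.exp (-y ^ 2 / (2 * 1)) := by
  simp [gaussianPDFReal]

lemma hasSum_gaussianPDFReal_comb (hε : 0 < ε) (b : ℤˣ) :
    HasSum (fun k : ℤ => gaussianPDFReal 0 1 (k * ε + combPhase ε b))
      ((√(2 * Real.pi))⁻¹ * latticeGaussian 1 ε (-combPhase ε b)) := by
  have h := (summable_latticeGaussian one_pos hε (-combPhase ε b)).hasSum.mul_left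
    (√(2 * Real.pi))⁻¹
  simpa only [gaussianPDFReal_zero_one, latticeGaussian, sub_neg_eq_add] using h

lemma gaussianComb_univ (hε : 0 < ε) (b : ℤˣ) : gaussianComb ε b Set.univ
    = ENNReal.ofReal ((√(2 * Real.pi))⁻¹ * latticeGaussian 1 ε (-combPhase ε b)) := by
  have h := hasSum_gaussianPDFReal_comb hε b
  rw [gaussianComb_eq_sum, Measure.sum_apply _ MeasurableSet.univ, ← h.tsum_eq,
    ENNReal.ofReal_tsum_of_nonneg (fun _ => gaussianPDFReal_nonneg _ _ _) h.summable]
  simp [gaussianPDF]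

lemma gaussianComb_mass_pos (hε : 0 < ε) (b : ℤˣ) :
    0 < (√(2 * Real.pi))⁻¹ * latticeGaussian 1 ε (-combPhase ε b) :=
  mul_pos (by have := Real.pi_pos; positivity) (latticeGaussian_pos one_pos hε _)

lemma isProbabilityMeasure_discretizedGaussian (hε : 0 < ε) (b : ℤˣ) :
    IsProbabilityMeasure (discretizedGaussian ε b) := by
  constructor
  rw [discretizedGaussian, Measure.smul_apply, smul_eq_mul, gaussianComb_univ hε]
  exact ENNReal.inv_mul_cancel (ENNReal.ofReal_pos.2 (gaussianComb_mass_pos hε b)).ne' ENNReal.ofReal_ne_top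

lemma integral_discretizedGaussian (hε : 0 < ε) (b : ℤˣ) {g : ℝ → ℝ}
    (hg : Summable fun k : ℤ => ‖g (k * ε + combPhase ε b)‖
      * Real.exp (-(k * ε + combPhase ε b) ^ 2 / (2 * 1))) :
    Integrable g (discretizedGaussian ε b) ∧
    ∫ y, g y ∂(discretizedGaussian ε b) = (latticeGaussian 1 ε (-combPhase ε b))⁻¹
        * ∑' k : ℤ, g (k * ε + combPhase ε b)
          * Real.exp (-(k * ε + combPhase ε b) ^ 2 / (2 * 1)) := by
  have hs : Summable fun k : ℤ => (gaussianPDF 0 1 (k * ε + combPhase ε b)).toReal *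
      ‖g (k * ε + combPhase ε b)‖ := by
    refine (hg.mul_left (√(2 * Real.pi))⁻¹).congr fun k => ?_
    rw [toReal_gaussianPDF, gaussianPDFReal_zero_one]
    ring
  have hne : ∀ k : ℤ, gaussianPDF 0 1 (k * ε + combPhase ε b) ≠ ∞ := fun _ => gaussianPDF_ne_top
  have hI : Integrable g (gaussianComb ε b) := by
    rw [gaussianComb_eq_sum]
    exact integrable_sum_dirac (x := fun k : ℤ => (k : ℝ) * ε + combPhase ε b) hne hs
  have hE : ∫ y, g y ∂(gaussianComb ε b) = (√(2 * Real.pi))⁻¹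
      * ∑' k : ℤ, g (k * ε + combPhase ε b)
          * Real.exp (-(k * ε + combPhase ε b) ^ 2 / (2 * 1)) := by
    rw [gaussianComb_eq_sum, integral_sum_dirac_eq_tsum
      (x := fun k : ℤ => (k : ℝ) * ε + combPhase ε b) hne hs, ← tsum_mul_left]
    refine tsum_congr fun k => ?_
    rw [toReal_gaussianPDF, gaussianPDFReal_zero_one, smul_eq_mul]
    ring
  have hpos := gaussianComb_mass_pos hε b
  have hpi : (√(2 * Real.pi))⁻¹ ≠ 0 := by have := Real.pi_pos; positivity
  refine ⟨hI.smul_measure ?_, ?_⟩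
  · rw [gaussianComb_univ hε, ENNReal.inv_ne_top]
    exact (ENNReal.ofReal_pos.2 hpos).ne'
  · rw [discretizedGaussian, integral_smul_measure, gaussianComb_univ hε, ENNReal.toReal_inv,
      ENNReal.toReal_ofReal hpos.le, hE, smul_eq_mul, mul_inv, mul_assoc,
      mul_left_comm, inv_mul_cancel_left₀ hpi]

lemma summable_sq_comb (hε : 0 < ε) (b : ℤˣ) : Summable fun k : ℤ =>
    (k * ε + combPhase ε b) ^ 2 * Real.exp (-(k * ε + combPhase ε b) ^ 2 / (2 * 1)) := by
  simpa only [sub_neg_eq_add] using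
    (summable_sq_mul_latticeGaussian one_pos hε (-combPhase ε b)).1

lemma integrable_sq_discretizedGaussian (hε : 0 < ε) (b : ℤˣ) :
    Integrable (fun y => y ^ 2) (discretizedGaussian ε b) := by
  refine (integral_discretizedGaussian hε b ((summable_sq_comb hε b).congr fun k => ?_)).1
  rw [Real.norm_of_nonneg (sq_nonneg _)]

/-- This is the second moment bound for lattice sums with `v = 1`, since `2 exp (ε + 1 / 2) ≤ 2 * (9
/ 2)`. -/
lemma integral_sq_discretizedGaussian_le (hε : 0 < ε) (hε1 : ε ≤ 1) (b : ℤˣ) :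
    ∫ y, y ^ 2 ∂(discretizedGaussian ε b) ≤ 9 := by
  have h := (integral_discretizedGaussian hε b (g := fun y => y ^ 2)
    ((summable_sq_comb hε b).congr fun k => by rw [Real.norm_of_nonneg (sq_nonneg _)])).2
  have h2 := (summable_sq_mul_latticeGaussian one_pos hε (-combPhase ε b)).2
  simp only [sub_neg_eq_add] at h2
  have hpos := latticeGaussian_pos one_pos hε (-combPhase ε b)
  rw [h, inv_mul_le_iff₀ hpos]
  nlinarith [exp_add_half_le le_rfl hε1]

lemma memLp_id_discretizedGaussian (hε : 0 < ε) (b : ℤˣ) :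
    MemLp (fun y => y) 2 (discretizedGaussian ε b) :=
  (memLp_two_iff_integrable_sq measurable_id.aestronglyMeasurable).2
    (integrable_sq_discretizedGaussian hε b)

/-- The phase is `0` or `ε / 2`, so twice the phase is a lattice vector `m ε` and the comb is
symmetric about the origin; the reflection is `k ↦ -m - k`. Hence the second block has mean zero
whatever `f` is. -/
lemma integral_id_discretizedGaussian (hε : 0 < ε) (b : ℤˣ) :
    ∫ y, y ∂(discretizedGaussian ε b) = 0 := by
  have hs : Summable fun k : ℤ => ‖k * ε + combPhase ε b‖
      * Real.exp (-(k * ε + combPhase ε b) ^ 2 / (2 * 1)) := by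
    have h0 := (hasSum_gaussianPDFReal_comb hε b).summable.mul_left (√(2 * Real.pi))
    refine Summable.of_nonneg_of_le (fun k => by positivity) (fun k => ?_)
      ((summable_sq_comb hε b).add h0)
    have hpi : √(2 * Real.pi) ≠ 0 := by have := Real.pi_pos; positivity
    rw [gaussianPDFReal_zero_one, mul_inv_cancel_left₀ hpi, ← add_one_mul]
    refine mul_le_mul_of_nonneg_right ?_ (Real.exp_pos _).le
    rw [Real.norm_eq_abs, ← sq_abs (k * ε + combPhase ε b)]
    nlinarith [sq_nonneg (|k * ε + combPhase ε b| - 1)]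
  rw [(integral_discretizedGaussian hε b (g := fun y => y) hs).2]
  obtain ⟨m, hm⟩ : ∃ m : ℤ, 2 * combPhase ε b = m * ε := by
    rcases Int.units_eq_one_or b with rfl | rfl
    · exact ⟨0, by simp [combPhase]⟩
    · exact ⟨1, by simp [combPhase]; ring⟩
  have hrefl : ∑' k : ℤ, (k * ε + combPhase ε b)
        * Real.exp (-(k * ε + combPhase ε b) ^ 2 / (2 * 1))
      = -∑' k : ℤ, (k * ε + combPhase ε b)
        * Real.exp (-(k * ε + combPhase ε b) ^ 2 / (2 * 1)) := by
    conv_lhs => rw [← (Equiv.subLeft (-m)).tsum_eq]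
    rw [← tsum_neg]
    refine tsum_congr fun k => ?_
    have : (((Equiv.subLeft (-m)) k : ℤ) : ℝ) * ε + combPhase ε b = -(k * ε + combPhase ε b) := by
      simp only [Equiv.subLeft_apply]
      push_cast
      linear_combination hm
    rw [this, neg_sq, neg_mul]
  rw [show ∑' k : ℤ, (k * ε + combPhase ε b)
        * Real.exp (-(k * ε + combPhase ε b) ^ 2 / (2 * 1)) = 0 by linarith, mul_zero]

/-- Completing the square in the comb point `y`: given `x`, the Gaussian weight of `y` has mean `x /
(1 + σ²)` and variance `σ² / (1 + σ²)`, and the remaining factor is the Gaussian of variance `1 +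
σ²` in `x`. Summation over the comb gives the lattice sum. -/
lemma gaussianSmoothing_discretizedGaussian (hε : 0 < ε) (b : ℤˣ) {σ : ℝ} (hσ : 0 < σ) (x : ℝ) :
    gaussianSmoothing (discretizedGaussian ε b) σ x
      = ((√(2 * Real.pi) * σ)⁻¹ * (latticeGaussian 1 ε (-combPhase ε b))⁻¹)
        * (Real.exp (-x ^ 2 / (2 * (1 + σ ^ 2)))
          * latticeGaussian (σ ^ 2 / (1 + σ ^ 2)) ε (x / (1 + σ ^ 2) - combPhase ε b)) := by
  have hpdf : ∀ y, gaussianPDFReal y (σ ^ 2).toNNReal x * Real.exp (-y ^ 2 / (2 * 1))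
      = (√(2 * Real.pi) * σ)⁻¹ * (Real.exp (-x ^ 2 / (2 * (1 + σ ^ 2)))
        * Real.exp (-(y - x / (1 + σ ^ 2)) ^ 2 / (2 * (σ ^ 2 / (1 + σ ^ 2))))) := fun y => by
    rw [gaussianPDFReal, Real.coe_toNNReal _ (sq_nonneg σ), Real.sqrt_mul (by positivity),
      Real.sqrt_sq hσ.le, mul_assoc, ← Real.exp_add, ← Real.exp_add]
    congr 2
    field_simp
    ring
  have hs := (summable_latticeGaussian (show 0 < σ ^ 2 / (1 + σ ^ 2) by positivity) hε
    (x / (1 + σ ^ 2) - combPhase ε b)).mul_left (Real.exp (-x ^ 2 / (2 * (1 + σ ^ 2))))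
  have hs := hs.mul_left (√(2 * Real.pi) * σ)⁻¹
  simp only [← sub_add, sub_add_eq_add_sub] at hs
  rw [gaussianSmoothing, (integral_discretizedGaussian hε b
    (g := fun y => gaussianPDFReal y (σ ^ 2).toNNReal x) (by
      refine hs.congr fun k => ?_
      rw [Real.norm_of_nonneg (gaussianPDFReal_nonneg _ _ _), hpdf])).2]
  simp only [hpdf, tsum_mul_left, latticeGaussian]
  rw [mul_left_comm, mul_assoc]
  congr 5
  ext k
  congr 3
  ring

lemma hasDerivAt_gaussianSmoothing_discretizedGaussian (hε : 0 < ε) (b : ℤˣ) {σ : ℝ} (hσ : 0 < σ)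
    (x : ℝ) :
    HasDerivAt (gaussianSmoothing (discretizedGaussian ε b) σ)
      (gaussianSmoothing (discretizedGaussian ε b) σ x *
        ((latticeScore (σ ^ 2 / (1 + σ ^ 2)) ε (x / (1 + σ ^ 2) - combPhase ε b) - x)
          / (1 + σ ^ 2))) x := by
  rw [show gaussianSmoothing (discretizedGaussian ε b) σ = _ from
    funext (gaussianSmoothing_discretizedGaussian hε b hσ)]
  have h1 : HasDerivAt (fun x : ℝ => x / (1 + σ ^ 2) - combPhase ε b) (1 / (1 + σ ^ 2)) x :=
    ((hasDerivAt_id x).div_const _).sub_const _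
  have h2 := (hasDerivAt_latticeGaussian (show 0 < σ ^ 2 / (1 + σ ^ 2) by positivity) hε
    (x / (1 + σ ^ 2) - combPhase ε b)).comp x h1
  have h3 : HasDerivAt (fun x : ℝ => -x ^ 2 / (2 * (1 + σ ^ 2))) (-(x / (1 + σ ^ 2))) x := by
    have := ((hasDerivAt_pow 2 x).neg).div_const (2 * (1 + σ ^ 2))
    convert! this using 1
    field_simp
    norm_num
    ring
  convert! (h3.exp.mul h2).const_mul
    ((√(2 * Real.pi) * σ)⁻¹ * (latticeGaussian 1 ε (-combPhase ε b))⁻¹) using 1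
  simp only [Function.comp]
  field_simp
  ring

end DiscretizedGaussian

/-! ### The Gaussian marginals. -/

section GaussianComponent

lemma hasDerivAt_gaussianPDFReal (m : ℝ) {v : ℝ} (hv : 0 < v) (x : ℝ) :
    HasDerivAt (gaussianPDFReal m v.toNNReal)
      (gaussianPDFReal m v.toNNReal x * ((m - x) / v)) x := by
  unfold gaussianPDFReal
  rw [Real.coe_toNNReal _ hv.le]
  have h3 : HasDerivAt (fun x : ℝ => -(x - m) ^ 2 / (2 * v)) ((m - x) / v) x := by
    have := ((((hasDerivAt_id x).sub_const m).pow 2).neg).div_const (2 * v)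
    convert! this using 1
    field_simp
    norm_num
    ring
  convert! h3.exp.const_mul (√(2 * Real.pi * v))⁻¹ using 1
  ring

lemma gaussianSmoothing_gaussianReal (m : ℝ) {σ : ℝ} (hσ : 0 < σ) (x : ℝ) :
    gaussianSmoothing (gaussianReal m 1) σ x = gaussianPDFReal m (1 + σ ^ 2).toNNReal x := by
  -- Marginal of `x` times posterior of `y` given `x`; the posterior density then integrates to one.
  have hpdf : ∀ y, gaussianPDFReal m 1 y * gaussianPDFReal y (σ ^ 2).toNNReal x
      = gaussianPDFReal m (1 + σ ^ 2).toNNReal x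
        * gaussianPDFReal ((m * σ ^ 2 + x) / (1 + σ ^ 2)) (σ ^ 2 / (1 + σ ^ 2)).toNNReal y := by
    intro y
    have h1 : (√(2 * Real.pi * (1 : ℝ)))⁻¹ * (√(2 * Real.pi * σ ^ 2))⁻¹
        = (√(2 * Real.pi * (1 + σ ^ 2)))⁻¹ * (√(2 * Real.pi * (σ ^ 2 / (1 + σ ^ 2))))⁻¹ := by
      rw [← mul_inv, ← mul_inv, ← Real.sqrt_mul (by positivity), ← Real.sqrt_mul (by positivity)]
      congr 2
      field_simp
    simp only [gaussianPDFReal, Real.coe_toNNReal _ (sq_nonneg σ), NNReal.coe_one,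
      Real.coe_toNNReal _ (show 0 ≤ 1 + σ ^ 2 by positivity),
      Real.coe_toNNReal _ (show 0 ≤ σ ^ 2 / (1 + σ ^ 2) by positivity)]
    rw [mul_mul_mul_comm, h1, mul_mul_mul_comm (√(2 * Real.pi * (1 + σ ^ 2)))⁻¹ (Real.exp _),
      ← Real.exp_add, ← Real.exp_add]
    congr 2
    field_simp
    ring
  have hne : (σ ^ 2 / (1 + σ ^ 2)).toNNReal ≠ 0 := by
    have : 0 < σ ^ 2 / (1 + σ ^ 2) := by positivity
    simpa using this
  rw [gaussianSmoothing, integral_gaussianReal_eq_integral_smul one_ne_zero]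
  simp only [smul_eq_mul, hpdf]
  rw [integral_const_mul, integral_gaussianPDFReal_eq_one _ hne, mul_one]

end GaussianComponent

/-! ### Operations on ReLU networks: affine precomposition, carrying data along, rescaling. -/

namespace ReLUNet

variable {κ : Type}

lemma continuous_eval : {ι : Type} → [Fintype ι] → (N : ReLUNet κ ι) → Continuous N.eval
  | _, _, output W b => by
      simp only [eval]
      fun_prop
  | _, _, hidden W b t => by
      have h := continuous_eval t
      simp only [eval]
      exact h.comp (by fun_prop)

lemma ParamsBoundedBy.mono {B B' : ℝ} (hB : B ≤ B') : {ι : Type} → {N : ReLUNet κ ι} →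
    N.ParamsBoundedBy B → N.ParamsBoundedBy B'
  | _, output _ _, h => ⟨fun i j => (h.1 i j).trans hB, fun i => (h.2 i).trans hB⟩
  | _, hidden _ _ _, h =>
      ⟨fun i j => (h.1 i j).trans hB, fun i => (h.2.1 i).trans hB, h.2.2.mono hB⟩

/-- Precomposition of a network with the affine map `x ↦ A x + c`. -/
def precomp {ι ι' : Type} [Fintype ι] (A : Matrix ι ι' ℝ) (c : ι → ℝ) :
    ReLUNet κ ι → ReLUNet κ ι'
  | output W b => output (fun i j => ∑ k, W i k * A k j) (fun i => ∑ k, W i k * c k + b i)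
  | hidden W b t => hidden (fun i j => ∑ k, W i k * A k j) (fun i => ∑ k, W i k * c k + b i) t

section Precomp

variable {ι ι' : Type} [Fintype ι] [Fintype ι'] (A : Matrix ι ι' ℝ) (c : ι → ℝ)

omit [Fintype ι'] in
lemma depth_precomp (N : ReLUNet κ ι) : (N.precomp A c).depth = N.depth := by
  cases N <;> rfl

lemma sum_sum_mul_mul {η : Type} (W : Matrix η ι ℝ) (b : η → ℝ) (x : ι' → ℝ) (i : η) :
    ∑ j, (∑ k, W i k * A k j) * x j + (∑ k, W i k * c k + b i)
      = ∑ k, W i k * (∑ j, A k j * x j + c k) + b i := by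
  simp only [Finset.sum_mul, mul_add, Finset.sum_add_distrib, Finset.mul_sum]
  rw [Finset.sum_comm, add_assoc]
  simp only [mul_assoc]

lemma eval_precomp (N : ReLUNet κ ι) (x : ι' → ℝ) :
    (N.precomp A c).eval x = N.eval fun k => ∑ j, A k j * x j + c k := by
  cases N <;> simp only [precomp, eval, sum_sum_mul_mul]

lemma paramCount_precomp_le [Fintype κ] (N : ReLUNet κ ι) :
    (N.precomp A c).paramCount ≤ N.paramCount * (Fintype.card ι' + 1) := by
  cases N with
  | output W b =>
      simp only [precomp, paramCount]
      gcongr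
      exact le_mul_of_one_le_right (by omega) (by omega)
  | @hidden _ η _ _ W b t =>
      simp only [precomp, paramCount]
      rw [add_mul]
      gcongr
      · exact le_mul_of_one_le_right (by omega) (by omega)
      · exact le_mul_of_one_le_right (by omega) (by omega)

omit [Fintype ι'] in
lemma abs_sum_mul_le {B D : ℝ} {w a : ι → ℝ} (hw : ∀ k, |w k| ≤ B) (ha : ∀ k, |a k| ≤ D) :
    |∑ k, w k * a k| ≤ Fintype.card ι * (B * D) := by
  refine (Finset.abs_sum_le_sum_abs _ _).trans ?_
  rw [← nsmul_eq_mul, Fintype.card, ← Finset.sum_const]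
  refine Finset.sum_le_sum fun k _ => ?_
  rw [abs_mul]
  exact mul_le_mul (hw k) (ha k) (abs_nonneg _) ((abs_nonneg _).trans (hw k))

omit [Fintype ι'] in
lemma ParamsBoundedBy.precomp {B D B' : ℝ} {N : ReLUNet κ ι} (hN : N.ParamsBoundedBy B)
    {A : Matrix ι ι' ℝ} {c : ι → ℝ} (hA : ∀ k j, |A k j| ≤ D) (hc : ∀ k, |c k| ≤ D)
    (hB0 : 0 ≤ B) (hD0 : 0 ≤ D) (hB' : Fintype.card ι * (B * D) + B ≤ B') :
    (N.precomp A c).ParamsBoundedBy B' := by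
  have h0 : 0 ≤ Fintype.card ι * (B * D) := by positivity
  cases N with
  | output W b =>
      exact ⟨fun i j => (abs_sum_mul_le (hN.1 i) fun k => hA k j).trans (by linarith),
        fun i => (abs_add_le _ _).trans
          ((add_le_add (abs_sum_mul_le (hN.1 i) hc) (hN.2 i)).trans hB')⟩
  | hidden W b t =>
      exact ⟨fun i j => (abs_sum_mul_le (hN.1 i) fun k => hA k j).trans (by linarith),
        fun i => (abs_add_le _ _).trans
          ((add_le_add (abs_sum_mul_le (hN.1 i) hc) (hN.2.1 i)).trans hB'),
        hN.2.2.mono (by linarith)⟩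

end Precomp

section Carry

variable {γ μ : Type} [Fintype γ] [DecidableEq γ] [Fintype κ]

/-- The network `N` applied to the first part of the input while the (nonnegative) second part is
carried through the hidden layers, followed by the network `T`. -/
def carry (T : ReLUNet μ (κ ⊕ γ)) : {ι : Type} → ReLUNet κ ι → ReLUNet μ (ι ⊕ γ)
  | _, output W b => T.precomp (Matrix.fromBlocks W 0 0 1) (Sum.elim b 0)
  | _, @hidden _ _ η _ _ W b t =>
      hidden (η := η ⊕ γ) (Matrix.fromBlocks W 0 0 1) (Sum.elim b 0) (carry T t)

variable (T : ReLUNet μ (κ ⊕ γ))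

lemma fromBlocks_affine {η ι : Type} [Fintype ι] (W : Matrix η ι ℝ) (b : η → ℝ) (x : ι → ℝ)
    (z : γ → ℝ) (k : η ⊕ γ) :
    ∑ j, Matrix.fromBlocks W 0 0 (1 : Matrix γ γ ℝ) k j * Sum.elim x z j
        + (Sum.elim b 0 : η ⊕ γ → ℝ) k
      = Sum.elim (fun i => ∑ j, W i j * x j + b i) z k := by
  rcases k with i | k
  · simp
  · simp [Matrix.one_apply]

/-- ReLU fixes nonnegative numbers, so an identity block transports `z` through every hidden layer
of `N`. -/
lemma eval_carry : {ι : Type} → [Fintype ι] → (N : ReLUNet κ ι) → (x : ι → ℝ) → {z : γ → ℝ} →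
    (∀ k, 0 ≤ z k) → (carry T N).eval (Sum.elim x z) = T.eval (Sum.elim (N.eval x) z)
  | _, _, output W b, x, z, hz => by
      simp only [carry, eval_precomp, eval, fromBlocks_affine]
  | _, _, @hidden _ _ η _ _ W b t, x, z, hz => by
      simp only [carry, eval, fromBlocks_affine]
      rw [← eval_carry t _ hz]
      congr 1
      ext k
      rcases k with i | k
      · rfl
      · simp [hz k]

/-- The output layer of `N` is merged into the first affine map of `T`, which saves one affine map.
-/
lemma depth_carry : {ι : Type} → (N : ReLUNet κ ι) →
    (carry T N).depth + 1 = N.depth + T.depth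
  | _, output W b => by
      simp only [carry, depth_precomp, depth]
      omega
  | _, hidden W b t => by
      have := depth_carry t
      simp only [carry, depth]
      omega

lemma paramCount_carry_le [Fintype μ] : {ι : Type} → [Fintype ι] → (N : ReLUNet κ ι) →
    (carry T N).paramCount ≤ (1 + Fintype.card γ) ^ 2 * N.paramCount
      + T.paramCount * (1 + Fintype.card γ) * (N.paramCount + Fintype.card ι + 1)
  | ι, _, output W b => by
      simp only [carry]
      refine (paramCount_precomp_le _ _ T).trans ?_
      rw [Fintype.card_sum, mul_assoc]
      refine le_trans ?_ (Nat.le_add_left _ _)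
      refine Nat.mul_le_mul_left _ ?_
      nlinarith [Nat.zero_le (paramCount (output W b)),
        Nat.zero_le (Fintype.card γ * Fintype.card ι),
        Nat.zero_le (Fintype.card γ * paramCount (output W b))]
  | ι, _, @hidden _ _ η _ _ W b t => by
      have h := paramCount_carry_le t
      simp only [carry, paramCount, Fintype.card_sum] at h ⊢
      -- Widening a layer by `g` neurons costs at most a factor `1 + g` only because the layer is
      -- nonempty: `e + g ≤ (1 + g) e` needs `1 ≤ e`.
      have hη : 1 ≤ Fintype.card η := Fintype.card_pos
      generalize Fintype.card γ = g at *
      generalize Fintype.card η = e at *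
      generalize Fintype.card ι = i at *
      generalize t.paramCount = p at *
      generalize T.paramCount = q at *
      have h1 : (e + g) * (i + g + 1) ≤ (1 + g) ^ 2 * (e * (i + 1)) := by
        have a1 : e + g ≤ (1 + g) * e := by nlinarith
        have a2 : i + g + 1 ≤ (1 + g) * (i + 1) := by nlinarith [Nat.zero_le (g * i)]
        calc _ ≤ ((1 + g) * e) * ((1 + g) * (i + 1)) := Nat.mul_le_mul a1 a2
          _ = _ := by ring
      have h2 : q * (1 + g) * (p + e + 1) ≤ q * (1 + g) * (e * (i + 1) + p + i + 1) := by
        refine Nat.mul_le_mul_left _ ?_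
        nlinarith [Nat.zero_le (e * i)]
      calc _ ≤ (1 + g) ^ 2 * (e * (i + 1)) + ((1 + g) ^ 2 * p + q * (1 + g) * (p + e + 1)) :=
            add_le_add h1 h
        _ ≤ (1 + g) ^ 2 * (e * (i + 1)) + ((1 + g) ^ 2 * p
            + q * (1 + g) * (e * (i + 1) + p + i + 1)) := by omega
        _ = _ := by ring

omit [Fintype γ] in
lemma abs_fromBlocks_le {η ι : Type} {W : Matrix η ι ℝ} {B : ℝ} (hB : 1 ≤ B)
    (hW : ∀ i j, |W i j| ≤ B) (k : η ⊕ γ) (j : ι ⊕ γ) :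
    |Matrix.fromBlocks W 0 0 (1 : Matrix γ γ ℝ) k j| ≤ B := by
  rcases k with i | k <;> rcases j with j | j
  · exact hW i j
  · simpa using zero_le_one.trans hB
  · simpa using zero_le_one.trans hB
  · rw [Matrix.fromBlocks_apply₂₂, Matrix.one_apply]
    split_ifs
    · simpa using hB
    · simpa using zero_le_one.trans hB

omit [Fintype γ] [DecidableEq γ] in
lemma abs_sumElim_zero_le {η : Type} {b : η → ℝ} {B : ℝ} (hB : 1 ≤ B)
    (hb : ∀ i, |b i| ≤ B) (k : η ⊕ γ) : |(Sum.elim b 0 : η ⊕ γ → ℝ) k| ≤ B := by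
  rcases k with i | k
  · exact hb i
  · simpa using zero_le_one.trans hB

lemma ParamsBoundedBy.carry {B D B' : ℝ} {T : ReLUNet μ (κ ⊕ γ)} (hT : T.ParamsBoundedBy D)
    (hB : 1 ≤ B) (hD : 0 ≤ D)
    (hB' : (Fintype.card κ + Fintype.card γ) * (D * B) + D ≤ B') (hBB' : B ≤ B') :
    {ι : Type} → {N : ReLUNet κ ι} → N.ParamsBoundedBy B → (carry T N).ParamsBoundedBy B'
  | _, output _ _, h => by
      refine hT.precomp (abs_fromBlocks_le hB h.1) (abs_sumElim_zero_le hB h.2) hD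
        (by linarith) ?_
      rw [Fintype.card_sum]
      push_cast
      exact hB'
  | _, hidden _ _ _, h =>
      ⟨fun i j => (abs_fromBlocks_le hB h.1 i j).trans hBB',
        fun i => (abs_sumElim_zero_le hB h.2.1 i).trans hBB',
        ParamsBoundedBy.carry hT hB hD hB' hBB' h.2.2⟩

end Carry

/-- Rescaling of the output of a network. -/
def scaleOutput (r : ℝ) : {ι : Type} → ReLUNet κ ι → ReLUNet κ ι
  | _, output W b => output (fun i j => r * W i j) (fun i => r * b i)
  | _, hidden W b t => hidden W b (scaleOutput r t)

lemma eval_scaleOutput (r : ℝ) : {ι : Type} → [Fintype ι] → (N : ReLUNet κ ι) → (x : ι → ℝ) →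
    (scaleOutput r N).eval x = fun i => r * N.eval x i
  | _, _, output W b, x => by
      ext i
      simp only [scaleOutput, eval, mul_add, Finset.mul_sum, mul_assoc]
  | _, _, hidden W b t, x => by
      simp only [scaleOutput, eval, eval_scaleOutput r t]

lemma paramCount_scaleOutput [Fintype κ] (r : ℝ) : {ι : Type} → [Fintype ι] →
    (N : ReLUNet κ ι) → (scaleOutput r N).paramCount = N.paramCount
  | _, _, output W b => rfl
  | _, _, hidden W b t => by simp only [scaleOutput, paramCount, paramCount_scaleOutput r t]

lemma ParamsBoundedBy.scaleOutput {r B : ℝ} (hr : 1 ≤ r) (hB : 0 ≤ B) : {ι : Type} →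
    {N : ReLUNet κ ι} → N.ParamsBoundedBy B → (scaleOutput r N).ParamsBoundedBy (r * B)
  | _, output _ _, h => by
      have h1 : ∀ {w : ℝ}, |w| ≤ B → |r * w| ≤ r * B := fun hw => by
        rw [abs_mul, abs_of_nonneg (by linarith)]
        gcongr
      exact ⟨fun i j => h1 (h.1 i j), fun i => h1 (h.2 i)⟩
  | _, hidden _ _ _, h =>
      have h1 : B ≤ r * B := le_mul_of_one_le_left hB hr
      ⟨fun i j => (h.1 i j).trans h1, fun i => (h.2.1 i).trans h1, h.2.2.scaleOutput hr hB⟩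

end ReLUNet

/-! ### Piecewise linear interpolation and the networks that compute it. -/

section PiecewiseLinear

/-- The piecewise linear function with value `p` on `(-∞, t₀]`, slope `c m` on
`[t₀ + m δ, t₀ + (m + 1) δ]` for `m < M`, and slope `0` beyond. -/
def piecewiseLinear (p : ℝ) (c : ℕ → ℝ) (t₀ δ : ℝ) (M : ℕ) (t : ℝ) : ℝ :=
  p + ∑ m ∈ Finset.range M, c m * (max (t - (t₀ + m * δ)) 0 - max (t - (t₀ + (m + 1) * δ)) 0)

/-- The slopes of the piecewise linear interpolation of `g`. -/
def interpSlope (g : ℝ → ℝ) (t₀ δ : ℝ) (m : ℕ) : ℝ :=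
  (g (t₀ + (m + 1) * δ) - g (t₀ + m * δ)) / δ

variable {g : ℝ → ℝ} {Λ δ : ℝ}

lemma abs_interpSlope_le (hg : ∀ x y, |g x - g y| ≤ Λ * |x - y|) (hδ : 0 < δ) (t₀ : ℝ) (m : ℕ) :
    |interpSlope g t₀ δ m| ≤ Λ := by
  rw [interpSlope, abs_div, abs_of_pos hδ, div_le_iff₀ hδ]
  refine (hg _ _).trans (le_of_eq ?_)
  rw [show t₀ + (m + 1) * δ - (t₀ + m * δ) = δ by ring, abs_of_pos hδ]

/-- To the right of the grid every ramp has its full height `δ`, and the increments telescope. -/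
lemma piecewiseLinear_interp_of_ge (hδ : 0 < δ) (t₀ : ℝ) (M : ℕ) {t : ℝ} (ht : t₀ + M * δ ≤ t) :
    piecewiseLinear (g t₀) (interpSlope g t₀ δ) t₀ δ M t = g (t₀ + M * δ) := by
  induction M with
  | zero => simp [piecewiseLinear]
  | succ M ih =>
    push_cast at ht ⊢
    have h1 := ih (by nlinarith)
    unfold piecewiseLinear at h1 ⊢
    rw [Finset.sum_range_succ, ← add_assoc, h1, max_eq_left (by nlinarith), max_eq_left (by linarith),
      interpSlope]
    field_simp
    ring

/-- The interpolant is constant outside the grid, so it is compared with `g` at the clamped point.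
On the last cell the interpolant and `g` each move by at most `Λ δ` from their common value at the
left node; earlier cells are covered by induction. -/
lemma abs_piecewiseLinear_interp_sub_le (hg : ∀ x y, |g x - g y| ≤ Λ * |x - y|) (hΛ : 0 ≤ Λ)
    (hδ : 0 < δ) (t₀ : ℝ) (M : ℕ) (t : ℝ) :
    |piecewiseLinear (g t₀) (interpSlope g t₀ δ) t₀ δ M t - g (max t₀ (min t (t₀ + M * δ)))|
      ≤ 2 * Λ * δ := by
  induction M with
  | zero =>
    simp only [piecewiseLinear, Finset.range_zero, Finset.sum_empty, add_zero, Nat.cast_zero,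
      zero_mul]
    rw [max_eq_left (min_le_right _ _), sub_self, abs_zero]
    positivity
  | succ M ih =>
    have hM : (0 : ℝ) ≤ M * δ := by positivity
    rcases le_total t (t₀ + M * δ) with ht | ht
    · have h1 : piecewiseLinear (g t₀) (interpSlope g t₀ δ) t₀ δ (M + 1) t
          = piecewiseLinear (g t₀) (interpSlope g t₀ δ) t₀ δ M t := by
        unfold piecewiseLinear
        rw [Finset.sum_range_succ, max_eq_right (by linarith), max_eq_right (by nlinarith)]
        ring
      rw [min_eq_left ht] at ih
      push_cast
      rwa [h1, min_eq_left (by nlinarith)]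
    · have h1 := piecewiseLinear_interp_of_ge (g := g) hδ t₀ M ht
      have h2 : piecewiseLinear (g t₀) (interpSlope g t₀ δ) t₀ δ (M + 1) t
          = g (t₀ + M * δ) + interpSlope g t₀ δ M
            * (max (t - (t₀ + M * δ)) 0 - max (t - (t₀ + (M + 1) * δ)) 0) := by
        rw [← h1]
        unfold piecewiseLinear
        rw [Finset.sum_range_succ, add_assoc]
      have h3 : |max (t - (t₀ + M * δ)) 0 - max (t - (t₀ + (M + 1) * δ)) 0| ≤ δ := by
        rw [max_eq_left (by linarith), abs_le]
        rcases le_total (t - (t₀ + (M + 1) * δ)) 0 with h | h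
        · rw [max_eq_right h]
          constructor <;> nlinarith
        · rw [max_eq_left h]
          constructor <;> nlinarith
      have h4 : |t₀ + M * δ - max t₀ (min t (t₀ + (M + 1) * δ))| ≤ δ := by
        rcases le_total t (t₀ + (M + 1) * δ) with h | h
        · rw [min_eq_left h, max_eq_right (by linarith), abs_le]
          constructor <;> nlinarith
        · rw [min_eq_right h, max_eq_right (by nlinarith), abs_le]
          constructor <;> nlinarith
      push_cast
      rw [h2]
      have h5 := hg (t₀ + M * δ) (max t₀ (min t (t₀ + (M + 1) * δ)))
      have h6 : |interpSlope g t₀ δ M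
            * (max (t - (t₀ + M * δ)) 0 - max (t - (t₀ + (M + 1) * δ)) 0)| ≤ Λ * δ := by
        rw [abs_mul]
        exact mul_le_mul (abs_interpSlope_le hg hδ _ _) h3 (abs_nonneg _) hΛ
      have h7 : Λ * |t₀ + M * δ - max t₀ (min t (t₀ + (M + 1) * δ))| ≤ Λ * δ := by gcongr
      rw [add_sub_right_comm]
      exact (abs_add_le _ _).trans (by linarith)

end PiecewiseLinear

/-- The sign `1` or `-1` of a Boolean. -/
def boolSign (β : Bool) : ℝ := if β then 1 else -1

/-- The identity `z = ReLU z - ReLU (-z)`, which lets linear forms pass through a hidden layer. -/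
lemma sum_boolSign_mul_max (z : ℝ) : ∑ β, boolSign β * max (boolSign β * z) 0 = z := by
  simp [boolSign, ← sub_eq_add_neg]

lemma abs_boolSign (β : Bool) : |boolSign β| = 1 := by
  cases β <;> simp [boolSign]

/-- A network with one hidden layer whose output coordinate `o` is a piecewise linear function of
the affine form `A o · z + c o`, plus the linear form `D o · z`. -/
def piecewiseLinearNet {κ α : Type} [Fintype κ] [Fintype α] [DecidableEq κ] [DecidableEq α]
    [Nonempty α] (A D : κ → α → ℝ) (c p : κ → ℝ) (s : κ → ℕ → ℝ) (t₀ δ : ℝ) (M : ℕ) :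
    ReLUNet κ α :=
  -- A neuron `(o, m, β)` is the ramp that starts at the left (`β = true`) or right (`β = false`)
  -- end of cell `m`; a neuron `(k, β)` holds the positive or negative part of `z k`.
  .hidden (η := (κ × Fin M × Bool) ⊕ (α × Bool))
    (fun h k => Sum.elim (fun q => A q.1 k) (fun q => if q.1 = k then boolSign q.2 else 0) h)
    (Sum.elim (fun q => c q.1 - (t₀ + (q.2.1 + if q.2.2 then (0 : ℝ) else 1) * δ)) 0)
    (.output (fun o h => Sum.elim (fun q => if o = q.1 then boolSign q.2.2 * s o q.2.1 else 0)
      (fun q => boolSign q.2 * D o q.1) h) p)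

section PiecewiseLinearNet

variable {κ α : Type} [Fintype κ] [Fintype α] [DecidableEq κ] [DecidableEq α]
    [Nonempty α] (A D : κ → α → ℝ) (c p : κ → ℝ) (s : κ → ℕ → ℝ) (t₀ δ : ℝ) (M : ℕ)

lemma eval_piecewiseLinearNet (z : α → ℝ) (o : κ) :
    (piecewiseLinearNet A D c p s t₀ δ M).eval z o
      = piecewiseLinear (p o) (s o) t₀ δ M (∑ k, A o k * z k + c o) + ∑ k, D o k * z k := by
  simp only [piecewiseLinearNet, ReLUNet.eval, Fintype.sum_sum_type, Sum.elim_inl, Sum.elim_inr,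
    Pi.zero_apply, add_zero, ite_mul, zero_mul, Finset.sum_ite_eq, Finset.mem_univ, if_true]
  have h1 : ∑ q : α × Bool, boolSign q.2 * D o q.1 * max (boolSign q.2 * z q.1) 0
      = ∑ k, D o k * z k := by
    rw [Fintype.sum_prod_type]
    refine Finset.sum_congr rfl fun k _ => ?_
    conv_rhs => rw [← sum_boolSign_mul_max (z k), Finset.mul_sum]
    exact Finset.sum_congr rfl fun β _ => by ring
  rw [h1, Fintype.sum_prod_type, Finset.sum_eq_single o (fun o' _ ho => by
    simp [ho.symm]) (by simp)]
  simp only [if_true]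
  rw [Fintype.sum_prod_type, piecewiseLinear, Finset.sum_range]
  rw [add_right_comm, add_comm (p o)]
  congr 2
  refine Finset.sum_congr rfl fun m _ => ?_
  simp only [Fintype.sum_bool, boolSign, if_true, Bool.false_eq_true, if_false, add_zero]
  ring_nf

lemma paramCount_piecewiseLinearNet : (piecewiseLinearNet A D c p s t₀ δ M).paramCount
    = (Fintype.card κ * (M * 2) + Fintype.card α * 2) * (Fintype.card α + 1)
      + Fintype.card κ * (Fintype.card κ * (M * 2) + Fintype.card α * 2 + 1) := by
  simp [piecewiseLinearNet, ReLUNet.paramCount]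

variable {A D c p s t₀ δ M}

lemma paramsBoundedBy_piecewiseLinearNet {B : ℝ} (hB : 1 ≤ B) (hA : ∀ o k, |A o k| ≤ B)
    (hD : ∀ o k, |D o k| ≤ B) (hc : ∀ o, |c o| + |t₀| + M * |δ| ≤ B) (hp : ∀ o, |p o| ≤ B)
    (hs : ∀ o m, |s o m| ≤ B) :
    (piecewiseLinearNet A D c p s t₀ δ M).ParamsBoundedBy B := by
  have hB0 : 0 ≤ B := zero_le_one.trans hB
  refine ⟨?_, ?_, ?_, hp⟩
  · rintro (⟨o, m, β⟩ | ⟨k', β⟩) k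
    · exact hA o k
    · simp only [Sum.elim_inr]
      split_ifs
      · rw [abs_boolSign]
        exact hB
      · simpa using hB0
  · rintro (⟨o, m, β⟩ | ⟨k', β⟩)
    · simp only [Sum.elim_inl]
      refine le_trans ?_ (hc o)
      have hm : ((m : ℕ) : ℝ) + 1 ≤ M := by exact_mod_cast m.2
      have h1 : |((m : ℕ) + if β then (0 : ℝ) else 1) * δ| ≤ M * |δ| := by
        rw [abs_mul]
        gcongr
        rw [abs_of_nonneg (by split_ifs <;> positivity)]
        split_ifs <;> linarith
      have h2 := abs_sub (c o) (t₀ + ((m : ℕ) + if β then (0 : ℝ) else 1) * δ)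
      have h3 := abs_add_le t₀ (((m : ℕ) + if β then (0 : ℝ) else 1) * δ)
      linarith
    · simpa using hB0
  · rintro o (⟨o', m, β⟩ | ⟨k', β⟩)
    · simp only [Sum.elim_inl]
      split_ifs
      · rw [abs_mul, abs_boolSign, one_mul]
        exact hs _ _
      · simpa using hB0
    · simp only [Sum.elim_inr]
      rw [abs_mul, abs_boolSign, one_mul]
      exact hD _ _

end PiecewiseLinearNet

/-! ### The hard distribution as a mixture of products. -/

section HardMarginals

variable {d d' : ℕ} (f : (Fin d → ℤˣ) → Fin d' → ℤˣ) (R ε : ℝ)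

/-- The marginals of the product distribution `hardComponent f R ε s`. -/
def hardMarginal (s : Fin d → ℤˣ) : Fin d ⊕ Fin d' → Measure ℝ :=
  Sum.elim (fun i => gaussianReal (R * ((s i : ℤ) : ℝ)) 1) (fun j => discretizedGaussian ε (f s j))

/-- The scores of the smoothed marginals of `hardComponent f R ε s`. -/
def hardMarginalScore (σ : ℝ) (s : Fin d → ℤˣ) : Fin d ⊕ Fin d' → ℝ → ℝ :=
  Sum.elim (fun i x => (R * ((s i : ℤ) : ℝ) - x) / (1 + σ ^ 2))
    (fun j x => (latticeScore (σ ^ 2 / (1 + σ ^ 2)) ε (x / (1 + σ ^ 2) - combPhase ε (f s j)) - x)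
      / (1 + σ ^ 2))

lemma hardDist_eq : hardDist f R ε = productMixture ((2 : ℝ≥0∞) ^ d)⁻¹ (hardMarginal f R ε) := rfl

lemma hardWeight_ne_zero (d : ℕ) : ((2 : ℝ≥0∞) ^ d)⁻¹ ≠ 0 := by simp

lemma hardWeight_ne_top (d : ℕ) : ((2 : ℝ≥0∞) ^ d)⁻¹ ≠ ∞ := by simp

lemma card_mul_hardWeight (d : ℕ) :
    (Fintype.card (Fin d → ℤˣ) : ℝ≥0∞) * ((2 : ℝ≥0∞) ^ d)⁻¹ = 1 := by
  rw [Fintype.card_fun, Fintype.card_units_int, Fintype.card_fin]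
  push_cast
  exact ENNReal.mul_inv_cancel (by simp) (by simp)

variable {ε}

lemma isProbabilityMeasure_hardMarginal (hε : 0 < ε) (s : Fin d → ℤˣ) (i : Fin d ⊕ Fin d') :
    IsProbabilityMeasure (hardMarginal f R ε s i) := by
  rcases i with i | j
  · simp only [hardMarginal, Sum.elim_inl]
    infer_instance
  · exact isProbabilityMeasure_discretizedGaussian hε _

lemma hasDerivAt_gaussianSmoothing_hardMarginal (hε : 0 < ε) {σ : ℝ} (hσ : 0 < σ)
    (s : Fin d → ℤˣ) (i : Fin d ⊕ Fin d') (x : ℝ) :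
    HasDerivAt (gaussianSmoothing (hardMarginal f R ε s i) σ)
      (gaussianSmoothing (hardMarginal f R ε s i) σ x * hardMarginalScore f R ε σ s i x) x := by
  rcases i with i | j
  · simp only [hardMarginal, hardMarginalScore, Sum.elim_inl]
    rw [show gaussianSmoothing (gaussianReal (R * ((s i : ℤ) : ℝ)) 1) σ = _ from
      funext (gaussianSmoothing_gaussianReal _ hσ)]
    exact hasDerivAt_gaussianPDFReal _ (by positivity) x
  · exact hasDerivAt_gaussianSmoothing_discretizedGaussian hε _ hσ x

lemma continuous_latticeScore {v : ℝ} (hv : 0 < v) (hε : 0 < ε) :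
    Continuous (latticeScore v ε) :=
  continuous_iff_continuousAt.2 fun u => (hasDerivAt_latticeScore hv hε u).continuousAt

lemma measurable_hardMarginalScore (hε : 0 < ε) {σ : ℝ} (hσ : 0 < σ) (s : Fin d → ℤˣ)
    (i : Fin d ⊕ Fin d') : Measurable (hardMarginalScore f R ε σ s i) := by
  rcases i with i | j
  · simp only [hardMarginalScore, Sum.elim_inl]
    fun_prop
  · simp only [hardMarginalScore, Sum.elim_inr]
    have := (continuous_latticeScore (v := σ ^ 2 / (1 + σ ^ 2)) (by positivity) hε).measurable
    fun_prop

end HardMarginals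

/-! ### Tail and moment estimates for the smoothed marginals. -/

section Tails

lemma smoothedReal_gaussianReal (m : ℝ) {σ : ℝ} (hσ : 0 < σ) :
    smoothedReal (gaussianReal m 1) σ = gaussianReal m (1 + σ ^ 2).toNNReal := by
  have hne : (1 + σ ^ 2).toNNReal ≠ 0 := by
    have : 0 < 1 + σ ^ 2 := by positivity
    simpa using this
  rw [smoothedReal, gaussianReal_of_var_ne_zero _ hne]
  simp only [gaussianSmoothing_gaussianReal m hσ]
  rfl

lemma unit_sq (s : ℤˣ) : ((s : ℤ) : ℝ) ^ 2 = 1 := by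
  rcases Int.units_eq_one_or s with rfl | rfl <;> simp

/-- Chernoff bound at the threshold `R / 2`, which exceeds `1` weakly because `R ≥ 2`. The tilt of
size `R / (2 (1 + σ²))` is the optimal one for a deviation of `R / 2` from the mean, and gives the
exponent `(R / 2)² / (2 (1 + σ²))`. -/
lemma lintegral_sign_tail_le {R : ℝ} (hR : 2 ≤ R) (s : ℤˣ) {σ : ℝ} (hσ : 0 < σ) {c : ℝ}
    (hc : 0 ≤ c) :
    ∫⁻ x, ENNReal.ofReal (if ((s : ℤ) : ℝ) * x < 1 then c else 0)
        ∂(smoothedReal (gaussianReal (R * ((s : ℤ) : ℝ)) 1) σ)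
      ≤ ENNReal.ofReal (c * Real.exp (-(R ^ 2 / (8 * (1 + σ ^ 2))))) := by
  have hV : 0 < 1 + σ ^ 2 := by positivity
  have hs := unit_sq s
  set r : ℝ := ((s : ℤ) : ℝ)
  rw [smoothedReal_gaussianReal _ hσ]
  set t : ℝ := -(R / (2 * (1 + σ ^ 2))) * r with ht
  have hint := integrable_exp_mul_gaussianReal (μ := R * r) (v := (1 + σ ^ 2).toNNReal) t
  have hmgf := congrFun (mgf_id_gaussianReal (μ := R * r) (v := (1 + σ ^ 2).toNNReal)) t
  rw [Real.coe_toNNReal _ hV.le] at hmgf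
  calc ∫⁻ x, ENNReal.ofReal (if r * x < 1 then c else 0)
        ∂(gaussianReal (R * r) (1 + σ ^ 2).toNNReal)
      ≤ ∫⁻ x, ENNReal.ofReal (c * Real.exp (R ^ 2 / (4 * (1 + σ ^ 2))) * Real.exp (t * x))
          ∂(gaussianReal (R * r) (1 + σ ^ 2).toNNReal) := by
        refine lintegral_mono fun x => ENNReal.ofReal_le_ofReal ?_
        split_ifs with h
        · rw [mul_assoc, ← Real.exp_add]
          refine le_mul_of_one_le_right hc (Real.one_le_exp ?_)
          have : R ^ 2 / (4 * (1 + σ ^ 2)) + t * x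
              = R / (2 * (1 + σ ^ 2)) * (R / 2 - r * x) := by
            rw [ht]
            field_simp
            ring
          rw [this]
          exact mul_nonneg (by positivity) (by linarith)
        · positivity
    _ = ENNReal.ofReal (c * Real.exp (R ^ 2 / (4 * (1 + σ ^ 2)))
          * mgf id (gaussianReal (R * r) (1 + σ ^ 2).toNNReal) t) := by
        rw [← ofReal_integral_eq_lintegral_ofReal (hint.const_mul _)
          (ae_of_all _ fun x => by positivity), integral_const_mul]
        rfl
    _ = ENNReal.ofReal (c * Real.exp (-(R ^ 2 / (8 * (1 + σ ^ 2))))) := by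
        rw [hmgf, mul_assoc, ← Real.exp_add]
        congr 3
        rw [ht]
        have h1 : R * r * (-(R / (2 * (1 + σ ^ 2))) * r)
            = -(R ^ 2 / (2 * (1 + σ ^ 2))) * r ^ 2 := by ring
        have h2 : (1 + σ ^ 2) * (-(R / (2 * (1 + σ ^ 2))) * r) ^ 2 / 2
            = R ^ 2 / (8 * (1 + σ ^ 2)) * r ^ 2 := by
          field_simp
          ring
        rw [h1, h2, hs]
        field_simp
        ring

lemma lintegral_sq_gaussianReal (y : ℝ) (v : ℝ≥0) :
    ∫⁻ x, ENNReal.ofReal (x ^ 2) ∂(gaussianReal y v) = ENNReal.ofReal (y ^ 2 + v) := by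
  have hm : MemLp (fun x : ℝ => x) 2 (gaussianReal y v) := memLp_id_gaussianReal' 2 (by simp)
  have h := variance_eq_sub hm
  rw [variance_fun_id_gaussianReal, integral_id_gaussianReal] at h
  rw [← ofReal_integral_eq_lintegral_ofReal hm.integrable_sq (ae_of_all _ fun x => sq_nonneg x)]
  congr 1
  have h2 : ∫ x, x ^ 2 ∂(gaussianReal y v) = ∫ x, ((fun x : ℝ => x) ^ 2) x ∂(gaussianReal y v) := rfl
  rw [h2]
  linarith

lemma lintegral_sq_smoothedReal_discretizedGaussian_le {ε : ℝ} (hε : 0 < ε) (hε1 : ε ≤ 1) (b : ℤˣ)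
    {σ : ℝ} (hσ : 0 < σ) :
    ∫⁻ x, ENNReal.ofReal (x ^ 2) ∂(smoothedReal (discretizedGaussian ε b) σ)
      ≤ ENNReal.ofReal (9 + σ ^ 2) := by
  have := isProbabilityMeasure_discretizedGaussian hε b
  rw [lintegral_smoothedReal _ hσ (by fun_prop)]
  simp only [lintegral_sq_gaussianReal, Real.coe_toNNReal _ (sq_nonneg σ)]
  have hi : Integrable (fun y : ℝ => y ^ 2 + σ ^ 2) (discretizedGaussian ε b) :=
    (integrable_sq_discretizedGaussian hε b).add (integrable_const (σ ^ 2))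
  rw [← ofReal_integral_eq_lintegral_ofReal hi (ae_of_all _ fun y => by positivity)]
  refine ENNReal.ofReal_le_ofReal ?_
  rw [integral_add (integrable_sq_discretizedGaussian hε b) (integrable_const _)]
  have := integral_sq_discretizedGaussian_le hε hε1 b
  simpa using this

lemma combPhase_mem {ε : ℝ} (hε : 0 < ε) (b : ℤˣ) : 0 ≤ combPhase ε b ∧ combPhase ε b ≤ ε / 2 := by
  rcases Int.units_eq_one_or b with rfl | rfl
  · simp [combPhase]
    positivity
  · norm_num [combPhase]
    positivity

/-- With `c` proportional to `1 / B²` this is Chebyshev's inequality for the event that the argument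
of `latticeScore` leaves the interpolation range `[-B, B]`. The constant is `18 + 1`: `2 (9 + σ²) /
(1 + σ²)² ≤ 18`, and twice the squared phase is at most `1`. -/
lemma lintegral_sq_location_le {ε : ℝ} (hε : 0 < ε) (hε1 : ε ≤ 1) (b : ℤˣ) {σ : ℝ} (hσ : 0 < σ)
    {c : ℝ} (hc : 0 ≤ c) :
    ∫⁻ x, ENNReal.ofReal (c * (x / (1 + σ ^ 2) - combPhase ε b) ^ 2)
        ∂(smoothedReal (discretizedGaussian ε b) σ) ≤ ENNReal.ofReal (c * 19) := by
  have := isProbabilityMeasure_discretizedGaussian hε b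
  have := isProbabilityMeasure_smoothedReal (discretizedGaussian ε b) hσ
  have hV : 1 ≤ 1 + σ ^ 2 := by nlinarith
  have hφ := combPhase_mem hε b
  set V := 1 + σ ^ 2 with hVdef
  calc ∫⁻ x, ENNReal.ofReal (c * (x / V - combPhase ε b) ^ 2)
        ∂(smoothedReal (discretizedGaussian ε b) σ)
      ≤ ∫⁻ x, (ENNReal.ofReal (c * (2 / V ^ 2)) * ENNReal.ofReal (x ^ 2) + ENNReal.ofReal c)
        ∂(smoothedReal (discretizedGaussian ε b) σ) := by
        refine lintegral_mono fun x => ?_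
        rw [← ENNReal.ofReal_mul (by positivity), ← ENNReal.ofReal_add (by positivity) hc]
        refine ENNReal.ofReal_le_ofReal ?_
        have h1 : (x / V - combPhase ε b) ^ 2 ≤ 2 * (x / V) ^ 2 + 2 * combPhase ε b ^ 2 := by
          nlinarith [sq_nonneg (x / V + combPhase ε b)]
        have h2 : combPhase ε b ^ 2 ≤ 1 / 2 := by nlinarith
        have h3 : c * (2 / V ^ 2) * x ^ 2 + c = c * (2 * (x / V) ^ 2 + 1) := by
          field_simp
        rw [h3]
        exact mul_le_mul_of_nonneg_left (by linarith) hc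
    _ ≤ ENNReal.ofReal (c * (2 / V ^ 2)) * ENNReal.ofReal (9 + σ ^ 2) + ENNReal.ofReal c := by
        rw [lintegral_add_right _ measurable_const, lintegral_const_mul _ (by fun_prop),
          lintegral_const, measure_univ, mul_one]
        gcongr
        exact lintegral_sq_smoothedReal_discretizedGaussian_le hε hε1 b hσ
    _ ≤ ENNReal.ofReal (c * 19) := by
        rw [← ENNReal.ofReal_mul (by positivity), ← ENNReal.ofReal_add (by positivity) hc]
        refine ENNReal.ofReal_le_ofReal ?_
        have h4 : 2 / V ^ 2 * (9 + σ ^ 2) ≤ 18 := by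
          rw [div_mul_eq_mul_div, div_le_iff₀ (by positivity)]
          nlinarith
        nlinarith

/-- Only the marginals matter, because the integrand is a sum of functions of single coordinates. -/
lemma lintegral_pi_add_sum_le {ι : Type} [Fintype ι] {ν : ι → Measure ℝ}
    (hν : ∀ i, IsProbabilityMeasure (ν i)) {φ : ι → ℝ → ℝ} {b : ι → ℝ} {k : ℝ} (hk : 0 ≤ k)
    (hm : ∀ i, Measurable (φ i)) (h0 : ∀ i x, 0 ≤ φ i x) (hb0 : ∀ i, 0 ≤ b i)
    (hb : ∀ i, ∫⁻ x, ENNReal.ofReal (φ i x) ∂(ν i) ≤ ENNReal.ofReal (b i)) :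
    ∫⁻ x, ENNReal.ofReal (k + ∑ i, φ i (x i)) ∂(Measure.pi ν)
      ≤ ENNReal.ofReal (k + ∑ i, b i) := by
  have h1 : ∀ x : ι → ℝ, ENNReal.ofReal (k + ∑ i, φ i (x i))
      = ENNReal.ofReal k + ∑ i, ENNReal.ofReal (φ i (x i)) := fun x => by
    rw [ENNReal.ofReal_add hk (Finset.sum_nonneg fun i _ => h0 i _),
      ENNReal.ofReal_sum_of_nonneg fun i _ => h0 i _]
  have h2 : ∀ i, Measurable fun x : ι → ℝ => ENNReal.ofReal (φ i (x i)) := fun i =>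
    ((hm i).comp (measurable_pi_apply i)).ennreal_ofReal
  simp only [h1]
  rw [lintegral_add_left measurable_const, lintegral_const, measure_univ, mul_one,
    lintegral_finsetSum _ fun i _ => h2 i,
    ENNReal.ofReal_add hk (Finset.sum_nonneg fun i _ => hb0 i),
    ENNReal.ofReal_sum_of_nonneg fun i _ => hb0 i]
  gcongr with i
  rw [(measurePreserving_eval ν i).lintegral_comp (hm i).ennreal_ofReal]
  exact hb i

end Tails

/-! ### The network that recovers the signs and applies the network for `f`. -/

/-- The index set of the neurons that carry the input of `signNet` and the ingredients of its
clipped first block. -/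
abbrev CarryIndex (d d' : ℕ) : Type := (Fin d × Bool) ⊕ ((Fin d ⊕ Fin d') × Bool)

section SignNet

variable {d d' : ℕ}

/-- The first block of the input, clipped to `[-1, 1]`. -/
def clipSign (x : Fin d ⊕ Fin d' → ℝ) (i : Fin d) : ℝ :=
  max (x (Sum.inl i) + 1) 0 - max (x (Sum.inl i) - 1) 0 - 1

/-- The values of the carrying neurons. -/
def carried (x : Fin d ⊕ Fin d' → ℝ) : CarryIndex d d' → ℝ :=
  Sum.elim (fun q => max (x (Sum.inl q.1) + boolSign q.2) 0) (fun q => max (boolSign q.2 * x q.1) 0)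

/-- The network `N` applied to the clipped first block of the input; the network `T` is then applied
to the result and to the carried input. -/
def signNet {μ : Type} [NeZero d] (N : ReLUNet (Fin d') (Fin d))
    (T : ReLUNet μ (Fin d' ⊕ CarryIndex d d')) : ReLUNet μ (Fin d ⊕ Fin d') :=
  .hidden (η := CarryIndex d d')
    (Matrix.of fun h k => Sum.elim (fun q => if Sum.inl q.1 = k then 1 else 0)
      (fun q => if q.1 = k then boolSign q.2 else 0) h)
    (Sum.elim (fun q => boolSign q.2) 0)
    -- This affine map assembles the clipped coordinates from the two ramps at `-1` and `1` and
    -- copies all carried values, which are nonnegative as outputs of ReLU.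
    ((ReLUNet.carry T N).precomp
      (Matrix.of fun h k => Sum.elim (fun i => Sum.elim (fun q => if q.1 = i then boolSign q.2 else 0) 0 k)
        (fun k' => if k' = k then 1 else 0) h)
      (Sum.elim (fun _ => -1) 0))

lemma sum_prod_ite_eq_mul {α : Type} [Fintype α] [DecidableEq α] (a : α) (g : α × Bool → ℝ)
    (z : α × Bool → ℝ) :
    ∑ q : α × Bool, (if q.1 = a then g q else 0) * z q = ∑ β, g (a, β) * z (a, β) := by
  rw [Fintype.sum_prod_type, Finset.sum_eq_single a (fun b _ hb => by simp [hb]) (by simp)]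
  simp

lemma carried_nonneg (x : Fin d ⊕ Fin d' → ℝ) (k : CarryIndex d d') : 0 ≤ carried x k := by
  rcases k with q | q <;> exact le_max_right _ _

lemma abs_clipSign_le (x : Fin d ⊕ Fin d' → ℝ) (i : Fin d) : |clipSign x i| ≤ 1 := by
  rw [clipSign, abs_le]
  rcases le_total (x (Sum.inl i) + 1) 0 with h | h <;>
  rcases le_total (x (Sum.inl i) - 1) 0 with h' | h' <;>
  simp only [max_eq_left, max_eq_right, h, h'] <;> constructor <;> linarith

/-- Beyond margin one the clipping saturates at the exact sign. This matters because `N` is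
controlled only at the vertices of the hypercube. -/
lemma clipSign_eq {x : Fin d ⊕ Fin d' → ℝ} {s : Fin d → ℤˣ} {i : Fin d}
    (h : 1 ≤ ((s i : ℤ) : ℝ) * x (Sum.inl i)) : clipSign x i = ((s i : ℤ) : ℝ) := by
  rw [clipSign]
  rcases Int.units_eq_one_or (s i) with hs | hs <;> rw [hs] at h ⊢ <;> push_cast at h ⊢
  · rw [max_eq_left (by linarith), max_eq_left (by linarith)]
    ring
  · rw [max_eq_right (by linarith), max_eq_right (by linarith)]
    ring

lemma card_carryIndex : Fintype.card (CarryIndex d d') = 4 * d + 2 * d' := by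
  simp only [CarryIndex, Fintype.card_sum, Fintype.card_prod, Fintype.card_fin, Fintype.card_bool]
  ring

variable {μ : Type} [NeZero d] (N : ReLUNet (Fin d') (Fin d))
    (T : ReLUNet μ (Fin d' ⊕ CarryIndex d d'))

lemma eval_signNet (x : Fin d ⊕ Fin d' → ℝ) :
    (signNet N T).eval x = T.eval (Sum.elim (N.eval (clipSign x)) (carried x)) := by
  simp only [signNet, ReLUNet.eval, ReLUNet.eval_precomp]
  rw [← ReLUNet.eval_carry T N _ (carried_nonneg x)]
  congr 1
  have hc : ∀ k : CarryIndex d d', max (∑ j, (Sum.elim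
      (fun q : Fin d × Bool => if (Sum.inl q.1 : Fin d ⊕ Fin d') = j then (1 : ℝ) else 0)
      (fun q : (Fin d ⊕ Fin d') × Bool => if q.1 = j then boolSign q.2 else 0) k) * x j
      + (Sum.elim (fun q : Fin d × Bool => boolSign q.2) 0 : CarryIndex d d' → ℝ) k) 0
      = carried x k := by
    rintro (q | q) <;> simp [carried]
  simp only [Matrix.of_apply, hc]
  ext k
  rcases k with i | k
  · simp only [Sum.elim_inl, clipSign, Fintype.sum_sum_type, Sum.elim_inr, Pi.zero_apply, zero_mul,
      Finset.sum_const_zero, add_zero]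
    rw [sum_prod_ite_eq_mul i (fun q => boolSign q.2) (fun q => carried x (Sum.inl q))]
    simp only [carried, Fintype.sum_bool, boolSign, if_true, Bool.false_eq_true, if_false,
      Sum.elim_inl]
    ring_nf
  · simp

/-- The extra clipping layer makes up for the affine map saved by `ReLUNet.carry`. -/
lemma depth_signNet : (signNet N T).depth = N.depth + T.depth := by
  simp only [signNet, ReLUNet.depth, ReLUNet.depth_precomp, ReLUNet.depth_carry]

lemma paramCount_signNet_le [Fintype μ] : (signNet N T).paramCount
    ≤ (4 * d + 2 * d') * (d + d' + 1)
      + ((1 + (4 * d + 2 * d')) ^ 2 * N.paramCount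
        + T.paramCount * (1 + (4 * d + 2 * d')) * (N.paramCount + d + 1)) * (4 * d + 2 * d' + 1) := by
  have h1 := ReLUNet.paramCount_carry_le T N
  simp only [signNet, ReLUNet.paramCount]
  have h2 := ReLUNet.paramCount_precomp_le (ι' := CarryIndex d d')
    (Matrix.of fun h k => Sum.elim (fun i => Sum.elim (fun q => if q.1 = i then boolSign q.2 else 0) 0 k)
        (fun k' => if k' = k then 1 else 0) h)
      (Sum.elim (fun _ => -1) 0) (ReLUNet.carry T N)
  rw [card_carryIndex] at *
  simp only [Fintype.card_sum, Fintype.card_fin] at *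
  exact add_le_add le_rfl (h2.trans (Nat.mul_le_mul_right _ h1))

lemma paramsBoundedBy_signNet {B D B' : ℝ} (hN : N.ParamsBoundedBy B) (hT : T.ParamsBoundedBy D)
    (hB : 1 ≤ B) (hD : 1 ≤ D) (hB' : (5 * d + 3 * d' + 1) ^ 2 * (2 * D * B) ≤ B') :
    (signNet N T).ParamsBoundedBy B' := by
  have hd : (0 : ℝ) ≤ d := Nat.cast_nonneg _
  have hd' : (0 : ℝ) ≤ d' := Nat.cast_nonneg _
  have hDB : 1 ≤ D * B := one_le_mul_of_one_le_of_one_le hD hB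
  have hDB' : D ≤ D * B := le_mul_of_one_le_right (by linarith) hB
  have hBD' : B ≤ D * B := le_mul_of_one_le_left (by linarith) hD
  set m : ℝ := 5 * d + 3 * d' + 1 with hm
  have hm1 : 1 ≤ m := by linarith
  have hB1 : 1 ≤ B' := by nlinarith
  have hcarry : (ReLUNet.carry T N).ParamsBoundedBy (m * (D * B)) := by
    refine hT.carry hB (by linarith) ?_ (by nlinarith) hN
    rw [card_carryIndex, Fintype.card_fin]
    push_cast
    nlinarith
  have hA : ∀ (q : Prop) [Decidable q], |if q then (1 : ℝ) else 0| ≤ 1 := fun q _ => by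
    split_ifs <;> simp
  have hS : ∀ (q : Prop) [Decidable q] (β : Bool), |if q then boolSign β else 0| ≤ 1 :=
    fun q _ β => by
      split_ifs
      · exact (abs_boolSign β).le
      · simp
  refine ⟨?_, ?_, hcarry.precomp (D := 1) ?_ ?_ (by positivity) zero_le_one ?_⟩
  · rintro (q | q) k
    · exact (hA _).trans hB1
    · exact (hS _ _).trans hB1
  · rintro (q | q)
    · exact (abs_boolSign _).le.trans hB1
    · simp only [Sum.elim_inr, Pi.zero_apply, abs_zero]
      linarith
  · rintro (i | k) k'
    · rcases k' with q | q
      · exact hS _ _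
      · simp
    · exact hA _
  · rintro (i | k) <;> simp
  · rw [Fintype.card_sum, card_carryIndex, Fintype.card_fin]
    push_cast
    refine le_trans ?_ hB'
    nlinarith [mul_nonneg (show 0 ≤ m by linarith) (show 0 ≤ D * B by linarith)]

end SignNet

/-! ### The last layers of the small noise network. -/

section SmallNoiseNet

variable (d d' : ℕ) [NeZero d] (R ε V t₀ δ : ℝ) (M : ℕ) (F : ℝ → ℝ)

/-- The network that computes the approximate score in the small noise case from the output of the
network for `f` and the carried input. The variance is `V = 1 + σ ^ 2`, and `F` is the function
to be interpolated. -/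
def smallNoiseTail : ReLUNet (Fin d ⊕ Fin d') (Fin d' ⊕ CarryIndex d d') :=
  piecewiseLinearNet
    (fun o => Sum.elim (fun _ => 0) (fun j => Sum.elim (fun j' => if j' = j then ε / 4 else 0)
      (Sum.elim 0 (fun q => if q.1 = Sum.inr j then boolSign q.2 * V⁻¹ else 0))) o)
    (fun o => Sum.elim 0 (Sum.elim
      (fun q => Sum.elim (fun i => if q.1 = i then boolSign q.2 * (R / V) else 0) 0 o)
      (fun q => if q.1 = o then boolSign q.2 * (-V⁻¹) else 0)))
    (Sum.elim 0 (fun _ => -(ε / 4)))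
    (Sum.elim (fun _ => -(R / V)) (fun _ => F t₀ / V))
    (Sum.elim 0 (fun _ m => interpSlope F t₀ δ m / V)) t₀ δ M

lemma eval_smallNoiseTail_inl (y : Fin d' → ℝ) (x : Fin d ⊕ Fin d' → ℝ) (i : Fin d) :
    (smallNoiseTail d d' R ε V t₀ δ M F).eval (Sum.elim y (carried x)) (Sum.inl i)
      = (R * clipSign x i - x (Sum.inl i)) / V := by
  rw [smallNoiseTail, eval_piecewiseLinearNet]
  simp only [Fintype.sum_sum_type, Sum.elim_inl, Sum.elim_inr, Pi.zero_apply, zero_mul,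
    Finset.sum_const_zero, zero_add, piecewiseLinear, add_zero]
  rw [sum_prod_ite_eq_mul i (fun q => boolSign q.2 * (R / V)) (fun q => carried x (Sum.inl q)),
    sum_prod_ite_eq_mul (Sum.inl i) (fun q => boolSign q.2 * (-V⁻¹))
      (fun q => carried x (Sum.inr q))]
  have h := sum_boolSign_mul_max (x (Sum.inl i))
  simp only [carried, Fintype.sum_bool, boolSign, if_true, Bool.false_eq_true, if_false,
    Sum.elim_inl, Sum.elim_inr, clipSign] at h ⊢
  linear_combination (-V⁻¹) * h

/-- At `y j = f(s)_j` the shift `ε / 4 * (1 - y j)` is exactly the phase of the comb, so the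
interpolant is evaluated at the argument of `latticeScore` in the component `s`. -/
lemma eval_smallNoiseTail_inr (y : Fin d' → ℝ) (x : Fin d ⊕ Fin d' → ℝ) (j : Fin d') :
    (smallNoiseTail d d' R ε V t₀ δ M F).eval (Sum.elim y (carried x)) (Sum.inr j)
      = (piecewiseLinear (F t₀) (interpSlope F t₀ δ) t₀ δ M
          (x (Sum.inr j) / V - ε / 4 * (1 - y j)) - x (Sum.inr j)) / V := by
  rw [smallNoiseTail, eval_piecewiseLinearNet]
  have h := sum_boolSign_mul_max (x (Sum.inr j))
  have hu : ∀ r : ℝ, ∑ q : (Fin d ⊕ Fin d') × Bool,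
      (if q.1 = Sum.inr j then boolSign q.2 * r else 0) * carried x (Sum.inr q)
      = r * x (Sum.inr j) := fun r => by
    rw [sum_prod_ite_eq_mul (Sum.inr j) (fun q => boolSign q.2 * r)
      (fun q => carried x (Sum.inr q))]
    simp only [carried, Fintype.sum_bool, Sum.elim_inr] at h ⊢
    linear_combination r * h
  have hy : ∑ k, (if k = j then ε / 4 else 0) * y k = ε / 4 * y j := by simp
  simp only [Fintype.sum_sum_type, Sum.elim_inl, Sum.elim_inr, Pi.zero_apply, zero_mul,
    Finset.sum_const_zero, zero_add, hu, hy]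
  have harg : ε / 4 * y j + V⁻¹ * x (Sum.inr j) + -(ε / 4)
      = x (Sum.inr j) / V - ε / 4 * (1 - y j) := by ring
  rw [harg]
  simp only [piecewiseLinear, sub_div, add_div, Finset.sum_div]
  rw [sub_eq_add_neg]
  congr 2
  · refine Finset.sum_congr rfl fun m _ => ?_
    ring
  · ring

lemma paramCount_smallNoiseTail : (smallNoiseTail d d' R ε V t₀ δ M F).paramCount
    = ((d + d') * (M * 2) + (4 * d + 3 * d') * 2) * (4 * d + 3 * d' + 1)
      + (d + d') * ((d + d') * (M * 2) + (4 * d + 3 * d') * 2 + 1) := by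
  rw [smallNoiseTail, paramCount_piecewiseLinearNet]
  simp only [Fintype.card_sum, Fintype.card_fin, Fintype.card_prod, Fintype.card_bool]
  ring

variable {d d' R ε V t₀ δ M F}

lemma paramsBoundedBy_smallNoiseTail {Λ B : ℝ} (hF : ∀ x y, |F x - F y| ≤ Λ * |x - y|)
    (hΛ : Λ ≤ B) (hε : 0 < ε) (hε1 : ε ≤ 1) (hV : 1 ≤ V) (hR0 : 0 ≤ R) (hR : R ≤ B) (hδ : 0 < δ)
    (ht : 1 + |t₀| + M * |δ| ≤ B) (hFt : |F t₀| ≤ B) :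
    (smallNoiseTail d d' R ε V t₀ δ M F).ParamsBoundedBy B := by
  have hV0 : 0 < V := by linarith
  have hB1 : 1 ≤ B := by
    have : 0 ≤ |t₀| := abs_nonneg _
    have : 0 ≤ M * |δ| := by positivity
    linarith
  have hVinv : |V⁻¹| ≤ 1 := by
    rw [abs_of_pos (by positivity)]
    exact inv_le_one_of_one_le₀ hV
  have hRV : |R / V| ≤ B := by
    rw [abs_of_nonneg (by positivity)]
    exact (div_le_self hR0 hV).trans hR
  have hε4 : |ε / 4| ≤ 1 := by
    rw [abs_of_pos (by positivity)]
    linarith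
  have hdiv : ∀ {z : ℝ}, |z| ≤ B → |z / V| ≤ B := fun hz => by
    rw [abs_div, abs_of_pos hV0]
    exact (div_le_self (abs_nonneg _) hV).trans hz
  have hite : ∀ (q : Prop) [Decidable q] {z : ℝ}, |z| ≤ B → |if q then z else 0| ≤ B :=
    fun q _ z hz => by
      split_ifs
      · exact hz
      · rw [abs_zero]
        linarith
  have hsgn : ∀ (β : Bool) {z : ℝ}, |z| ≤ B → |boolSign β * z| ≤ B := fun β z hz => by
    rwa [abs_mul, abs_boolSign, one_mul]
  have h0 : |(0 : ℝ)| ≤ B := by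
    rw [abs_zero]
    linarith
  refine paramsBoundedBy_piecewiseLinearNet hB1 ?_ ?_ ?_ ?_ ?_
  · rintro (i | j) k
    · exact h0
    · rcases k with j' | q | q
      · exact hite _ (hε4.trans hB1)
      · exact h0
      · exact hite _ (hsgn _ (hVinv.trans hB1))
  · rintro o (j' | q | q)
    · exact h0
    · rcases o with i | j
      · exact hite _ (hsgn _ hRV)
      · exact h0
    · refine hite _ (hsgn _ ?_)
      rw [abs_neg]
      exact hVinv.trans hB1
  · rintro (i | j)
    · simp only [Sum.elim_inl, Pi.zero_apply, abs_zero]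
      linarith
    · simp only [Sum.elim_inr, abs_neg]
      linarith
  · rintro (i | j)
    · simp only [Sum.elim_inl, abs_neg]
      exact hRV
    · exact hdiv hFt
  · rintro (i | j) m
    · exact h0
    · exact hdiv ((abs_interpSlope_le hF hδ _ _).trans hΛ)

end SmallNoiseNet

/-! ### Error analysis for small noise. -/

section SmallNoise

variable {d d' : ℕ} {f : (Fin d → ℤˣ) → Fin d' → ℤˣ} {N : ReLUNet (Fin d') (Fin d)}
  {R ε σ η B : ℝ} {P : ℝ → ℝ} {h : (Fin d ⊕ Fin d' → ℝ) → Fin d ⊕ Fin d' → ℝ}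

/-- A function that computes the score of a component of the mixture, up to an approximation `P` of
`latticeScore`, is close to the score of the component `s` where the signs of the first block agree
with `s`, and at a bounded distance from it elsewhere. -/
lemma sum_sq_sub_hardMarginalScore_le (hN : N.Computes f) (hε1 : ε ≤ 1) (hσ : 0 < σ)
    (hη1 : η ≤ 1) (hB : 0 < B)
    (hP : ∀ u w, |P u - latticeScore (σ ^ 2 / (1 + σ ^ 2)) ε w|
      ≤ η + 2 * (ε / (σ ^ 2 / (1 + σ ^ 2))))
    (hPB : ∀ u, |u| ≤ B → |P u - latticeScore (σ ^ 2 / (1 + σ ^ 2)) ε u| ≤ η)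
    (hl : ∀ x i, h x (Sum.inl i) = (R * clipSign x i - x (Sum.inl i)) / (1 + σ ^ 2))
    (hr : ∀ x j, h x (Sum.inr j) = (P (x (Sum.inr j) / (1 + σ ^ 2)
      - ε / 4 * (1 - N.eval (clipSign x) j)) - x (Sum.inr j)) / (1 + σ ^ 2))
    (s : Fin d → ℤˣ) (x : Fin d ⊕ Fin d' → ℝ) :
    ∑ i, (h x i - hardMarginalScore f R ε σ s i (x i)) ^ 2
      ≤ d' * η ^ 2 + ∑ i, (Sum.elim
        (fun i t => if ((s i : ℤ) : ℝ) * t < 1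
          then 4 * d * (R / (1 + σ ^ 2)) ^ 2 + d' * (2 + 8 / σ ^ 4) else 0)
        (fun j t => (2 + 8 / σ ^ 4) / B ^ 2 * (t / (1 + σ ^ 2) - combPhase ε (f s j)) ^ 2) i :
          ℝ → ℝ) (x i) := by
  have hV1 : 1 ≤ 1 + σ ^ 2 := by nlinarith
  have hE : ε / (σ ^ 2 / (1 + σ ^ 2)) ≤ (1 + σ ^ 2) / σ ^ 2 := by
    rw [div_div_eq_mul_div]
    gcongr
    nlinarith
  set V := 1 + σ ^ 2 with hV
  have hV0 : 0 < V := by linarith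
  have hl' : ∀ i, h x (Sum.inl i) - hardMarginalScore f R ε σ s (Sum.inl i) (x (Sum.inl i))
      = R / V * (clipSign x i - ((s i : ℤ) : ℝ)) := fun i => by
    simp only [hl, hardMarginalScore, Sum.elim_inl]
    ring
  have hr' : ∀ j, h x (Sum.inr j) - hardMarginalScore f R ε σ s (Sum.inr j) (x (Sum.inr j))
      = (P (x (Sum.inr j) / V - ε / 4 * (1 - N.eval (clipSign x) j))
        - latticeScore (σ ^ 2 / V) ε (x (Sum.inr j) / V - combPhase ε (f s j))) / V := fun j => by
    simp only [hr, hardMarginalScore, Sum.elim_inr]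
    ring
  -- A crude bound valid everywhere: scores on the second block are at most `ε / v ≤ (1 + σ²) / σ²`,
  -- and `(1 + 2 / σ²)² ≤ 2 + 8 / σ⁴`. It is used where a sign is wrong or the argument is out of
  -- range.
  have hsq : ∀ {z : ℝ}, |z| ≤ η + 2 * (ε / (σ ^ 2 / V)) → (z / V) ^ 2 ≤ 2 + 8 / σ ^ 4 :=
    fun {z} hz => by
      have h1 : |z| ≤ V * (1 + 2 / σ ^ 2) := by
        refine hz.trans ?_
        have : V * (1 + 2 / σ ^ 2) = V + 2 * (V / σ ^ 2) := by ring
        rw [this]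
        linarith
      have h2 : |z / V| ≤ 1 + 2 / σ ^ 2 := by
        rw [abs_div, abs_of_pos hV0, div_le_iff₀ hV0]
        linarith
      have h3 : (2 + 8 / σ ^ 4) - (1 + 2 / σ ^ 2) ^ 2 = (1 - 2 / σ ^ 2) ^ 2 := by
        field_simp
        ring
      have h4 : (z / V) ^ 2 ≤ (1 + 2 / σ ^ 2) ^ 2 := by
        rw [← sq_abs]
        gcongr
      nlinarith [sq_nonneg (1 - 2 / σ ^ 2)]
  have hH : 0 ≤ 2 + 8 / σ ^ 4 := by positivity
  simp only [Fintype.sum_sum_type, Sum.elim_inl, Sum.elim_inr, hl', hr']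
  -- If all signs have margin one, the first block is exact and the phases are correct, so only the
  -- interpolation error remains.
  by_cases hgood : ∀ i, 1 ≤ ((s i : ℤ) : ℝ) * x (Sum.inl i)
  · have hclip : clipSign x = fun i => ((s i : ℤ) : ℝ) := funext fun i => clipSign_eq (hgood i)
    have hleft : ∑ i, (R / V * (clipSign x i - ((s i : ℤ) : ℝ))) ^ 2 = 0 :=
      Finset.sum_eq_zero fun i _ => by rw [hclip]; ring
    have hright : ∀ j, ((P (x (Sum.inr j) / V - ε / 4 * (1 - N.eval (clipSign x) j))
        - latticeScore (σ ^ 2 / V) ε (x (Sum.inr j) / V - combPhase ε (f s j))) / V) ^ 2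
        ≤ η ^ 2 + (2 + 8 / σ ^ 4) / B ^ 2 * (x (Sum.inr j) / V - combPhase ε (f s j)) ^ 2 := by
      intro j
      rw [hclip, hN s j, show ε / 4 * (1 - ((f s j : ℤ) : ℝ)) = combPhase ε (f s j) by
        rw [combPhase]; ring]
      set u := x (Sum.inr j) / V - combPhase ε (f s j)
      rcases le_or_gt |u| B with hu | hu
      · have h1 := hPB u hu
        have h2 : |(P u - latticeScore (σ ^ 2 / V) ε u) / V| ≤ η := by
          rw [abs_div, abs_of_pos hV0]
          exact (div_le_self (abs_nonneg _) hV1).trans h1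
        have h3 := pow_le_pow_left₀ (abs_nonneg _) h2 2
        rw [sq_abs] at h3
        have : 0 ≤ (2 + 8 / σ ^ 4) / B ^ 2 * u ^ 2 := by positivity
        linarith
      -- Outside the interpolation range the factor `u² / B²` exceeds one and pays for the crude
      -- bound.
      · have h1 := hsq (hP u u)
        have h2 : B ^ 2 ≤ u ^ 2 := by
          rw [← sq_abs u]
          gcongr
        have h3 : 2 + 8 / σ ^ 4 ≤ (2 + 8 / σ ^ 4) / B ^ 2 * u ^ 2 := by
          rw [div_mul_eq_mul_div, le_div_iff₀ (by positivity)]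
          gcongr
        nlinarith [sq_nonneg η]
    have hpos : 0 ≤ ∑ i : Fin d, (if ((s i : ℤ) : ℝ) * x (Sum.inl i) < 1
          then 4 * d * (R / V) ^ 2 + d' * (2 + 8 / σ ^ 4) else 0) :=
      Finset.sum_nonneg fun i _ => by split_ifs <;> positivity
    have hsum := Finset.sum_le_sum fun j (_ : j ∈ Finset.univ) => hright j
    rw [Finset.sum_add_distrib, Finset.sum_const, Finset.card_univ, Fintype.card_fin,
      nsmul_eq_mul] at hsum
    rw [hleft]
    linarith
  -- A single wrong coordinate already contributes an indicator term that covers the error of all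
  -- coordinates.
  · push Not at hgood
    obtain ⟨i₀, hi₀⟩ := hgood
    have hbig : 4 * d * (R / V) ^ 2 + d' * (2 + 8 / σ ^ 4)
        ≤ ∑ i : Fin d, (if ((s i : ℤ) : ℝ) * x (Sum.inl i) < 1
          then 4 * d * (R / V) ^ 2 + d' * (2 + 8 / σ ^ 4) else 0) := by
      refine le_trans ?_ (Finset.single_le_sum
        (f := fun i : Fin d => if ((s i : ℤ) : ℝ) * x (Sum.inl i) < 1
          then 4 * d * (R / V) ^ 2 + d' * (2 + 8 / σ ^ 4) else 0)
        (fun i _ => by split_ifs <;> positivity) (Finset.mem_univ i₀))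
      simp only [hi₀, if_true, le_refl]
    have hleft : ∑ i, (R / V * (clipSign x i - ((s i : ℤ) : ℝ))) ^ 2 ≤ 4 * d * (R / V) ^ 2 := by
      have : ∀ i ∈ Finset.univ, (R / V * (clipSign x i - ((s i : ℤ) : ℝ))) ^ 2
          ≤ 4 * (R / V) ^ 2 := fun i _ => by
        obtain ⟨h1, h2⟩ := abs_le.1 (abs_clipSign_le x i)
        have h3 : (clipSign x i - ((s i : ℤ) : ℝ)) ^ 2 ≤ 4 := by
          rcases Int.units_eq_one_or (s i) with hs | hs <;> rw [hs] <;> push_cast <;> nlinarith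
        rw [mul_pow]
        nlinarith [sq_nonneg (R / V)]
      refine (Finset.sum_le_sum this).trans (le_of_eq ?_)
      rw [Finset.sum_const, Finset.card_univ, Fintype.card_fin, nsmul_eq_mul]
      ring
    have hright : ∑ j, ((P (x (Sum.inr j) / V - ε / 4 * (1 - N.eval (clipSign x) j))
        - latticeScore (σ ^ 2 / V) ε (x (Sum.inr j) / V - combPhase ε (f s j))) / V) ^ 2
        ≤ d' * (2 + 8 / σ ^ 4) := by
      refine (Finset.sum_le_sum fun j _ => hsq (hP _ _)).trans (le_of_eq ?_)
      rw [Finset.sum_const, Finset.card_univ, Fintype.card_fin, nsmul_eq_mul]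
    have hpos : 0 ≤ ∑ j : Fin d', (2 + 8 / σ ^ 4) / B ^ 2
        * (x (Sum.inr j) / V - combPhase ε (f s j)) ^ 2 :=
      Finset.sum_nonneg fun j _ => by positivity
    nlinarith [mul_nonneg (Nat.cast_nonneg (α := ℝ) d') (sq_nonneg η)]

/-- The mixture error is at most the average of the component errors. The pointwise bound for a
component is a sum over coordinates, and its integral has a bound independent of `s`. -/
lemma scoreError_small_noise_le (hN : N.Computes f) (hε : 0 < ε) (hε1 : ε ≤ 1) (hσ : 0 < σ)
    (hR : 2 ≤ R) (hη1 : η ≤ 1) (hB : 0 < B) (hh : Measurable h)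
    (hP : ∀ u w, |P u - latticeScore (σ ^ 2 / (1 + σ ^ 2)) ε w|
      ≤ η + 2 * (ε / (σ ^ 2 / (1 + σ ^ 2))))
    (hPB : ∀ u, |u| ≤ B → |P u - latticeScore (σ ^ 2 / (1 + σ ^ 2)) ε u| ≤ η)
    (hl : ∀ x i, h x (Sum.inl i) = (R * clipSign x i - x (Sum.inl i)) / (1 + σ ^ 2))
    (hr : ∀ x j, h x (Sum.inr j) = (P (x (Sum.inr j) / (1 + σ ^ 2)
      - ε / 4 * (1 - N.eval (clipSign x) j)) - x (Sum.inr j)) / (1 + σ ^ 2)) :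
    scoreError (hardDist f R ε) σ h ≤ ENNReal.ofReal (d' * η ^ 2
      + (d * ((4 * d * (R / (1 + σ ^ 2)) ^ 2 + d' * (2 + 8 / σ ^ 4))
          * Real.exp (-(R ^ 2 / (8 * (1 + σ ^ 2)))))
        + d' * ((2 + 8 / σ ^ 4) / B ^ 2 * 19))) := by
  have hprob := isProbabilityMeasure_hardMarginal f R hε
  have hprob' := fun s i => isProbabilityMeasure_smoothedReal (hardMarginal f R ε s i) hσ
  rw [hardDist_eq]
  refine (scoreError_productMixture_le _ _ (hardWeight_ne_zero d) (hardWeight_ne_top d) hσ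
    (fun s i u => hasDerivAt_gaussianSmoothing_hardMarginal f R hε hσ s i u)
    (fun s i => measurable_hardMarginalScore f R hε hσ s i) hh).trans ?_
  set b := d' * η ^ 2
      + (d * ((4 * d * (R / (1 + σ ^ 2)) ^ 2 + d' * (2 + 8 / σ ^ 4))
          * Real.exp (-(R ^ 2 / (8 * (1 + σ ^ 2)))))
        + d' * ((2 + 8 / σ ^ 4) / B ^ 2 * 19)) with hb
  have hcomp : ∀ s : Fin d → ℤˣ, ∫⁻ x, ENNReal.ofReal
      (∑ i, (h x i - hardMarginalScore f R ε σ s i (x i)) ^ 2)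
        ∂(Measure.pi fun i => smoothedReal (hardMarginal f R ε s i) σ) ≤ ENNReal.ofReal b := by
    intro s
    refine (lintegral_mono fun x => ENNReal.ofReal_le_ofReal
      (sum_sq_sub_hardMarginalScore_le hN hε1 hσ hη1 hB hP hPB hl hr s x)).trans ?_
    refine (lintegral_pi_add_sum_le (b := Sum.elim
      (fun _ => (4 * d * (R / (1 + σ ^ 2)) ^ 2 + d' * (2 + 8 / σ ^ 4))
        * Real.exp (-(R ^ 2 / (8 * (1 + σ ^ 2)))))
      (fun _ => (2 + 8 / σ ^ 4) / B ^ 2 * 19)) (hprob' s) (by positivity) ?_ ?_ ?_ ?_).trans ?_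
    · rintro (i | j)
      · exact Measurable.ite (measurableSet_lt (by fun_prop) measurable_const)
          measurable_const measurable_const
      · simp only [Sum.elim_inr]
        fun_prop
    · rintro (i | j) x
      · simp only [Sum.elim_inl]
        split_ifs <;> positivity
      · simp only [Sum.elim_inr]
        positivity
    · rintro (i | j)
      · simp only [Sum.elim_inl]
        positivity
      · simp only [Sum.elim_inr]
        positivity
    · rintro (i | j)
      · exact lintegral_sign_tail_le hR (s i) hσ (by positivity)
      · exact lintegral_sq_location_le hε hε1 (f s j) hσ (by positivity)
    · rw [hb, Fintype.sum_sum_type]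
      simp
  calc ∑ s : Fin d → ℤˣ, ((2 : ℝ≥0∞) ^ d)⁻¹ * ∫⁻ x, ENNReal.ofReal
          (∑ i, (h x i - hardMarginalScore f R ε σ s i (x i)) ^ 2)
          ∂(Measure.pi fun i => smoothedReal (hardMarginal f R ε s i) σ)
      ≤ ∑ _s : Fin d → ℤˣ, ((2 : ℝ≥0∞) ^ d)⁻¹ * ENNReal.ofReal b :=
        Finset.sum_le_sum fun s _ => by gcongr; exact hcomp s
    _ = ENNReal.ofReal b := by
        rw [Finset.sum_const, Finset.card_univ, nsmul_eq_mul, ← mul_assoc, card_mul_hardWeight,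
          one_mul]

end SmallNoise

lemma small_noise_paramCount_le {d d' n Q : ℕ} (hQ : 1000 ≤ Q) (hd : d ≤ Q) (hd' : d' ≤ Q)
    (hn : n ≤ Q) :
    (4 * d + 2 * d') * (d + d' + 1)
      + ((1 + (4 * d + 2 * d')) ^ 2 * n
        + (((d + d') * (2 * Q ^ 11 * 2) + (4 * d + 3 * d') * 2) * (4 * d + 3 * d' + 1)
            + (d + d') * ((d + d') * (2 * Q ^ 11 * 2) + (4 * d + 3 * d') * 2 + 1))
          * (1 + (4 * d + 2 * d')) * (n + d + 1)) * (4 * d + 2 * d' + 1) ≤ Q ^ 22 := by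
  have hQ1 : 1 ≤ Q := by omega
  have hp : ∀ k, 1 ≤ Q ^ k := fun k => Nat.one_le_pow _ _ hQ1
  have e1 : 4 * d + 2 * d' ≤ 6 * Q := by omega
  have e2 : d + d' + 1 ≤ 3 * Q := by omega
  have e3 : 1 + (4 * d + 2 * d') ≤ 7 * Q := by omega
  have e4 : d + d' ≤ 2 * Q := by omega
  have e5 : (4 * d + 3 * d') * 2 ≤ 14 * Q := by omega
  have e6 : 4 * d + 3 * d' + 1 ≤ 8 * Q := by omega
  have e7 : n + d + 1 ≤ 3 * Q := by omega
  have e8 : 4 * d + 2 * d' + 1 ≤ 7 * Q := by omega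
  have e9 : (d + d') * (2 * Q ^ 11 * 2) ≤ 8 * Q ^ 12 := by
    calc _ ≤ 2 * Q * (2 * Q ^ 11 * 2) := Nat.mul_le_mul_right _ e4
      _ = _ := by ring
  have e10 : Q ≤ Q ^ 12 := Nat.le_self_pow (by norm_num) Q
  have e11 : (d + d') * (2 * Q ^ 11 * 2) + (4 * d + 3 * d') * 2 ≤ 22 * Q ^ 12 := by omega
  have e12 : (d + d') * (2 * Q ^ 11 * 2) + (4 * d + 3 * d') * 2 + 1 ≤ 23 * Q ^ 12 := by
    have := hp 12
    omega
  have e13 : ((d + d') * (2 * Q ^ 11 * 2) + (4 * d + 3 * d') * 2) * (4 * d + 3 * d' + 1)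
            + (d + d') * ((d + d') * (2 * Q ^ 11 * 2) + (4 * d + 3 * d') * 2 + 1)
      ≤ 222 * Q ^ 13 := by
    calc _ ≤ 22 * Q ^ 12 * (8 * Q) + 2 * Q * (23 * Q ^ 12) :=
          add_le_add (Nat.mul_le_mul e11 e6) (Nat.mul_le_mul e4 e12)
      _ = 222 * Q ^ 13 := by ring
  calc _ ≤ 6 * Q * (3 * Q) + ((7 * Q) ^ 2 * Q + 222 * Q ^ 13 * (7 * Q) * (3 * Q)) * (7 * Q) := by
        gcongr
    _ = 18 * Q ^ 2 + 343 * Q ^ 4 + 32634 * Q ^ 16 := by ring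
    _ ≤ 18 * Q ^ 16 + 343 * Q ^ 16 + 32634 * Q ^ 16 := by
        gcongr <;> omega
    _ ≤ 1000 ^ 6 * Q ^ 16 := by
        rw [← add_mul, ← add_mul]
        exact Nat.mul_le_mul_right _ (by norm_num)
    _ ≤ Q ^ 6 * Q ^ 16 := by gcongr
    _ = Q ^ 22 := by ring

/-- Here `72 / q³` is the interpolation error and `q⁴` the half-width of the interpolation range; `1
/ σ² ≤ q²` makes the crude bound at most `10 q⁴`, which the Chebyshev factor `q⁻⁸` beats. -/
lemma small_noise_remainder_le {q σ m : ℝ} (hq : 1000 ≤ q) (hσ : 0 < σ) (hσq : 1 / σ ^ 2 ≤ q ^ 2)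
    (hm : m ≤ q) :
    m * (72 / q ^ 3) ^ 2 + m * ((2 + 8 / σ ^ 4) / (q ^ 4) ^ 2 * 19) ≤ 1 / q := by
  have hq0 : 0 < q := by linarith
  have h3 : 2 + 8 / σ ^ 4 ≤ 10 * q ^ 4 := by
    have h4 : 8 / σ ^ 4 = 8 * (1 / σ ^ 2) ^ 2 := by
      field_simp
    have h5 : (1 / σ ^ 2) ^ 2 ≤ (q ^ 2) ^ 2 := pow_le_pow_left₀ (by positivity) hσq 2
    have h6 : (1 : ℝ) ≤ q ^ 4 := one_le_pow₀ (by linarith)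
    rw [h4]
    linarith [show (q ^ 2) ^ 2 = q ^ 4 by ring]
  have h1 : m * (72 / q ^ 3) ^ 2 ≤ 5184 / q ^ 5 := by
    calc m * (72 / q ^ 3) ^ 2 ≤ q * (72 / q ^ 3) ^ 2 := by gcongr
      _ = 5184 / q ^ 5 := by
          field_simp
          norm_num
  have h2 : m * ((2 + 8 / σ ^ 4) / (q ^ 4) ^ 2 * 19) ≤ 190 / q ^ 3 := by
    calc m * ((2 + 8 / σ ^ 4) / (q ^ 4) ^ 2 * 19)
        ≤ q * (10 * q ^ 4 / (q ^ 4) ^ 2 * 19) := by gcongr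
      _ = 190 / q ^ 3 := by
          field_simp
          norm_num
  have h7 : 5184 / q ^ 5 ≤ 1 / (2 * q) := by
    rw [div_le_div_iff₀ (by positivity) (by positivity)]
    have h8 : (1000 : ℝ) ^ 4 ≤ q ^ 4 := pow_le_pow_left₀ (by norm_num) hq 4
    nlinarith
  have h9 : 190 / q ^ 3 ≤ 1 / (2 * q) := by
    rw [div_le_div_iff₀ (by positivity) (by positivity)]
    have h8 : (1000 : ℝ) ^ 2 ≤ q ^ 2 := pow_le_pow_left₀ (by norm_num) hq 2
    nlinarith
  have h10 : 1 / (2 * q) + 1 / (2 * q) = 1 / q := by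
    field_simp
    norm_num
  linarith

/-- The smoothed score of `hardDist f R ε` is approximated by a network that recovers the signs of
the first block, applies the network for `f`, and interpolates the scores of the components. -/
theorem exists_net_small_noise {d d' Q : ℕ} (hd : 0 < d) (hQ : 1000 ≤ Q) (hdQ : d ≤ Q)
    (hd'Q : d' ≤ Q) {f : (Fin d → ℤˣ) → Fin d' → ℤˣ} {N : ReLUNet (Fin d') (Fin d)}
    (hN : N.Computes f) (hNc : N.paramCount ≤ Q) (hNB : N.ParamsBoundedBy Q) {ε R σ : ℝ}
    (hε : 0 < ε) (hε1 : ε ≤ 1) (hR : 2 ≤ R) (hRQ : R ≤ Q) (hσ : 1 / (Q : ℝ) ≤ σ) :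
    ∃ h : ReLUNet (Fin d ⊕ Fin d') (Fin d ⊕ Fin d'), h.depth ≤ N.depth + 2 ∧
      h.paramCount ≤ Q ^ 22 ∧ h.ParamsBoundedBy ((Q : ℝ) ^ 22) ∧
      scoreError (hardDist f R ε) σ h.eval ≤ ENNReal.ofReal
        (d * ((4 * d * (R / (1 + σ ^ 2)) ^ 2 + d' * (2 + 8 / σ ^ 4))
          * Real.exp (-(R ^ 2 / (8 * (1 + σ ^ 2))))) + 1 / Q) := by
  have : NeZero d := ⟨hd.ne'⟩
  have hQr : (1000 : ℝ) ≤ Q := by exact_mod_cast hQ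
  have hdr : (d : ℝ) ≤ Q := by exact_mod_cast hdQ
  have hd'r : (d' : ℝ) ≤ Q := by exact_mod_cast hd'Q
  set q : ℝ := (Q : ℝ) with hq
  have hq0 : 0 < q := by linarith
  have hσ0 : 0 < σ := lt_of_lt_of_le (by positivity) hσ
  set V := 1 + σ ^ 2 with hV
  have hV1 : 1 ≤ V := by nlinarith
  have hV0 : 0 < V := by linarith
  set v := σ ^ 2 / V with hv
  have hv0 : 0 < v := by positivity
  have hv1 : v ≤ 1 := by
    rw [hv, div_le_one hV0]
    linarith
  have hσq : 1 / σ ^ 2 ≤ q ^ 2 := by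
    rw [div_le_iff₀ (by positivity)]
    rw [div_le_iff₀ hq0] at hσ
    nlinarith
  have hvinv : 1 / v ≤ 2 * q ^ 2 := by
    have : 1 / v = 1 + 1 / σ ^ 2 := by
      rw [hv, hV]
      field_simp
      ring
    rw [this]
    nlinarith
  -- The Lipschitz constant `9 / v²` with `1 / v ≤ 2 q²`.
  have hΛ : ∀ x y, |latticeScore v ε x - latticeScore v ε y| ≤ 36 * q ^ 4 * |x - y| := fun x y => by
    refine (abs_latticeScore_sub_le hv0 hv1 hε hε1 y x).trans ?_
    gcongr
    have : 9 / v ^ 2 = 9 * (1 / v) ^ 2 := by ring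
    rw [this]
    have : (1 / v) ^ 2 ≤ (2 * q ^ 2) ^ 2 := by gcongr
    nlinarith
  -- The mesh makes the interpolation error `2 * (36 q⁴) * δ = 72 / q³`; the `2 Q ^ 11` cells below
  -- then cover `[-q⁴, q⁴]`.
  set δ : ℝ := 1 / q ^ 7 with hδ
  have hδ0 : 0 < δ := by positivity
  set η : ℝ := 2 * (36 * q ^ 4) * δ with hη
  have hηq : η = 72 / q ^ 3 := by
    rw [hη, hδ]
    field_simp
    norm_num
  have hη1 : η ≤ 1 := by
    rw [hηq, div_le_one (by positivity)]
    calc (72 : ℝ) ≤ 1000 ^ 3 := by norm_num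
      _ ≤ q ^ 3 := by gcongr
  set M : ℕ := 2 * Q ^ 11 with hM
  have hMδ : -q ^ 4 + M * δ = q ^ 4 := by
    rw [hM, hδ]
    push_cast
    rw [← hq]
    field_simp
    ring
  set P := piecewiseLinear (latticeScore v ε (-q ^ 4)) (interpSlope (latticeScore v ε) (-q ^ 4) δ)
    (-q ^ 4) δ M with hPdef
  have hPclamp : ∀ u, |P u - latticeScore v ε (max (-q ^ 4) (min u (q ^ 4)))| ≤ η := fun u => by
    have := abs_piecewiseLinear_interp_sub_le hΛ (by positivity) hδ0 (-q ^ 4) M u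
    rwa [hMδ] at this
  have hFE : ∀ u, |latticeScore v ε u| ≤ ε / v := abs_latticeScore_le hv0 hε
  have hP : ∀ u w, |P u - latticeScore v ε w| ≤ η + 2 * (ε / v) := fun u w => by
    have h1 := abs_le.1 (hPclamp u)
    have h2 := abs_le.1 (hFE (max (-q ^ 4) (min u (q ^ 4))))
    have h3 := abs_le.1 (hFE w)
    rw [abs_le]
    constructor <;> linarith [h1.1, h1.2, h2.1, h2.2, h3.1, h3.2]
  have hPB : ∀ u, |u| ≤ q ^ 4 → |P u - latticeScore v ε u| ≤ η := fun u hu => by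
    have h1 := hPclamp u
    obtain ⟨h2, h3⟩ := abs_le.1 hu
    rwa [min_eq_left h3, max_eq_right h2] at h1
  have hT : (smallNoiseTail d d' R ε V (-q ^ 4) δ M (latticeScore v ε)).ParamsBoundedBy (q ^ 5) := by
    have h4 : q ^ 5 = q * q ^ 4 := by ring
    have h5 : 1 ≤ q ^ 4 := one_le_pow₀ (by linarith)
    refine paramsBoundedBy_smallNoiseTail hΛ (by nlinarith) hε hε1 hV1 (by linarith)
      (hRQ.trans (by nlinarith)) hδ0 ?_ ?_
    · rw [abs_neg, abs_of_pos (by positivity), abs_of_pos hδ0,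
        show (M : ℝ) * δ = 2 * q ^ 4 by linarith]
      nlinarith
    · refine (hFE _).trans ?_
      have h6 : ε / v ≤ 1 / v := by gcongr
      calc ε / v ≤ 2 * q ^ 2 := h6.trans hvinv
        _ ≤ q ^ 3 * q ^ 2 := by
            gcongr
            calc (2 : ℝ) ≤ 1000 ^ 3 := by norm_num
              _ ≤ q ^ 3 := by gcongr
        _ = q ^ 5 := by ring
  refine ⟨signNet N (smallNoiseTail d d' R ε V (-q ^ 4) δ M (latticeScore v ε)), ?_, ?_, ?_, ?_⟩
  · rw [depth_signNet]
    rfl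
  · refine (paramCount_signNet_le _ _).trans ?_
    rw [paramCount_smallNoiseTail]
    exact small_noise_paramCount_le hQ hdQ hd'Q hNc
  · refine paramsBoundedBy_signNet N _ hNB hT (by linarith) (one_le_pow₀ (by linarith)) ?_
    calc (5 * (d : ℝ) + 3 * d' + 1) ^ 2 * (2 * q ^ 5 * q) ≤ (9 * q) ^ 2 * (2 * q ^ 5 * q) := by
          gcongr
          linarith
      _ = 162 * q ^ 8 := by ring
      _ ≤ q ^ 14 * q ^ 8 := by
          gcongr
          calc (162 : ℝ) ≤ 1000 ^ 14 := by norm_num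
            _ ≤ q ^ 14 := by gcongr
      _ = q ^ 22 := by ring
  · refine (scoreError_small_noise_le (P := P) (B := q ^ 4) (η := η) hN hε hε1 hσ0 hR
      hη1 (by positivity) (ReLUNet.continuous_eval _).measurable hP hPB
      (fun x i => ?_) (fun x j => ?_)).trans (ENNReal.ofReal_le_ofReal ?_)
    · rw [eval_signNet, eval_smallNoiseTail_inl]
    · rw [eval_signNet, eval_smallNoiseTail_inr]
    · have h := small_noise_remainder_le hQr hσ0 hσq hd'r
      rw [← hηq] at h
      linarith

/-! ### Regularity and saturation of the hyperbolic tangent. -/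

section Tanh

lemma hasDerivAt_tanh (x : ℝ) : HasDerivAt Real.tanh (1 / Real.cosh x ^ 2) x := by
  have h := (Real.hasDerivAt_sinh x).div (Real.hasDerivAt_cosh x) (Real.cosh_pos x).ne'
  have he : Real.tanh = Real.sinh / Real.cosh := funext fun x => Real.tanh_eq_sinh_div_cosh x
  rw [he]
  convert! h using 1
  have := Real.cosh_sq x
  congr 1
  linarith

lemma abs_tanh_sub_le (x y : ℝ) : |Real.tanh x - Real.tanh y| ≤ 1 * |x - y| := by
  refine Convex.norm_image_sub_le_of_norm_hasDerivWithin_le (s := Set.univ)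
    (fun x _ => (hasDerivAt_tanh x).hasDerivWithinAt)
    (fun x _ => ?_) convex_univ (Set.mem_univ y) (Set.mem_univ x)
  have h1 : 1 ≤ Real.cosh x ^ 2 := one_le_pow₀ (Real.one_le_cosh x)
  rw [Real.norm_of_nonneg (by positivity)]
  exact div_le_self zero_le_one h1

lemma one_sub_tanh_le {x : ℝ} (hx : 0 < x) : 1 - Real.tanh x ≤ 1 / x := by
  have h1 := Real.add_one_le_exp (2 * x)
  have h2 : Real.exp (2 * x) = Real.exp x * Real.exp x := by rw [← Real.exp_add]; ring_nf
  have h3 : Real.exp x * Real.exp (-x) = 1 := by rw [← Real.exp_add]; simp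
  have h4 := Real.exp_pos x
  have h5 := Real.exp_pos (-x)
  have h6 : 1 - Real.tanh x = 2 * Real.exp (-x) / (Real.exp x + Real.exp (-x)) := by
    rw [Real.tanh_eq]
    field_simp
    ring
  rw [h6, div_le_div_iff₀ (by positivity) hx]
  have h7 : Real.exp (-x) * (2 * x + 1) ≤ Real.exp x := by
    calc Real.exp (-x) * (2 * x + 1) ≤ Real.exp (-x) * Real.exp (2 * x) := by gcongr
      _ = Real.exp x := by rw [← Real.exp_add]; ring_nf
  nlinarith

/-- Outside `[-B, B]` both values lie within `1 / B` of the same limit `± 1`. This polynomial rate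
suffices because the grid may be polynomially wide. -/
lemma abs_tanh_clamp_sub_le {B : ℝ} (hB : 0 < B) (u : ℝ) :
    |Real.tanh (max (-B) (min u B)) - Real.tanh u| ≤ 1 / B := by
  have h1 := one_sub_tanh_le hB
  have hB1 : 0 < 1 / B := by positivity
  rcases le_total u (-B) with h | h
  · rw [min_eq_left (by linarith), max_eq_left h, Real.tanh_neg, abs_le]
    have h2 := one_sub_tanh_le (x := -u) (by linarith)
    rw [Real.tanh_neg] at h2
    have h3 : 1 / (-u) ≤ 1 / B := by gcongr; linarith
    have h4 := Real.tanh_lt_one B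
    have h5 := Real.neg_one_lt_tanh u
    constructor <;> linarith
  · rcases le_total u B with h' | h'
    · rw [min_eq_left h', max_eq_right h, sub_self, abs_zero]
      exact hB1.le
    · rw [min_eq_right h', max_eq_right (by linarith), abs_le]
      have h2 := one_sub_tanh_le (x := u) (by linarith)
      have h3 : 1 / u ≤ 1 / B := by gcongr
      have h4 := Real.tanh_lt_one B
      have h5 := Real.tanh_lt_one u
      constructor <;> linarith

end Tanh

/-! ### Weighted means and their stability under perturbed weights. -/

section WeightedMean

variable {S : Type} [Fintype S] [Nonempty S]

lemma abs_weighted_mean_le {W y : S → ℝ} {b : ℝ} (hW : ∀ s, 0 < W s) (hy : ∀ s, |y s| ≤ b) :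
    |(∑ s, W s * y s) / ∑ s, W s| ≤ b := by
  have hsum : 0 < ∑ s, W s := Finset.sum_pos (fun s _ => hW s) Finset.univ_nonempty
  rw [abs_div, abs_of_pos hsum, div_le_iff₀ hsum, Finset.mul_sum]
  refine (Finset.abs_sum_le_sum_abs _ _).trans (Finset.sum_le_sum fun s _ => ?_)
  rw [abs_mul, abs_of_pos (hW s), mul_comm b]
  exact mul_le_mul_of_nonneg_left (hy s) (hW s).le

/-- A perturbation of the weights by factors with nearly constant logarithms changes a weighted
mean little. -/
lemma abs_weighted_mean_sub_le {a r y : S → ℝ} {m θ : ℝ} (ha : ∀ s, 0 < a s) (hr : ∀ s, 0 < r s)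
    (hmean : ∑ s, a s * (y s - m) = 0) (hy : ∀ s, |y s - m| ≤ 2) (hθ1 : θ ≤ 1)
    (hθ : ∀ s t, |Real.log (r s) - Real.log (r t)| ≤ θ) :
    |(∑ s, a s * r s * y s) / ∑ s, a s * r s - m| ≤ 4 * θ := by
  obtain ⟨t⟩ := ‹Nonempty S›
  have hsum : 0 < ∑ s, a s * r s :=
    Finset.sum_pos (fun s _ => mul_pos (ha s) (hr s)) ⟨t, Finset.mem_univ t⟩
  have h1 : (∑ s, a s * r s * y s) / ∑ s, a s * r s - m
      = (∑ s, a s * ((r s - r t) * (y s - m))) / ∑ s, a s * r s := by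
    rw [div_sub' hsum.ne']
    congr 1
    -- The mean under the unperturbed weights is `m`, so a constant multiple `r t` may be subtracted
    -- from the perturbing factor at no cost.
    have h2 : ∑ s, a s * ((r s - r t) * (y s - m))
        = ∑ s, (a s * r s * y s - a s * r s * m) - r t * ∑ s, a s * (y s - m) := by
      rw [Finset.mul_sum, ← Finset.sum_sub_distrib]
      exact Finset.sum_congr rfl fun s _ => by ring
    rw [h2, hmean, mul_zero, sub_zero, Finset.sum_sub_distrib, Finset.sum_mul]
  -- From `|exp z - 1| ≤ 2 |z|` for `|z| ≤ 1`; together with `|y s - m| ≤ 2` this gives the constant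
  -- `4`.
  have h3 : ∀ s, |r s - r t| ≤ 2 * θ * r s := fun s => by
    have h4 : r t = r s * Real.exp (Real.log (r t) - Real.log (r s)) := by
      rw [Real.exp_sub, Real.exp_log (hr t), Real.exp_log (hr s), mul_div_cancel₀ _ (hr s).ne']
    have h5 := Real.abs_exp_sub_one_le ((hθ t s).trans hθ1)
    have h6 := hθ t s
    calc |r s - r t| = r s * |Real.exp (Real.log (r t) - Real.log (r s)) - 1| := by
          rw [abs_sub_comm]
          conv_lhs => rw [h4]
          rw [← mul_sub_one, abs_mul, abs_of_pos (hr s)]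
      _ ≤ r s * (2 * θ) := mul_le_mul_of_nonneg_left (by linarith) (hr s).le
      _ = 2 * θ * r s := by ring
  rw [h1, abs_div, abs_of_pos hsum, div_le_iff₀ hsum, Finset.mul_sum]
  refine (Finset.abs_sum_le_sum_abs _ _).trans (Finset.sum_le_sum fun s _ => ?_)
  rw [abs_mul, abs_mul, abs_of_pos (ha s)]
  have h7 : |r s - r t| * |y s - m| ≤ 2 * θ * r s * 2 :=
    mul_le_mul (h3 s) (hy s) (abs_nonneg _) ((abs_nonneg _).trans (h3 s))
  nlinarith [ha s]

/-- A sum over all sign vectors of a product over coordinates is the product of the coordinate sums,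
and the factor at `i` vanishes. It serves both the `tanh` formula and the decorrelation of the
signs. -/
lemma sum_prod_mul_eq_zero {d : ℕ} {g : Fin d → ℤˣ → ℝ} {i : Fin d} {y : ℤˣ → ℝ}
    (h : ∑ b, g i b * y b = 0) : ∑ s : Fin d → ℤˣ, (∏ i', g i' (s i')) * y (s i) = 0 := by
  have h1 : ∀ s : Fin d → ℤˣ, (∏ i', g i' (s i')) * y (s i)
      = ∏ i', (g i' (s i') * if i' = i then y (s i') else 1) := fun s => by
    rw [Finset.prod_mul_distrib]
    congr 1
    rw [Finset.prod_ite_eq' Finset.univ i fun i' => y (s i')]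
    simp
  have h2 := Finset.prod_univ_sum (fun _ : Fin d => (Finset.univ : Finset ℤˣ))
    (fun i' b => g i' b * if i' = i then y b else 1)
  rw [Fintype.piFinset_univ] at h2
  simp only [h1]
  rw [← h2]
  refine Finset.prod_eq_zero (Finset.mem_univ i) ?_
  simpa using h

end WeightedMean

/-! ### The score and its network for large noise. -/

section LargeNoise

lemma latticeDecay_le {v ε : ℝ} (hv : 1 / 2 ≤ v) : latticeDecay v ε ≤ latticeDecay (1 / 2) ε := by
  refine Real.exp_le_exp.2 (neg_le_neg ?_)
  gcongr

/-- Since `b² = 1`, the two densities differ only through `exp (± R x / V)`. Thus `tanh (R x / V)`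
is the posterior mean of the sign in the balanced mixture of `N(± R, V)`. -/
lemma sum_gaussianPDFReal_mul_sub_tanh (R x : ℝ) {V : ℝ} (hV : 0 < V) :
    ∑ b : ℤˣ, gaussianPDFReal (R * ((b : ℤ) : ℝ)) V.toNNReal x
      * (((b : ℤ) : ℝ) - Real.tanh (R / V * x)) = 0 := by
  have h : ∀ r : ℝ, r ^ 2 = 1 → gaussianPDFReal (R * r) V.toNNReal x
      = (√(2 * Real.pi * V))⁻¹ * Real.exp (-(x ^ 2 + R ^ 2) / (2 * V))
        * Real.exp (r * (R / V * x)) := fun r hr => by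
    rw [gaussianPDFReal, Real.coe_toNNReal _ hV.le, mul_assoc (√(2 * Real.pi * V))⁻¹,
      ← Real.exp_add]
    congr 2
    have : (x - R * r) ^ 2 = x ^ 2 - 2 * R * r * x + R ^ 2 * r ^ 2 := by ring
    rw [this, hr]
    field_simp
    ring
  have huniv : (Finset.univ : Finset ℤˣ) = {1, -1} := by decide
  rw [huniv, Finset.sum_pair (by decide)]
  push_cast
  rw [h 1 (by norm_num), h (-1) (by norm_num), one_mul, neg_one_mul, Real.tanh_eq]
  have h4 := Real.exp_pos (R / V * x)
  have h5 := Real.exp_pos (-(R / V * x))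
  field_simp
  ring

variable {d d' : ℕ} {f : (Fin d → ℤˣ) → Fin d' → ℤˣ} {R ε σ : ℝ}

/-- The factor of the weight of the component `s` that comes from the second block. -/
def latticeFactor (f : (Fin d → ℤˣ) → Fin d' → ℤˣ) (ε σ : ℝ) (x : Fin d ⊕ Fin d' → ℝ)
    (s : Fin d → ℤˣ) : ℝ :=
  ∏ j, (latticeGaussian 1 ε (-combPhase ε (f s j)))⁻¹
    * latticeGaussian (σ ^ 2 / (1 + σ ^ 2)) ε (x (Sum.inr j) / (1 + σ ^ 2) - combPhase ε (f s j))

lemma latticeFactor_pos (hε : 0 < ε) (hσ : 0 < σ) (x : Fin d ⊕ Fin d' → ℝ) (s : Fin d → ℤˣ) :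
    0 < latticeFactor f ε σ x s :=
  Finset.prod_pos fun j _ => mul_pos (inv_pos.2 (latticeGaussian_pos one_pos hε _))
    (latticeGaussian_pos (by positivity) hε _)

/-- The first factor does not depend on `s` and drops out of posterior means. The second factorizes
over the signs, and all the coupling through `f` sits in `latticeFactor`. -/
lemma prod_gaussianSmoothing_hardMarginal (hε : 0 < ε) (hσ : 0 < σ) (x : Fin d ⊕ Fin d' → ℝ)
    (s : Fin d → ℤˣ) : ∏ o, gaussianSmoothing (hardMarginal f R ε s o) σ (x o)
      = (∏ j : Fin d', (√(2 * Real.pi) * σ)⁻¹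
          * Real.exp (-x (Sum.inr j) ^ 2 / (2 * (1 + σ ^ 2))))
        * ((∏ i, gaussianPDFReal (R * ((s i : ℤ) : ℝ)) (1 + σ ^ 2).toNNReal (x (Sum.inl i)))
          * latticeFactor f ε σ x s) := by
  rw [Fintype.prod_sum_type, mul_left_comm, latticeFactor, ← Finset.prod_mul_distrib]
  simp only [hardMarginal, Sum.elim_inl, Sum.elim_inr, gaussianSmoothing_gaussianReal _ hσ,
    gaussianSmoothing_discretizedGaussian hε _ hσ]
  congr 1
  exact Finset.prod_congr rfl fun j _ => by ring

lemma half_le_sq_div (hσ : 1 ≤ σ) : 1 / 2 ≤ σ ^ 2 / (1 + σ ^ 2) := by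
  rw [div_le_div_iff₀ (by norm_num) (by positivity)]
  nlinarith

/-- Each coordinate of the second block contributes an oscillation `16 q` from the smoothed lattice
sum and another `16 q` from the normalizing constant. For `σ ≥ 1` both variances are at least `1 /
2`. -/
lemma abs_log_latticeFactor_sub_le (hε : 0 < ε) (hσ : 1 ≤ σ) (hq : latticeDecay (1 / 2) ε ≤ 1 / 8)
    (x : Fin d ⊕ Fin d' → ℝ) (s t : Fin d → ℤˣ) :
    |Real.log (latticeFactor f ε σ x s) - Real.log (latticeFactor f ε σ x t)|
      ≤ 32 * d' * latticeDecay (1 / 2) ε := by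
  have hv := half_le_sq_div hσ
  have hv0 : 0 < σ ^ 2 / (1 + σ ^ 2) := by linarith
  have hlog : ∀ s, Real.log (latticeFactor f ε σ x s)
      = ∑ j, (Real.log (latticeGaussian (σ ^ 2 / (1 + σ ^ 2)) ε
          (x (Sum.inr j) / (1 + σ ^ 2) - combPhase ε (f s j)))
        - Real.log (latticeGaussian 1 ε (-combPhase ε (f s j)))) := fun s => by
    rw [latticeFactor, Real.log_prod fun j _ => (mul_pos
      (inv_pos.2 (latticeGaussian_pos one_pos hε _)) (latticeGaussian_pos hv0 hε _)).ne']
    refine Finset.sum_congr rfl fun j _ => ?_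
    rw [Real.log_mul (inv_pos.2 (latticeGaussian_pos one_pos hε _)).ne'
      (latticeGaussian_pos hv0 hε _).ne', Real.log_inv]
    ring
  rw [hlog, hlog, ← Finset.sum_sub_distrib]
  refine (Finset.abs_sum_le_sum_abs _ _).trans ?_
  have hterm : ∀ j ∈ (Finset.univ : Finset (Fin d')), |Real.log (latticeGaussian
      (σ ^ 2 / (1 + σ ^ 2)) ε (x (Sum.inr j) / (1 + σ ^ 2) - combPhase ε (f s j)))
        - Real.log (latticeGaussian 1 ε (-combPhase ε (f s j)))
      - (Real.log (latticeGaussian (σ ^ 2 / (1 + σ ^ 2)) ε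
          (x (Sum.inr j) / (1 + σ ^ 2) - combPhase ε (f t j)))
        - Real.log (latticeGaussian 1 ε (-combPhase ε (f t j))))|
      ≤ 32 * latticeDecay (1 / 2) ε := fun j _ => by
    have d1 := latticeDecay_le (ε := ε) hv
    have d2 := latticeDecay_le (ε := ε) (v := 1) (by norm_num)
    have h1 := abs_log_latticeGaussian_sub_le hv0 hε (d1.trans hq)
      (x (Sum.inr j) / (1 + σ ^ 2) - combPhase ε (f s j))
      (x (Sum.inr j) / (1 + σ ^ 2) - combPhase ε (f t j))
    have h2 := abs_log_latticeGaussian_sub_le one_pos hε (d2.trans hq)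
      (-combPhase ε (f s j)) (-combPhase ε (f t j))
    rw [abs_le] at h1 h2 ⊢
    constructor <;> linarith [h1.1, h1.2, h2.1, h2.2]
  refine (Finset.sum_le_sum hterm).trans (le_of_eq ?_)
  rw [Finset.sum_const, Finset.card_univ, Fintype.card_fin, nsmul_eq_mul]
  ring

lemma smoothedScore_hardDist (hε : 0 < ε) (hσ : 0 < σ) (x : Fin d ⊕ Fin d' → ℝ)
    (o : Fin d ⊕ Fin d') : smoothedScore (hardDist f R ε) σ x o
      = (∑ s, (∏ i, gaussianPDFReal (R * ((s i : ℤ) : ℝ)) (1 + σ ^ 2).toNNReal (x (Sum.inl i)))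
          * latticeFactor f ε σ x s * hardMarginalScore f R ε σ s o (x o))
        / ∑ s, (∏ i, gaussianPDFReal (R * ((s i : ℤ) : ℝ)) (1 + σ ^ 2).toNNReal (x (Sum.inl i)))
          * latticeFactor f ε σ x s := by
  have hprob := isProbabilityMeasure_hardMarginal f R hε
  have hK : (∏ j : Fin d', (√(2 * Real.pi) * σ)⁻¹
      * Real.exp (-x (Sum.inr j) ^ 2 / (2 * (1 + σ ^ 2)))) ≠ 0 :=
    (Finset.prod_pos fun j _ => by have := Real.pi_pos; positivity).ne'
  rw [hardDist_eq, smoothedScore_productMixture _ _ (hardWeight_ne_zero d) (hardWeight_ne_top d) hσ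
    x o fun s => hasDerivAt_gaussianSmoothing_hardMarginal f R hε hσ s o (x o)]
  simp only [prod_gaussianSmoothing_hardMarginal hε hσ]
  simp only [mul_assoc _ (_ * _) (hardMarginalScore _ _ _ _ _ _ _)]
  rw [← Finset.mul_sum, ← Finset.mul_sum, mul_div_mul_left _ _ hK]

lemma weighted_mean_affine {S : Type} [Fintype S] {W y : S → ℝ} (hW : 0 < ∑ s, W s) (R x V : ℝ) :
    (∑ s, W s * ((R * y s - x) / V)) / ∑ s, W s
      = (R * ((∑ s, W s * y s) / ∑ s, W s) - x) / V := by
  have h : ∑ s, W s * ((R * y s - x) / V) = (R * ∑ s, W s * y s - x * ∑ s, W s) / V := by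
    rw [Finset.mul_sum, Finset.mul_sum, ← Finset.sum_sub_distrib, Finset.sum_div]
    exact Finset.sum_congr rfl fun s _ => by ring
  rw [h, div_right_comm, sub_div, mul_div_assoc, mul_div_cancel_right₀ _ hW.ne']

/-- With constant `latticeFactor` the posterior would be a product over the signs and the mean of `s
i` exactly a `tanh`. The nearly constant factor perturbs this mean by at most four times the
oscillation of its logarithm. -/
lemma abs_smoothedScore_inl_sub_le (hε : 0 < ε) (hσ : 1 ≤ σ)
    (hq : latticeDecay (1 / 2) ε ≤ 1 / 8) (hθ : 32 * d' * latticeDecay (1 / 2) ε ≤ 1) (hR : 0 ≤ R)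
    (x : Fin d ⊕ Fin d' → ℝ) (i : Fin d) :
    |smoothedScore (hardDist f R ε) σ x (Sum.inl i)
      - (R * Real.tanh (R / (1 + σ ^ 2) * x (Sum.inl i)) - x (Sum.inl i)) / (1 + σ ^ 2)|
      ≤ R / (1 + σ ^ 2) * (4 * (32 * d' * latticeDecay (1 / 2) ε)) := by
  have hσ0 : 0 < σ := by linarith
  have hV : 0 < 1 + σ ^ 2 := by positivity
  have hne : (1 + σ ^ 2).toNNReal ≠ 0 := by simpa using hV
  obtain ⟨m, hm⟩ : ∃ m, m = Real.tanh (R / (1 + σ ^ 2) * x (Sum.inl i)) := ⟨_, rfl⟩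
  obtain ⟨g, hgdef⟩ : ∃ g : Fin d → ℤˣ → ℝ, g = fun i (b : ℤˣ) =>
    gaussianPDFReal (R * ((b : ℤ) : ℝ)) (1 + σ ^ 2).toNNReal (x (Sum.inl i)) := ⟨_, rfl⟩
  have hg : ∑ b, g i b * (((b : ℤ) : ℝ) - m) = 0 := by
    rw [hgdef, hm]
    exact sum_gaussianPDFReal_mul_sub_tanh R (x (Sum.inl i)) hV
  obtain ⟨a, ha⟩ : ∃ a : (Fin d → ℤˣ) → ℝ, a = fun s => ∏ i, g i (s i) := ⟨_, rfl⟩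
  have hapos : ∀ s, 0 < a s := fun s => by
    rw [ha, hgdef]
    exact Finset.prod_pos fun i _ => gaussianPDFReal_pos _ _ _ hne
  have hrpos : ∀ s, 0 < latticeFactor f ε σ x s := latticeFactor_pos hε hσ0 x
  have hsum : 0 < ∑ s, a s * latticeFactor f ε σ x s :=
    Finset.sum_pos (fun s _ => mul_pos (hapos s) (hrpos s)) Finset.univ_nonempty
  have h1 : smoothedScore (hardDist f R ε) σ x (Sum.inl i)
      = (R * ((∑ s, a s * latticeFactor f ε σ x s * ((s i : ℤ) : ℝ))
        / ∑ s, a s * latticeFactor f ε σ x s) - x (Sum.inl i)) / (1 + σ ^ 2) := by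
    rw [smoothedScore_hardDist hε hσ0, ← weighted_mean_affine hsum, ha, hgdef]
    rfl
  rw [← hm]
  have h2 : |(∑ s, a s * latticeFactor f ε σ x s * ((s i : ℤ) : ℝ))
        / ∑ s, a s * latticeFactor f ε σ x s - m|
      ≤ 4 * (32 * d' * latticeDecay (1 / 2) ε) := by
    have hmean : ∑ s, a s * (((s i : ℤ) : ℝ) - m) = 0 :=
      by
      rw [ha]
      exact sum_prod_mul_eq_zero (i := i) (g := g) (y := fun b => ((b : ℤ) : ℝ) - m) hg
    refine abs_weighted_mean_sub_le hapos hrpos hmean (fun s => ?_) hθ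
      (abs_log_latticeFactor_sub_le hε hσ hq x)
    · have t1 := Real.tanh_lt_one (R / (1 + σ ^ 2) * x (Sum.inl i))
      have t2 := Real.neg_one_lt_tanh (R / (1 + σ ^ 2) * x (Sum.inl i))
      rw [← hm] at t1 t2
      rcases Int.units_eq_one_or (s i) with hs | hs <;> rw [hs, abs_le] <;> push_cast <;>
        constructor <;> linarith
  rw [h1, ← sub_div, sub_sub_sub_cancel_right, ← mul_sub, mul_div_right_comm, abs_mul,
    abs_of_nonneg (by positivity)]
  gcongr

/-- The left side squares a posterior mean of values of `latticeScore`, divided by `1 + σ² ≥ 1`.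
Each value is small by Poisson summation, so the posterior need not be known. -/
lemma sq_smoothedScore_inr_add_le (hε : 0 < ε) (hσ : 1 ≤ σ)
    (hq : latticeDecay (1 / 2) ε ≤ 1 / 8) (x : Fin d ⊕ Fin d' → ℝ) (j : Fin d') :
    (smoothedScore (hardDist f R ε) σ x (Sum.inr j) + x (Sum.inr j) / (1 + σ ^ 2)) ^ 2
      ≤ 289 * latticeDecay (1 / 2) ε := by
  have hσ0 : 0 < σ := by linarith
  have hV : 0 < 1 + σ ^ 2 := by positivity
  have hv := half_le_sq_div hσ
  have hne : (1 + σ ^ 2).toNNReal ≠ 0 := by simpa using hV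
  set W : (Fin d → ℤˣ) → ℝ := fun s =>
    (∏ i, gaussianPDFReal (R * ((s i : ℤ) : ℝ)) (1 + σ ^ 2).toNNReal (x (Sum.inl i)))
      * latticeFactor f ε σ x s with hW
  have hWpos : ∀ s, 0 < W s := fun s => mul_pos
    (Finset.prod_pos fun i _ => gaussianPDFReal_pos _ _ _ hne) (latticeFactor_pos hε hσ0 x s)
  have hsum : 0 < ∑ s, W s := Finset.sum_pos (fun s _ => hWpos s) Finset.univ_nonempty
  set y : (Fin d → ℤˣ) → ℝ := fun s => latticeScore (σ ^ 2 / (1 + σ ^ 2)) ε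
    (x (Sum.inr j) / (1 + σ ^ 2) - combPhase ε (f s j)) with hy
  have h1 : smoothedScore (hardDist f R ε) σ x (Sum.inr j)
      = (1 * ((∑ s, W s * y s) / ∑ s, W s) - x (Sum.inr j)) / (1 + σ ^ 2) := by
    rw [smoothedScore_hardDist hε hσ0, ← weighted_mean_affine hsum]
    simp only [one_mul]
    rfl
  set b := √(289 * latticeDecay (1 / 2) ε) with hb
  have hb2 : b ^ 2 = 289 * latticeDecay (1 / 2) ε :=
    Real.sq_sqrt (by have := latticeDecay_pos (1 / 2) ε; positivity)
  have h2 : |(∑ s, W s * y s) / ∑ s, W s| ≤ b := by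
    refine abs_weighted_mean_le hWpos fun s => Real.abs_le_sqrt ?_
    refine (sq_latticeScore_le_of_decay hv hε ((latticeDecay_le hv).trans hq) _).trans ?_
    gcongr
    exact latticeDecay_le hv
  rw [h1, one_mul, ← add_div, sub_add_cancel, ← hb2, ← sq_abs, abs_div, abs_of_pos hV]
  refine pow_le_pow_left₀ (by positivity) ?_ 2
  refine (div_le_self (abs_nonneg _) (by nlinarith)).trans h2

variable (d d') in
/-- The network that approximates the score in the large noise case by applying to each coordinate
of the first block an interpolation of the score of a mixture of two Gaussians. -/
def largeNoiseNet [NeZero d] (R V t₀ δ : ℝ) (M : ℕ) : ReLUNet (Fin d ⊕ Fin d') (Fin d ⊕ Fin d') :=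
  piecewiseLinearNet
    (Sum.elim (fun i k => if k = Sum.inl i then R / V else 0) 0)
    (fun o k => if k = o then -V⁻¹ else 0) 0
    (Sum.elim (fun _ => R / V * Real.tanh t₀) 0)
    (Sum.elim (fun _ m => R / V * interpSlope Real.tanh t₀ δ m) 0) t₀ δ M

section Eval

variable [NeZero d] (V t₀ δ : ℝ) (M : ℕ) (x : Fin d ⊕ Fin d' → ℝ)

lemma eval_largeNoiseNet_inl (i : Fin d) :
    (largeNoiseNet d d' R V t₀ δ M).eval x (Sum.inl i)
      = (R * piecewiseLinear (Real.tanh t₀) (interpSlope Real.tanh t₀ δ) t₀ δ M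
          (R / V * x (Sum.inl i)) - x (Sum.inl i)) / V := by
  rw [largeNoiseNet, eval_piecewiseLinearNet]
  simp only [Sum.elim_inl, ite_mul, zero_mul, Finset.sum_ite_eq', Finset.mem_univ, if_true,
    Pi.zero_apply, add_zero, piecewiseLinear]
  rw [mul_add, Finset.mul_sum, sub_div, add_div, Finset.sum_div, sub_eq_add_neg]
  congr 2
  · ring
  · exact Finset.sum_congr rfl fun m _ => by ring
  · ring

lemma eval_largeNoiseNet_inr (j : Fin d') :
    (largeNoiseNet d d' R V t₀ δ M).eval x (Sum.inr j) = -(x (Sum.inr j) / V) := by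
  rw [largeNoiseNet, eval_piecewiseLinearNet]
  simp only [Sum.elim_inr, ite_mul, zero_mul, Finset.sum_ite_eq', Finset.mem_univ, if_true,
    Pi.zero_apply, add_zero, piecewiseLinear, Finset.sum_const_zero, zero_add]
  ring

end Eval

lemma large_noise_paramCount_le {n Q : ℕ} (hQ : 1000 ≤ Q) (hn : n ≤ 2 * Q) :
    (n * (2 * Q ^ 6 * 2) + n * 2) * (n + 1) + n * (n * (2 * Q ^ 6 * 2) + n * 2 + 1) ≤ Q ^ 22 := by
  have hQ1 : 1 ≤ Q := by omega
  have e1 : n + 1 ≤ 3 * Q := by omega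
  have e2 : n * 2 + 1 ≤ 5 * Q := by omega
  have e10 : Q ≤ Q ^ 7 := Nat.le_self_pow (by norm_num) Q
  have e3 : n * (2 * Q ^ 6 * 2) ≤ 8 * Q ^ 7 := by
    calc _ ≤ 2 * Q * (2 * Q ^ 6 * 2) := Nat.mul_le_mul_right _ hn
      _ = _ := by ring
  have e4 : n * (2 * Q ^ 6 * 2) + n * 2 + 1 ≤ 13 * Q ^ 7 := by omega
  have e5 : n * (2 * Q ^ 6 * 2) + n * 2 ≤ 13 * Q ^ 7 := by omega
  calc _ ≤ 13 * Q ^ 7 * (3 * Q) + 2 * Q * (13 * Q ^ 7) := by gcongr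
    _ = 65 * Q ^ 8 := by ring
    _ ≤ 1000 ^ 14 * Q ^ 8 := Nat.mul_le_mul_right _ (by norm_num)
    _ ≤ Q ^ 14 * Q ^ 8 := by gcongr
    _ = Q ^ 22 := by ring

/-- For large noise, the smoothed score of `hardDist f R ε` is approximated by a network with one
hidden layer. -/
theorem exists_net_large_noise {Q : ℕ} (hd : 0 < d) (hQ : 1000 ≤ Q) (hdQ : d ≤ Q)
    (hd'Q : d' ≤ Q) (hε : 0 < ε) (hR0 : 0 ≤ R) (hRQ : R ≤ Q)
    (hσ : 1 ≤ σ) (hq : latticeDecay (1 / 2) ε ≤ 1 / 8)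
    (hθ : 32 * d' * latticeDecay (1 / 2) ε ≤ 1) :
    ∃ h : ReLUNet (Fin d ⊕ Fin d') (Fin d ⊕ Fin d'), h.depth = 2 ∧
      h.paramCount ≤ Q ^ 22 ∧ h.ParamsBoundedBy ((Q : ℝ) ^ 22) ∧
      scoreError (hardDist f R ε) σ h.eval ≤ ENNReal.ofReal
        (1 / Q + (d * ((R / (1 + σ ^ 2)) ^ 2 * (32 * (32 * d' * latticeDecay (1 / 2) ε) ^ 2))
          + d' * (289 * latticeDecay (1 / 2) ε))) := by
  have : NeZero d := ⟨hd.ne'⟩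
  have hprob := isProbabilityMeasure_hardMarginal f R hε
  have hQr : (1000 : ℝ) ≤ Q := by exact_mod_cast hQ
  have hdr : (d : ℝ) ≤ Q := by exact_mod_cast hdQ
  set q : ℝ := (Q : ℝ) with hqdef
  have hq0 : 0 < q := by linarith
  set V := 1 + σ ^ 2 with hV
  have hV1 : 1 ≤ V := by nlinarith
  have hV0 : 0 < V := by linarith
  have hRV0 : 0 ≤ R / V := by positivity
  have hRV : R / V ≤ q := (div_le_self hR0 hV1).trans hRQ
  -- Mesh `q⁻³` on `[-q³, q³]`: interpolation costs `2 q⁻³` and the clamp `q⁻³`, together `3 / q³`.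
  set δ : ℝ := 1 / q ^ 3 with hδ
  have hδ0 : 0 < δ := by positivity
  set M : ℕ := 2 * Q ^ 6 with hM
  have hMδ : -q ^ 3 + M * δ = q ^ 3 := by
    rw [hM, hδ]
    push_cast
    rw [← hqdef]
    field_simp
    ring
  set P := piecewiseLinear (Real.tanh (-q ^ 3)) (interpSlope Real.tanh (-q ^ 3) δ)
    (-q ^ 3) δ M with hPdef
  have hP : ∀ u, |P u - Real.tanh u| ≤ 3 / q ^ 3 := fun u => by
    have h1 := abs_piecewiseLinear_interp_sub_le abs_tanh_sub_le zero_le_one hδ0 (-q ^ 3) M u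
    have h2 := abs_tanh_clamp_sub_le (B := q ^ 3) (by positivity) u
    rw [hMδ] at h1
    have h3 : 3 / q ^ 3 = 2 * 1 * δ + 1 / q ^ 3 := by rw [hδ]; ring
    rw [h3]
    exact (abs_sub_le _ _ _).trans (add_le_add h1 h2)
  have hq22 : q ^ 4 ≤ q ^ 22 := pow_le_pow_right₀ (by linarith) (by norm_num)
  have hq3 : 1 ≤ q ^ 3 := one_le_pow₀ (by linarith)
  have hq4 : q ^ 4 = q * q ^ 3 := by ring
  have hqq4 : q ≤ q ^ 4 := by nlinarith
  refine ⟨largeNoiseNet d d' R V (-q ^ 3) δ M, rfl, ?_, ?_, ?_⟩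
  · rw [largeNoiseNet, paramCount_piecewiseLinearNet, Fintype.card_sum, Fintype.card_fin,
      Fintype.card_fin]
    exact large_noise_paramCount_le hQ (by omega)
  · refine ReLUNet.ParamsBoundedBy.mono hq22 (paramsBoundedBy_piecewiseLinearNet (by nlinarith)
      ?_ ?_ ?_ ?_ ?_)
    · rintro (i | j) k
      · simp only [Sum.elim_inl]
        split_ifs
        · rw [abs_of_nonneg hRV0]
          linarith
        · simp only [abs_zero]
          positivity
      · simp only [Sum.elim_inr, Pi.zero_apply, abs_zero]
        positivity
    · intro o k
      split_ifs
      · rw [abs_neg, abs_of_pos (by positivity)]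
        have := inv_le_one_of_one_le₀ hV1
        nlinarith
      · simp only [abs_zero]
        positivity
    · intro o
      rw [abs_neg, abs_of_pos (show 0 < q ^ 3 by positivity), abs_of_pos hδ0,
        show (M : ℝ) * δ = 2 * q ^ 3 by linarith, Pi.zero_apply, abs_zero]
      nlinarith
    · rintro (i | j)
      · simp only [Sum.elim_inl, abs_mul, abs_of_nonneg hRV0]
        have h1 := Real.abs_tanh_lt_one (-q ^ 3)
        nlinarith [abs_nonneg (Real.tanh (-q ^ 3))]
      · simp only [Sum.elim_inr, Pi.zero_apply, abs_zero]
        positivity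
    · rintro (i | j) m
      · simp only [Sum.elim_inl, abs_mul, abs_of_nonneg hRV0]
        have h1 := abs_interpSlope_le abs_tanh_sub_le hδ0 (-q ^ 3) m
        nlinarith [abs_nonneg (interpSlope Real.tanh (-q ^ 3) δ m)]
      · simp only [Sum.elim_inr, Pi.zero_apply, abs_zero]
        positivity
  · rw [hardDist_eq]
    refine scoreError_le_of_forall_le _ _ (hardWeight_ne_top d) (card_mul_hardWeight d)
      (by linarith) fun x => ?_
    rw [← hardDist_eq, Fintype.sum_sum_type]
    set θ := 32 * (d' : ℝ) * latticeDecay (1 / 2) ε with hθdef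
    -- By `(a + b)² ≤ 2 a² + 2 b²`, where `18 = 2 * 3²` comes from the interpolation and `32 = 2 *
    -- 4²` from the perturbation of the weights.
    have hl : ∀ i ∈ (Finset.univ : Finset (Fin d)),
        ((largeNoiseNet d d' R V (-q ^ 3) δ M).eval x (Sum.inl i)
          - smoothedScore (hardDist f R ε) σ x (Sum.inl i)) ^ 2
        ≤ (R / V) ^ 2 * (18 / q ^ 6) + (R / V) ^ 2 * (32 * θ ^ 2) := fun i _ => by
      have h1 := abs_smoothedScore_inl_sub_le (f := f) hε hσ hq hθ hR0 x i
      have h2 : |(largeNoiseNet d d' R V (-q ^ 3) δ M).eval x (Sum.inl i)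
          - (R * Real.tanh (R / V * x (Sum.inl i)) - x (Sum.inl i)) / V|
          ≤ R / V * (3 / q ^ 3) := by
        rw [eval_largeNoiseNet_inl, ← sub_div, sub_sub_sub_cancel_right, ← mul_sub,
          mul_div_right_comm, abs_mul, abs_of_nonneg hRV0]
        exact mul_le_mul_of_nonneg_left (hP _) hRV0
      rw [abs_sub_comm] at h1
      have h3 := (abs_sub_le _ _ _).trans (add_le_add h2 h1)
      rw [← sq_abs]
      refine (pow_le_pow_left₀ (abs_nonneg _) h3 2).trans ?_
      have h4 : (R / V) ^ 2 * (18 / q ^ 6) = 2 * (R / V * (3 / q ^ 3)) ^ 2 := by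
        field_simp
        ring
      have h5 : (R / V) ^ 2 * (32 * θ ^ 2) = 2 * (R / V * (4 * θ)) ^ 2 := by ring
      rw [h4, h5]
      nlinarith [sq_nonneg (R / V * (3 / q ^ 3) - R / V * (4 * θ))]
    have hr : ∀ j ∈ (Finset.univ : Finset (Fin d')),
        ((largeNoiseNet d d' R V (-q ^ 3) δ M).eval x (Sum.inr j)
          - smoothedScore (hardDist f R ε) σ x (Sum.inr j)) ^ 2
        ≤ 289 * latticeDecay (1 / 2) ε := fun j _ => by
      rw [eval_largeNoiseNet_inr, ← neg_add', neg_sq, add_comm]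
      exact sq_smoothedScore_inr_add_le hε hσ hq x j
    refine (add_le_add (Finset.sum_le_sum hl) (Finset.sum_le_sum hr)).trans ?_
    simp only [Finset.sum_const, Finset.card_univ, Fintype.card_fin, nsmul_eq_mul]
    have h6 : d * ((R / V) ^ 2 * (18 / q ^ 6)) ≤ 1 / q := by
      calc d * ((R / V) ^ 2 * (18 / q ^ 6)) ≤ q * (q ^ 2 * (18 / q ^ 6)) := by gcongr
        _ = 18 / q ^ 3 := by field_simp
        _ ≤ 1 / q := by
            rw [div_le_div_iff₀ (by positivity) hq0]
            have : (1000 : ℝ) ^ 2 ≤ q ^ 2 := pow_le_pow_left₀ (by norm_num) hQr 2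
            nlinarith
    rw [mul_add]
    linarith

end LargeNoise

/-! ### Behaviour of densities, scores and errors under scaling. -/

section Scaling

variable {ι : Type}

lemma measurableEmbedding_smul_fun {r : ℝ} (hr : r ≠ 0) :
    MeasurableEmbedding fun x : ι → ℝ => r • x :=
  (MeasurableEquiv.smul₀ r hr).measurableEmbedding

variable [Fintype ι]

lemma gaussianPDFReal_inv_mul {R σ : ℝ} (hR : 0 < R) (hσ : 0 < σ) (m x : ℝ) :
    gaussianPDFReal (R⁻¹ * m) (σ ^ 2).toNNReal x
      = R * gaussianPDFReal m ((R * σ) ^ 2).toNNReal (R * x) := by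
  have h2 : √(2 * Real.pi * (R * σ) ^ 2) = R * √(2 * Real.pi * σ ^ 2) := by
    rw [show 2 * Real.pi * (R * σ) ^ 2 = R ^ 2 * (2 * Real.pi * σ ^ 2) by ring,
      Real.sqrt_mul (sq_nonneg R), Real.sqrt_sq hR.le]
  rw [gaussianPDFReal, gaussianPDFReal, Real.coe_toNNReal _ (sq_nonneg _),
    Real.coe_toNNReal _ (sq_nonneg _), h2, mul_inv, ← mul_assoc, ← mul_assoc,
    mul_inv_cancel₀ hR.ne', one_mul]
  congr 2
  field_simp

/-- Dilation by `R` turns a kernel of width `σ` around the shrunken points into one of width `R σ`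
around the original points, with a factor `R` per coordinate. -/
lemma smoothedDensity_map_smul (P : Measure (ι → ℝ)) {R σ : ℝ} (hR : 0 < R) (hσ : 0 < σ)
    (x : ι → ℝ) : smoothedDensity (P.map fun x => R⁻¹ • x) σ x
      = R ^ Fintype.card ι * smoothedDensity P (R * σ) (R • x) := by
  rw [smoothedDensity, (measurableEmbedding_smul_fun (inv_ne_zero hR.ne')).integral_map,
    smoothedDensity, ← integral_const_mul]
  congr 1 with y
  simp only [Pi.smul_apply, smul_eq_mul, gaussianPDFReal_inv_mul hR hσ]
  rw [Finset.prod_mul_distrib, Finset.prod_const, Finset.card_univ]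

variable [DecidableEq ι]

/-- The factor `R ^ n` becomes an additive constant under the logarithm, which needs the density to
be nonzero, and the chain rule produces `R`. -/
lemma smoothedScore_map_smul (P : Measure (ι → ℝ)) {R σ : ℝ} (hR : 0 < R) (hσ : 0 < σ)
    (hP : ∀ x, smoothedDensity P (R * σ) x ≠ 0) (x : ι → ℝ) (i : ι) :
    smoothedScore (P.map fun x => R⁻¹ • x) σ x i = R * smoothedScore P (R * σ) (R • x) i := by
  have h : (fun t : ℝ => Real.log (smoothedDensity (P.map fun x => R⁻¹ • x) σ
      (Function.update x i t))) = fun t => Real.log (R ^ Fintype.card ι)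
        + (fun u => Real.log (smoothedDensity P (R * σ) (Function.update (R • x) i u)))
          (R * t) := by
    ext t
    rw [smoothedDensity_map_smul P hR hσ, Real.log_mul (by positivity) (hP _),
      ← smul_eq_mul R t, ← Function.update_smul]
  rw [smoothedScore, h, deriv_const_add, deriv_comp_mul_left R (fun u => Real.log
    (smoothedDensity P (R * σ) (Function.update (R • x) i u))) (x i), smul_eq_mul]
  rfl

/-- Scaling of a distribution by `R⁻¹` multiplies the score error by `R²`. -/
lemma scoreError_map_smul (P : Measure (ι → ℝ)) {R σ : ℝ} (hR : 0 < R) (hσ : 0 < σ)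
    (hP : ∀ x, smoothedDensity P (R * σ) x ≠ 0) (hm : Measurable (smoothedDensity P (R * σ)))
    (h : (ι → ℝ) → ι → ℝ) :
    scoreError (P.map fun x => R⁻¹ • x) σ (fun x i => R * h (R • x) i)
      = ENNReal.ofReal (R ^ 2) * scoreError P (R * σ) h := by
  have hms : Measurable fun x : ι → ℝ => R • x := measurable_const_smul R
  have hsq : ∀ x : ι → ℝ, ∑ i, (R * h (R • x) i
      - smoothedScore (P.map fun x => R⁻¹ • x) σ x i) ^ 2
      = R ^ 2 * ∑ i, (h (R • x) i - smoothedScore P (R * σ) (R • x) i) ^ 2 := fun x => by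
    rw [Finset.mul_sum]
    refine Finset.sum_congr rfl fun i _ => ?_
    rw [smoothedScore_map_smul P hR hσ hP]
    ring
  have hRn : (0 : ℝ) ≤ R ^ Fintype.card ι := by positivity
  -- The Jacobian of `x ↦ R • x` cancels the factor `R ^ n` of the density, so only the `R²` of the
  -- squared scores survives.
  have hscale : ∀ G : (ι → ℝ) → ℝ≥0∞, ∫⁻ x, G (R • x)
      = ENNReal.ofReal (R ^ Fintype.card ι)⁻¹ * ∫⁻ x, G x := fun G => by
    have h1 := Measure.map_addHaar_smul (volume : Measure (ι → ℝ)) hR.ne'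
    rw [← (measurableEmbedding_smul_fun hR.ne').lintegral_map G, h1, lintegral_smul_measure,
      Module.finrank_fintype_fun_eq_card, abs_of_nonneg (by positivity), smul_eq_mul]
  simp only [scoreError, smoothed]
  rw [lintegral_withDensity_eq_lintegral_mul_non_measurable _ hm.ennreal_ofReal
    (ae_of_all _ fun _ => ENNReal.ofReal_lt_top),
    lintegral_withDensity_eq_lintegral_mul_non_measurable _ _
    (ae_of_all _ fun _ => ENNReal.ofReal_lt_top)]
  · simp only [Pi.mul_apply, hsq, smoothedDensity_map_smul P hR hσ]
    rw [hscale fun y => ENNReal.ofReal (R ^ Fintype.card ι * smoothedDensity P (R * σ) y)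
      * ENNReal.ofReal (R ^ 2 * ∑ i, (h y i - smoothedScore P (R * σ) y i) ^ 2)]
    rw [← lintegral_const_mul' _ _ ENNReal.ofReal_ne_top,
      ← lintegral_const_mul' _ _ ENNReal.ofReal_ne_top]
    refine lintegral_congr fun y => ?_
    rw [ENNReal.ofReal_mul hRn, ENNReal.ofReal_mul (sq_nonneg R), mul_assoc, ← mul_assoc,
      ← ENNReal.ofReal_mul (by positivity), inv_mul_cancel₀ (by positivity), ENNReal.ofReal_one,
      one_mul, mul_left_comm]
  · simp only [smoothedDensity_map_smul P hR hσ]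
    exact ((hm.comp hms).const_mul _).ennreal_ofReal

end Scaling

/-! ### Moments of mixtures of product measures. -/

section Moments

variable {ι : Type} [Fintype ι] {S : Type} [Fintype S] {c : ℝ≥0∞} {μ : S → ι → Measure ℝ}

lemma integrable_productMixture (hc : c ≠ ∞) {φ : (ι → ℝ) → ℝ}
    (h : ∀ s, Integrable φ (Measure.pi (μ s))) : Integrable φ (productMixture c μ) :=
  integrable_finsetSum_measure.2 fun s _ => (h s).smul_measure hc

lemma integral_productMixture (hc : c ≠ ∞) {φ : (ι → ℝ) → ℝ}
    (h : ∀ s, Integrable φ (Measure.pi (μ s))) :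
    ∫ x, φ x ∂(productMixture c μ) = c.toReal * ∑ s, ∫ x, φ x ∂(Measure.pi (μ s)) := by
  rw [productMixture, integral_finsetSum_measure fun s _ => (h s).smul_measure hc,
    Finset.mul_sum]
  exact Finset.sum_congr rfl fun s _ => integral_smul_measure _ _

variable [∀ s i, IsProbabilityMeasure (μ s i)]

lemma isProbabilityMeasure_productMixture (hc1 : Fintype.card S * c = 1) :
    IsProbabilityMeasure (productMixture c μ) := by
  refine ⟨?_⟩
  rw [productMixture, Measure.finsetSum_apply]
  simpa using hc1

lemma memLp_eval_pi {ν : ι → Measure ℝ} [∀ i, IsProbabilityMeasure (ν i)] {i : ι}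
    (h : MemLp (fun y => y) 2 (ν i)) : MemLp (fun x : ι → ℝ => x i) 2 (Measure.pi ν) :=
  h.comp_measurePreserving (measurePreserving_eval ν i)

lemma integral_eval_pi {ν : ι → Measure ℝ} [∀ i, IsProbabilityMeasure (ν i)] (i : ι)
    {φ : ℝ → ℝ} (hφ : Measurable φ) :
    ∫ x : ι → ℝ, φ (x i) ∂(Measure.pi ν) = ∫ y, φ y ∂(ν i) := by
  rw [← (measurePreserving_eval ν i).map_eq, integral_map (measurable_pi_apply i).aemeasurable
    hφ.aestronglyMeasurable]

lemma integral_mul_eval_pi {ν : ι → Measure ℝ} [∀ i, IsProbabilityMeasure (ν i)] {i j : ι}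
    (hij : i ≠ j) : ∫ x : ι → ℝ, x i * x j ∂(Measure.pi ν) = (∫ y, y ∂(ν i)) * ∫ y, y ∂(ν j) := by
  have h := (iIndepFun_pi (μ := ν) (X := fun _ y => y) fun _ => aemeasurable_id').indepFun hij
  have h1 := h.integral_fun_mul_eq_mul_integral (measurable_pi_apply i).aestronglyMeasurable
    (measurable_pi_apply j).aestronglyMeasurable
  rw [h1, integral_eval_pi i measurable_id', integral_eval_pi j measurable_id']

lemma memLp_eval_productMixture (hc : c ≠ ∞) {i : ι}
    (h : ∀ s, MemLp (fun y => y) 2 (μ s i)) :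
    MemLp (fun x : ι → ℝ => x i) 2 (productMixture c μ) := by
  rw [memLp_two_iff_integrable_sq (measurable_pi_apply i).aestronglyMeasurable]
  exact integrable_productMixture hc fun s => (memLp_eval_pi (h s)).integrable_sq

/-- The covariances of a mixture of product measures, in terms of the moments of the factors. -/
lemma covariance_productMixture (hc : c ≠ ∞) (hc1 : Fintype.card S * c = 1)
    (h : ∀ s i, MemLp (fun y => y) 2 (μ s i)) (hmean : ∀ i, ∑ s, ∫ y, y ∂(μ s i) = 0) (i j : ι) :
    cov[fun x => x i, fun x => x j; productMixture c μ]
      = c.toReal * ∑ s, ∫ x : ι → ℝ, x i * x j ∂(Measure.pi (μ s)) := by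
  have := isProbabilityMeasure_productMixture (μ := μ) hc1
  have hm : ∫ x : ι → ℝ, x i ∂(productMixture c μ) = 0 := by
    rw [integral_productMixture hc fun s => (memLp_eval_pi (h s i)).integrable one_le_two]
    simp only [integral_eval_pi i measurable_id', hmean, mul_zero]
  rw [covariance_eq_sub (memLp_eval_productMixture hc fun s => h s i)
    (memLp_eval_productMixture hc fun s => h s j), hm, zero_mul, sub_zero]
  exact integral_productMixture hc fun s =>
    (memLp_eval_pi (h s i)).integrable_mul (memLp_eval_pi (h s j))

end Moments

/-! ### Covariance of the hard distribution and of its scaled version. -/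

section HardMoments

variable {d d' : ℕ} (f : (Fin d → ℤˣ) → Fin d' → ℤˣ) (R : ℝ) {ε : ℝ}

lemma memLp_hardMarginal (hε : 0 < ε) (s : Fin d → ℤˣ) (o : Fin d ⊕ Fin d') :
    MemLp (fun y => y) 2 (hardMarginal f R ε s o) := by
  rcases o with i | j
  · exact memLp_id_gaussianReal' 2 (by simp)
  · exact memLp_id_discretizedGaussian hε _

lemma integral_hardMarginal_inl (s : Fin d → ℤˣ) (i : Fin d) :
    ∫ y, y ∂(hardMarginal f R ε s (Sum.inl i)) = R * ((s i : ℤ) : ℝ) :=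
  integral_id_gaussianReal

lemma integral_hardMarginal_inr (hε : 0 < ε) (s : Fin d → ℤˣ) (j : Fin d') :
    ∫ y, y ∂(hardMarginal f R ε s (Sum.inr j)) = 0 :=
  integral_id_discretizedGaussian hε _

lemma integral_sq_hardMarginal_le (hε : 0 < ε) (hε1 : ε ≤ 1) (s : Fin d → ℤˣ)
    (o : Fin d ⊕ Fin d') : ∫ y, y ^ 2 ∂(hardMarginal f R ε s o) ≤ R ^ 2 + 9 := by
  rcases o with i | j
  · have := isProbabilityMeasure_hardMarginal f R hε s (Sum.inl i)
    have h := variance_eq_sub (memLp_hardMarginal f R hε s (Sum.inl i))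
    simp only [hardMarginal, Sum.elim_inl] at h ⊢
    rw [variance_fun_id_gaussianReal, integral_id_gaussianReal, mul_pow, unit_sq, mul_one] at h
    have h2 : ∫ x, x ^ 2 ∂(gaussianReal (R * ((s i : ℤ) : ℝ)) 1)
        = ∫ x, ((fun x : ℝ => x) ^ 2) x ∂(gaussianReal (R * ((s i : ℤ) : ℝ)) 1) := rfl
    rw [NNReal.coe_one] at h
    linarith
  · have h := integral_sq_discretizedGaussian_le hε hε1 (f s j)
    simp only [hardMarginal, Sum.elim_inr]
    nlinarith [sq_nonneg R]

lemma sum_units_coe_mul {i j : Fin d} (hij : i ≠ j) :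
    ∑ s : Fin d → ℤˣ, ((s i : ℤ) : ℝ) * ((s j : ℤ) : ℝ) = 0 := by
  have huniv : (Finset.univ : Finset ℤˣ) = {1, -1} := by decide
  have h := sum_prod_mul_eq_zero (g := fun i' b => if i' = i then ((b : ℤ) : ℝ) else 1) (i := j)
    (y := fun b => ((b : ℤ) : ℝ)) (by
      rw [huniv, Finset.sum_pair (by decide)]
      simp [hij.symm])
  rw [← h]
  refine Finset.sum_congr rfl fun s _ => ?_
  simp

lemma sum_units_coe (i : Fin d) : ∑ s : Fin d → ℤˣ, ((s i : ℤ) : ℝ) = 0 := by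
  have huniv : (Finset.univ : Finset ℤˣ) = {1, -1} := by decide
  have h := sum_prod_mul_eq_zero (g := fun _ _ => (1 : ℝ)) (i := i)
    (y := fun b => ((b : ℤ) : ℝ)) (by
      rw [huniv, Finset.sum_pair (by decide)]
      simp)
  simpa using h

lemma sum_integral_hardMarginal (hε : 0 < ε) (o : Fin d ⊕ Fin d') :
    ∑ s, ∫ y, y ∂(hardMarginal f R ε s o) = 0 := by
  rcases o with i | j
  · simp only [integral_hardMarginal_inl, ← Finset.mul_sum, sum_units_coe, mul_zero]
  · simp only [integral_hardMarginal_inr f R hε, Finset.sum_const_zero]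

lemma isProbabilityMeasure_hardDist (hε : 0 < ε) : IsProbabilityMeasure (hardDist f R ε) := by
  have := isProbabilityMeasure_hardMarginal f R hε
  rw [hardDist_eq]
  exact isProbabilityMeasure_productMixture (card_mul_hardWeight d)

lemma memLp_eval_hardDist (hε : 0 < ε) (o : Fin d ⊕ Fin d') :
    MemLp (fun x : Fin d ⊕ Fin d' → ℝ => x o) 2 (hardDist f R ε) := by
  have := isProbabilityMeasure_hardMarginal f R hε
  rw [hardDist_eq]
  exact memLp_eval_productMixture (hardWeight_ne_top d) fun s => memLp_hardMarginal f R hε s o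

/-- Given `s` the coordinates are independent, so cross moments are averages of products of
conditional means. Those of the second block vanish for every `s`, and those of the first block are
`R s_i` with uncorrelated signs. The dependence of the second block on `s` is invisible to second
moments. -/
lemma covariance_hardDist_of_ne (hε : 0 < ε) {o o' : Fin d ⊕ Fin d'} (h : o ≠ o') :
    cov[fun x => x o, fun x => x o'; hardDist f R ε] = 0 := by
  have := isProbabilityMeasure_hardMarginal f R hε
  rw [hardDist_eq, covariance_productMixture (hardWeight_ne_top d) (card_mul_hardWeight d)
    (memLp_hardMarginal f R hε) (sum_integral_hardMarginal f R hε)]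
  simp only [integral_mul_eval_pi h]
  rcases o with i | j
  · rcases o' with i' | j'
    · have hi : i ≠ i' := fun e => h (congrArg _ e)
      simp only [integral_hardMarginal_inl, mul_mul_mul_comm R, ← Finset.mul_sum,
        sum_units_coe_mul hi, mul_zero]
    · simp only [integral_hardMarginal_inr f R hε, mul_zero, Finset.sum_const_zero]
  · simp only [integral_hardMarginal_inr f R hε, zero_mul, mul_zero, Finset.sum_const_zero]

lemma covariance_hardDist_self (hε : 0 < ε) (hε1 : ε ≤ 1) (o : Fin d ⊕ Fin d') :
    |cov[fun x => x o, fun x => x o; hardDist f R ε]| ≤ R ^ 2 + 9 := by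
  have := isProbabilityMeasure_hardMarginal f R hε
  rw [hardDist_eq, covariance_productMixture (hardWeight_ne_top d) (card_mul_hardWeight d)
    (memLp_hardMarginal f R hε) (sum_integral_hardMarginal f R hε)]
  simp only [← sq, integral_eval_pi o (measurable_id'.pow_const 2)]
  rw [abs_of_nonneg (mul_nonneg ENNReal.toReal_nonneg
    (Finset.sum_nonneg fun s _ => integral_nonneg fun y => sq_nonneg y))]
  have hw : (Fintype.card (Fin d → ℤˣ) : ℝ) * (((2 : ℝ≥0∞) ^ d)⁻¹).toReal = 1 := by
    have := congrArg ENNReal.toReal (card_mul_hardWeight d)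
    rwa [ENNReal.toReal_mul, ENNReal.toReal_natCast, ENNReal.toReal_one] at this
  calc _ ≤ (((2 : ℝ≥0∞) ^ d)⁻¹).toReal * ∑ s : Fin d → ℤˣ, (R ^ 2 + 9) :=
        mul_le_mul_of_nonneg_left
          (Finset.sum_le_sum fun s _ => integral_sq_hardMarginal_le f R hε hε1 s o)
          ENNReal.toReal_nonneg
    _ = (Fintype.card (Fin d → ℤˣ) : ℝ) * (((2 : ℝ≥0∞) ^ d)⁻¹).toReal * (R ^ 2 + 9) := by
        rw [Finset.sum_const, Finset.card_univ, nsmul_eq_mul]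
        ring
    _ = R ^ 2 + 9 := by rw [hw, one_mul]

lemma isProbabilityMeasure_scaledHardDist (hε : 0 < ε) :
    IsProbabilityMeasure (scaledHardDist f R ε) := by
  have := isProbabilityMeasure_hardDist f R hε
  exact Measure.isProbabilityMeasure_map (measurable_const_smul R⁻¹).aemeasurable

lemma memLp_eval_scaledHardDist (hε : 0 < ε) (o : Fin d ⊕ Fin d') :
    MemLp (fun x : Fin d ⊕ Fin d' → ℝ => x o) 2 (scaledHardDist f R ε) := by
  exact (memLp_map_measure_iff (g := fun x : Fin d ⊕ Fin d' → ℝ => x o)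
    (measurable_pi_apply o).aestronglyMeasurable (measurable_const_smul R⁻¹).aemeasurable).2
    ((memLp_eval_hardDist f R hε o).const_mul R⁻¹)

lemma covariance_scaledHardDist (o o' : Fin d ⊕ Fin d') :
    cov[fun x => x o, fun x => x o'; scaledHardDist f R ε]
      = R⁻¹ * (R⁻¹ * cov[fun x => x o, fun x => x o'; hardDist f R ε]) := by
  rw [scaledHardDist, covariance_map (measurable_pi_apply o).aestronglyMeasurable
    (measurable_pi_apply o').aestronglyMeasurable (measurable_const_smul R⁻¹).aemeasurable,
    ← covariance_const_mul_right, ← covariance_const_mul_left]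
  rfl

/-- The matrix is diagonal, so its operator norm is the largest entry, and `(R² + 9) / R² ≤ 10` for
`R ≥ 1`. -/
lemma norm_covMatrix_scaledHardDist_le (hε : 0 < ε) (hε1 : ε ≤ 1) (hR : 1 ≤ R) :
    ‖covMatrix (scaledHardDist f R ε)‖ ≤ 10 := by
  have h : covMatrix (scaledHardDist f R ε) = Matrix.diagonal fun o =>
      R⁻¹ * (R⁻¹ * cov[fun x => x o, fun x => x o; hardDist f R ε]) := by
    ext o o'
    rw [covMatrix, Matrix.of_apply, covariance_scaledHardDist]
    rcases eq_or_ne o o' with rfl | hne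
    · rw [Matrix.diagonal_apply_eq]
    · rw [Matrix.diagonal_apply_ne _ hne, covariance_hardDist_of_ne f R hε hne, mul_zero, mul_zero]
  rw [h, Matrix.l2_opNorm_diagonal, pi_norm_le_iff_of_nonneg (by norm_num)]
  intro o
  have h1 := covariance_hardDist_self f R hε hε1 o
  have hR0 : 0 < R := by linarith
  rw [Real.norm_eq_abs, abs_mul, abs_mul, abs_of_pos (inv_pos.2 hR0), ← mul_assoc, ← mul_inv,
    inv_mul_le_iff₀ (by positivity)]
  nlinarith

end HardMoments

/-! ### Transfer of networks to the scaled distribution. -/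

section ScaledNetwork

variable {d d' : ℕ} (f : (Fin d → ℤˣ) → Fin d' → ℤˣ) {R ε σ : ℝ}

lemma smoothedDensity_hardDist_pos (hε : 0 < ε) (hσ : 0 < σ) (x : Fin d ⊕ Fin d' → ℝ) :
    0 < smoothedDensity (hardDist f R ε) σ x := by
  have := isProbabilityMeasure_hardMarginal f R hε
  rw [hardDist_eq, smoothedDensity_productMixture _ _ (hardWeight_ne_top d)]
  exact mul_pos (ENNReal.toReal_pos (hardWeight_ne_zero d) (hardWeight_ne_top d))
    (Finset.sum_pos (fun s _ => Finset.prod_pos fun o _ => gaussianSmoothing_pos _ hσ _)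
      Finset.univ_nonempty)

lemma measurable_smoothedDensity_hardDist (hε : 0 < ε) (σ : ℝ) :
    Measurable (smoothedDensity (hardDist f R ε) σ) := by
  have := isProbabilityMeasure_hardMarginal f R hε
  have h : smoothedDensity (hardDist f R ε) σ = fun x => (((2 : ℝ≥0∞) ^ d)⁻¹).toReal
      * ∑ s, ∏ o, gaussianSmoothing (hardMarginal f R ε s o) σ (x o) :=
    funext fun x => smoothedDensity_productMixture _ (hardMarginal f R ε) (hardWeight_ne_top d) _ _
  rw [h]
  exact (Finset.measurable_sum _ fun s _ => Finset.measurable_prod _ fun o _ =>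
    (measurable_gaussianSmoothing _ _).comp (measurable_pi_apply o)).const_mul _

/-- A network that approximates the score of `hardDist f R ε` yields one for the scaled
distribution. -/
lemma exists_net_scaledHardDist (hε : 0 < ε) (hR : 1 ≤ R) (hσ : 0 < σ) {Q : ℕ} (hQ : 1000 ≤ Q)
    (hdQ : d ≤ Q) (hd'Q : d' ≤ Q) (hRQ : R ≤ Q) {h : ReLUNet (Fin d ⊕ Fin d') (Fin d ⊕ Fin d')}
    (hc : h.paramCount ≤ Q ^ 22) (hB : h.ParamsBoundedBy ((Q : ℝ) ^ 22)) :
    ∃ h' : ReLUNet (Fin d ⊕ Fin d') (Fin d ⊕ Fin d'), h'.paramCount ≤ Q ^ 26 ∧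
      h'.ParamsBoundedBy ((Q : ℝ) ^ 26) ∧ scoreError (scaledHardDist f R ε) σ h'.eval
        = ENNReal.ofReal (R ^ 2) * scoreError (hardDist f R ε) (R * σ) h.eval := by
  have hR0 : 0 < R := by linarith
  have hQr : (1000 : ℝ) ≤ Q := by exact_mod_cast hQ
  have hdr : (d : ℝ) ≤ Q := by exact_mod_cast hdQ
  have hd'r : (d' : ℝ) ≤ Q := by exact_mod_cast hd'Q
  -- The scaled score at `x` is `R` times the original score, at noise level `R σ`, at the point `R
  -- x`.
  refine ⟨(h.precomp (Matrix.diagonal fun _ => R) 0).scaleOutput R, ?_, ?_, ?_⟩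
  · rw [ReLUNet.paramCount_scaleOutput]
    refine (ReLUNet.paramCount_precomp_le _ _ h).trans ?_
    rw [Fintype.card_sum, Fintype.card_fin, Fintype.card_fin]
    have h1 : d + d' + 1 ≤ Q ^ 2 := by nlinarith
    calc _ ≤ Q ^ 22 * Q ^ 2 := Nat.mul_le_mul hc h1
      _ = Q ^ 24 := by ring
      _ ≤ Q ^ 26 := Nat.pow_le_pow_right (by omega) (by norm_num)
  · have hle : R * ((Q : ℝ) ^ 25) ≤ (Q : ℝ) ^ 26 := by
      calc _ ≤ (Q : ℝ) * (Q : ℝ) ^ 25 := by gcongr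
        _ = (Q : ℝ) ^ 26 := by ring
    refine ReLUNet.ParamsBoundedBy.mono hle
      (ReLUNet.ParamsBoundedBy.scaleOutput hR (by positivity)
        (hB.precomp (D := R) (fun o o' => ?_) (fun _ => ?_) (by positivity) hR0.le ?_))
    · rcases eq_or_ne o o' with rfl | hne
      · rw [Matrix.diagonal_apply_eq, abs_of_pos hR0]
      · rw [Matrix.diagonal_apply_ne _ hne, abs_zero]
        exact hR0.le
    · rw [Pi.zero_apply, abs_zero]
      exact hR0.le
    · rw [Fintype.card_sum, Fintype.card_fin, Fintype.card_fin]
      push_cast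
      calc ((d : ℝ) + d') * ((Q : ℝ) ^ 22 * R) + (Q : ℝ) ^ 22
          ≤ (Q + Q) * ((Q : ℝ) ^ 22 * Q) + (Q : ℝ) ^ 22 := by gcongr
        _ = (Q : ℝ) ^ 22 * (2 * Q ^ 2 + 1) := by ring
        _ ≤ (Q : ℝ) ^ 22 * Q ^ 3 := by gcongr; nlinarith
        _ = (Q : ℝ) ^ 25 := by ring
  · have he : ((h.precomp (Matrix.diagonal fun _ => R) 0).scaleOutput R).eval
        = fun x o => R * h.eval (R • x) o := by
      ext x o
      rw [ReLUNet.eval_scaleOutput, ReLUNet.eval_precomp]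
      have hx : (fun k => ∑ j, Matrix.diagonal (fun _ => R) k j * x j
          + (0 : Fin d ⊕ Fin d' → ℝ) k) = R • x := by
        funext k
        simp [Matrix.diagonal_apply]
      rw [hx]
    rw [he, scaledHardDist, scoreError_map_smul _ hR0 hσ
      (fun x => (smoothedDensity_hardDist_pos f hε (by positivity) x).ne')
      (measurable_smoothedDensity_hardDist f hε _)]

end ScaledNetwork

/-! ### Simplified error bounds in the two regimes. -/

section ErrorBounds

variable {d d' Q : ℕ} {f : (Fin d → ℤˣ) → Fin d' → ℤˣ} {N : ReLUNet (Fin d') (Fin d)} {R ε σ η : ℝ}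

/-- The small noise approximation, with the error bounded in terms of its exponential factors. -/
lemma exists_net_small_noise_of_exp_le (hd : 0 < d) (hQ : 1000 ≤ Q) (hdQ : d ≤ Q)
    (hd'd : d' ≤ d ^ 2) (hd'Q : d' ≤ Q) (hN : N.Computes f) (hNc : N.paramCount ≤ Q)
    (hNB : N.ParamsBoundedBy Q) (hε : 0 < ε) (hε1 : ε ≤ 1) (hR : 2 ≤ R) (hRQ : R ≤ Q)
    (hσ : 1 / (Q : ℝ) ≤ σ) (h1 : Real.exp (-(R ^ 2 / (16 * (1 + σ ^ 2)))) ≤ η)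
    (h2 : 1 / σ ^ 4 * Real.exp (-(R ^ 2 / (8 * (1 + σ ^ 2)))) ≤ η) :
    ∃ h : ReLUNet (Fin d ⊕ Fin d') (Fin d ⊕ Fin d'), h.depth ≤ N.depth + 2 ∧
      h.paramCount ≤ Q ^ 22 ∧ h.ParamsBoundedBy ((Q : ℝ) ^ 22) ∧
      scoreError (hardDist f R ε) σ h.eval ≤ ENNReal.ofReal (74 * d ^ 3 * η + 1 / Q) := by
  obtain ⟨h, hdep, hpc, hpb, herr⟩ := exists_net_small_noise hd hQ hdQ hd'Q hN hNc hNB hε hε1 hR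
    hRQ hσ
  refine ⟨h, hdep, hpc, hpb, herr.trans (ENNReal.ofReal_le_ofReal ?_)⟩
  have hd1 : (1 : ℝ) ≤ d := by exact_mod_cast hd
  have hd'r : (d' : ℝ) ≤ (d : ℝ) ^ 2 := by exact_mod_cast hd'd
  have hV1 : 1 ≤ 1 + σ ^ 2 := by nlinarith [sq_nonneg σ]
  have hV0 : 0 < 1 + σ ^ 2 := by linarith
  have hη : 0 ≤ η := (Real.exp_pos _).le.trans h1
  set V := 1 + σ ^ 2 with hV
  have e1 : Real.exp (-(R ^ 2 / (8 * V))) = Real.exp (-(R ^ 2 / (16 * V)))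
      * Real.exp (-(R ^ 2 / (16 * V))) := by
    rw [← Real.exp_add]
    congr 1
    ring_nf
  have hle1 : Real.exp (-(R ^ 2 / (16 * V))) ≤ 1 :=
    Real.exp_le_one_iff.2 (neg_nonpos.2 (by positivity))
  -- One half of the exponent absorbs `R² / V` through `z exp (-z) ≤ 1`; the other half is bounded
  -- by `η`.
  have hA : (R / V) ^ 2 * Real.exp (-(R ^ 2 / (8 * V))) ≤ 16 * η := by
    have t1 : (R / V) ^ 2 ≤ 16 * (R ^ 2 / (16 * V)) := by
      have : 16 * (R ^ 2 / (16 * V)) = R ^ 2 / V := by field_simp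
      rw [this, div_pow]
      gcongr
      nlinarith
    have t2 : R ^ 2 / (16 * V) * Real.exp (-(R ^ 2 / (16 * V))) ≤ 1 := by
      have t3 := Real.add_one_le_exp (R ^ 2 / (16 * V))
      rw [Real.exp_neg, ← div_eq_mul_inv, div_le_one (Real.exp_pos _)]
      linarith
    calc _ ≤ 16 * (R ^ 2 / (16 * V)) * Real.exp (-(R ^ 2 / (8 * V))) := by gcongr
      _ = 16 * (R ^ 2 / (16 * V) * Real.exp (-(R ^ 2 / (16 * V))))
          * Real.exp (-(R ^ 2 / (16 * V))) := by rw [e1]; ring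
      _ ≤ 16 * 1 * η := by gcongr
      _ = 16 * η := by ring
  have hB : Real.exp (-(R ^ 2 / (8 * V))) ≤ η := by
    rw [e1]
    exact (mul_le_of_le_one_left (Real.exp_pos _).le hle1).trans h1
  clear_value V
  have he0 := Real.exp_pos (-(R ^ 2 / (8 * V)))
  have hw0 : 0 ≤ (R / V) ^ 2 := sq_nonneg _
  generalize Real.exp (-(R ^ 2 / (8 * V))) = e at hA hB h2 he0 ⊢
  generalize (R / V) ^ 2 = w at hA hw0 ⊢
  calc _ = 4 * d ^ 2 * (w * e) + d * d' * (2 * e + 8 * (1 / σ ^ 4 * e)) + 1 / Q := by ring_nf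
    _ ≤ 4 * d ^ 3 * (16 * η) + d * d ^ 2 * (2 * η + 8 * η) + 1 / Q := by
        have : (d : ℝ) ^ 2 ≤ d ^ 3 := pow_le_pow_right₀ hd1 (by norm_num)
        gcongr
    _ = 74 * d ^ 3 * η + 1 / Q := by ring

/-- The large noise approximation, with the error bounded in terms of a bound for
`latticeDecay (1 / 2) ε`. -/
lemma exists_net_large_noise_of_latticeDecay_le (hd : 0 < d) (hQ : 1000 ≤ Q) (hdQ : d ≤ Q)
    (hd'd : d' ≤ d ^ 2) (hd'Q : d' ≤ Q) (hε : 0 < ε) (hR0 : 0 ≤ R) (hRQ : R ≤ Q) (hσ : 1 ≤ σ)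
    (hη : latticeDecay (1 / 2) ε ≤ η) (hη1 : 32 * d ^ 2 * η ≤ 1) {r : ℝ} (hr : 1 ≤ r)
    (hRr : (R / (1 + σ ^ 2)) ^ 2 ≤ r) :
    ∃ h : ReLUNet (Fin d ⊕ Fin d') (Fin d ⊕ Fin d'), h.depth = 2 ∧
      h.paramCount ≤ Q ^ 22 ∧ h.ParamsBoundedBy ((Q : ℝ) ^ 22) ∧
      scoreError (hardDist f R ε) σ h.eval
        ≤ ENNReal.ofReal (1313 * d ^ 3 * r * η + 1 / Q) := by
  have hq0 := latticeDecay_pos (1 / 2) ε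
  have hd1 : (1 : ℝ) ≤ d := by exact_mod_cast hd
  have hd'r : (d' : ℝ) ≤ (d : ℝ) ^ 2 := by exact_mod_cast hd'd
  have hd21 : (1 : ℝ) ≤ (d : ℝ) ^ 2 := one_le_pow₀ hd1
  have hη0 : 0 ≤ η := hq0.le.trans hη
  have hθ' : 32 * d' * latticeDecay (1 / 2) ε ≤ 32 * d ^ 2 * η := by gcongr
  have hθ := hθ'.trans hη1
  obtain ⟨h, hdep, hpc, hpb, herr⟩ := exists_net_large_noise (f := f) hd hQ hdQ hd'Q hε hR0 hRQ hσ
    (by nlinarith) hθ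
  refine ⟨h, hdep, hpc, hpb, herr.trans (ENNReal.ofReal_le_ofReal ?_)⟩
  -- The perturbation is at most one, so its square is bounded by its first power. Below, `1313 = 32
  -- * 32 + 289`.
  have h1 : (32 * d' * latticeDecay (1 / 2) ε) ^ 2 ≤ 32 * d ^ 2 * η := by
    rw [sq]
    exact (mul_le_of_le_one_left (by positivity) hθ).trans hθ'
  have h2 : (d : ℝ) ^ 2 ≤ d ^ 3 * r := by
    have : (d : ℝ) ^ 2 ≤ d ^ 3 := pow_le_pow_right₀ hd1 (by norm_num)
    nlinarith [pow_pos (by linarith : (0 : ℝ) < d) 3]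
  calc _ ≤ 1 / Q + (d * (r * (32 * (32 * d ^ 2 * η))) + d ^ 2 * (289 * η)) := by gcongr
    _ = 1 / Q + (1024 * d ^ 3 * r * η + 289 * η * d ^ 2) := by ring
    _ ≤ 1 / Q + (1024 * d ^ 3 * r * η + 289 * η * (d ^ 3 * r)) := by gcongr
    _ = 1313 * d ^ 3 * r * η + 1 / Q := by ring

end ErrorBounds

/-! ### Asymptotic comparisons in `d`. -/

section Asymptotics

lemma exists_forall_log_le (B C : ℝ) : ∃ d₀ : ℕ, ∀ d : ℕ, d₀ ≤ d →
    B ≤ d ∧ B ≤ Real.log d ∧ C * Real.log d ≤ d := by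
  have h1 : ∀ᶠ x : ℝ in Filter.atTop, B ≤ Real.log x :=
    Real.tendsto_log_atTop.eventually_ge_atTop B
  have h2 : ∀ᶠ x : ℝ in Filter.atTop, C * Real.log x ≤ x := by
    filter_upwards [(Real.isLittleO_log_id_atTop.const_mul_left C).bound one_pos,
      Filter.eventually_ge_atTop 0] with x hx hx0
    rw [one_mul, id, Real.norm_of_nonneg hx0] at hx
    exact (le_abs_self _).trans hx
  exact Filter.eventually_atTop.1 (tendsto_natCast_atTop_atTop.eventually
    ((Filter.eventually_ge_atTop B).and (h1.and h2)))

lemma exp_neg_le_rpow {x t y : ℝ} (hx : 0 < x) (h : t * Real.log x ≤ y) :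
    Real.exp (-y) ≤ x ^ (-t) := by
  rw [Real.rpow_def_of_pos hx]
  exact Real.exp_le_exp.2 (by linarith)

/-- The upper bound on `ε` gives `1 / ε² ≥ C² log x`, and `π² ≥ 9`. This is how a smaller comb
period yields an arbitrarily high power of `d`. -/
lemma latticeDecay_half_le {x C ε : ℝ} (hC : 0 < C) (hx : 1 < x) (hε : 0 < ε)
    (h : ε < 1 / (C * √(Real.log x))) : latticeDecay (1 / 2) ε ≤ x ^ (-(9 * C ^ 2)) := by
  have hl := Real.log_pos hx
  refine exp_neg_le_rpow (by linarith) ?_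
  rw [lt_div_iff₀ (by positivity)] at h
  have h2 : (ε * (C * √(Real.log x))) ^ 2 ≤ 1 := pow_le_one₀ (by positivity) h.le
  rw [mul_pow, mul_pow, Real.sq_sqrt hl.le] at h2
  rw [le_div_iff₀ (by positivity)]
  nlinarith [Real.pi_gt_three]

lemma one_div_mul_sqrt_le_one {C l : ℝ} (hC : 1 ≤ C) (hl : 1 ≤ l) : 1 / (C * √l) ≤ 1 := by
  have h1 : 1 ≤ √l := Real.one_le_sqrt.2 hl
  rw [div_le_one (by positivity)]
  nlinarith

end Asymptotics

/-! ### Choice of parameters in the two results. -/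

section ScoreNetworks

/-- ReLU networks approximate the smoothed scores of `hardDist f R ε`. -/
theorem exists_net_hardDist_score {C : ℝ} (hC : 64 ≤ C) (k : ℕ) :
    ∃ K d₀ : ℕ, ∀ d : ℕ, d₀ ≤ d → ∀ d' : ℕ, d' ≤ k * d →
      ∀ (f : (Fin d → ℤˣ) → Fin d' → ℤˣ) (N : ReLUNet (Fin d') (Fin d)),
        N.Computes f → N.paramCount ≤ d ^ k → N.ParamsBoundedBy ((d : ℝ) ^ k) →
      ∀ ε : ℝ, 1 / (d : ℝ) ^ k < ε → ε < 1 / (C * √(Real.log d)) →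
      ∀ R : ℝ, C * Real.log d < R → R ≤ (d : ℝ) ^ k →
      ∀ σ : ℝ, 1 / (d : ℝ) ^ C ≤ σ →
        ∃ h : ReLUNet (Fin d ⊕ Fin d') (Fin d ⊕ Fin d'),
          h.depth ≤ N.depth + 2 ∧ h.paramCount ≤ d ^ K ∧ h.ParamsBoundedBy ((d : ℝ) ^ K) ∧
          scoreError (hardDist f R ε) σ h.eval
            ≤ ENNReal.ofReal (1314 * (1 / (d : ℝ) ^ (C / 200))) := by
  obtain ⟨d₀, hd₀⟩ := exists_forall_log_le (max 1000 k) 0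
  obtain ⟨m₀, hm₀⟩ := exists_nat_ge C
  -- All sizes are measured by `Q = d ^ m` with `m = k + 2 + m₀`: `k` covers `N` and `R`, `2` covers
  -- `d' ≤ d²`, and `m₀ ≥ C` covers `1 / σ` and the error `1 / Q`.
  refine ⟨(k + 2 + m₀) * 22, d₀, fun d hd d' hd' f N hN hNc hNB ε hε hε1 R hR hRk σ hσ => ?_⟩
  obtain ⟨hdB, hl, -⟩ := hd₀ d hd
  have hd1000 : (1000 : ℝ) ≤ d := (le_max_left _ _).trans hdB
  have hl1000 : (1000 : ℝ) ≤ Real.log d := (le_max_left _ _).trans hl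
  have hkd : (k : ℝ) ≤ d := (le_max_right _ _).trans hdB
  have hd0 : (0 : ℝ) < d := by linarith
  have hd1 : (1 : ℝ) ≤ d := by linarith
  have hdn : 1000 ≤ d := by exact_mod_cast hd1000
  have hkdn : k ≤ d := by exact_mod_cast hkd
  obtain ⟨m, hm⟩ : ∃ m, m = k + 2 + m₀ := ⟨_, rfl⟩
  rw [← hm]
  have hpow : ∀ {j : ℕ}, j ≤ m → d ^ j ≤ d ^ m := fun h => Nat.pow_le_pow_right (by omega) h
  have hdm : d ≤ d ^ m := (pow_one d).symm.le.trans (hpow (by omega))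
  have hd'd : d' ≤ d ^ 2 := (hd'.trans (Nat.mul_le_mul_right d (by omega))).trans_eq (sq d).symm
  have hd'm : d' ≤ d ^ m := hd'd.trans (hpow (by omega))
  have hkm : (d : ℝ) ^ k ≤ ((d ^ m : ℕ) : ℝ) := by exact_mod_cast hpow (by omega)
  have hCm : (d : ℝ) ^ C ≤ ((d ^ m : ℕ) : ℝ) := by
    rw [Nat.cast_pow, ← Real.rpow_natCast]
    refine Real.rpow_le_rpow_of_exponent_le hd1 (hm₀.trans ?_)
    exact_mod_cast (by omega : m₀ ≤ m)
  have hσQ : 1 / ((d ^ m : ℕ) : ℝ) ≤ σ := (one_div_le_one_div_of_le (by positivity) hCm).trans hσ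
  have hσ0 : 0 < σ := lt_of_lt_of_le (by positivity) hσ
  have hε0 : 0 < ε := lt_trans (by positivity) hε
  have hCl : 64 * 1000 ≤ C * Real.log d := mul_le_mul hC hl1000 (by norm_num) (by linarith)
  have hR2 : 2 ≤ R := by linarith
  have hR0 : 0 < R := by linarith
  have hQ1 : 1 / ((d ^ m : ℕ) : ℝ) ≤ 1 / (d : ℝ) ^ (C / 200) := by
    refine one_div_le_one_div_of_le (by positivity) (le_trans ?_ hCm)
    exact Real.rpow_le_rpow_of_exponent_le hd1 (by linarith)
  -- For `1 + σ² ≤ R` the exponent `R² / (16 (1 + σ²))` is at least `R / 16 > (C / 16) log d`. For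
  -- `C ≥ 64` there remains room for the factor `d³`: `3 - C / 16 ≤ -C / 200`.
  obtain ⟨η, hη⟩ : ∃ η, η = (d : ℝ) ^ (-(C / 16)) := ⟨_, rfl⟩
  have hη0 : 0 ≤ η := hη ▸ by positivity
  have hηd : (d : ℝ) ^ 3 * η ≤ 1 / (d : ℝ) ^ (C / 200) := by
    rw [hη, ← Real.rpow_natCast, ← Real.rpow_add hd0, one_div, ← Real.rpow_neg hd0.le]
    refine Real.rpow_le_rpow_of_exponent_le hd1 ?_
    push_cast
    linarith
  have hX0 : 0 < 1 / (d : ℝ) ^ (C / 200) := by positivity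
  rw [pow_mul, pow_mul, ← Nat.cast_pow]
  -- Below this threshold the signs are reliable; above it `R / (1 + σ²) ≤ 1` and `σ ≥ 1`, as the
  -- large noise estimate needs.
  rcases le_or_gt (1 + σ ^ 2) R with hσR | hσR
  · have hw : R ≤ R ^ 2 / (1 + σ ^ 2) := by
      rw [le_div_iff₀ (by positivity), sq R]
      exact mul_le_mul_of_nonneg_left hσR hR0.le
    have hexp1 : Real.exp (-(R ^ 2 / (16 * (1 + σ ^ 2)))) ≤ η := by
      rw [hη]
      refine exp_neg_le_rpow hd0 ?_
      have : R ^ 2 / (16 * (1 + σ ^ 2)) = R ^ 2 / (1 + σ ^ 2) / 16 := by field_simp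
      rw [this]
      linarith
    have hexp2 : 1 / σ ^ 4 * Real.exp (-(R ^ 2 / (8 * (1 + σ ^ 2)))) ≤ η := by
      have h8 : R ^ 2 / (8 * (1 + σ ^ 2)) = R ^ 2 / (1 + σ ^ 2) / 8 := by field_simp
      rw [h8, hη]
      rcases le_or_gt 1 σ with hσ1 | hσ1
      · have hσ4 : 1 / σ ^ 4 ≤ 1 := by
          rw [div_le_one (by positivity)]
          exact one_le_pow₀ hσ1
        refine (mul_le_of_le_one_left (Real.exp_pos _).le hσ4).trans (exp_neg_le_rpow hd0 ?_)
        linarith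
      -- For `σ < 1` the factor `1 / σ⁴` can reach `d ^ (4 C)`, but the exponent is then quadratic
      -- in `R`, and `R² ≥ 64000 C log d` outweighs it.
      · have hw2 : R ^ 2 / 2 ≤ R ^ 2 / (1 + σ ^ 2) := by
          gcongr
          linarith [pow_le_one₀ (n := 2) hσ0.le hσ1.le]
        have hσ4 : 1 / σ ^ 4 ≤ (d : ℝ) ^ (4 * C) := by
          have : 1 / σ ≤ (d : ℝ) ^ C := by
            rw [one_div_le hσ0 (by positivity)]
            exact hσ
          calc 1 / σ ^ 4 = (1 / σ) ^ 4 := by rw [one_div_pow]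
            _ ≤ ((d : ℝ) ^ C) ^ 4 := by gcongr
            _ = (d : ℝ) ^ (4 * C) := by
              rw [← Real.rpow_natCast, ← Real.rpow_mul hd0.le]
              push_cast
              rw [mul_comm]
        have he : Real.exp (-(R ^ 2 / (1 + σ ^ 2) / 8)) ≤ (d : ℝ) ^ (-(5 * C)) := by
          refine exp_neg_le_rpow hd0 ?_
          have hRR : 64 * 1000 * (C * Real.log d) ≤ R ^ 2 := by
            rw [sq]
            exact mul_le_mul (hCl.trans hR.le) hR.le (by linarith) hR0.le
          linarith
        calc _ ≤ (d : ℝ) ^ (4 * C) * (d : ℝ) ^ (-(5 * C)) := by gcongr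
          _ = (d : ℝ) ^ (-C) := by
            rw [← Real.rpow_add hd0]
            ring_nf
          _ ≤ (d : ℝ) ^ (-(C / 16)) := Real.rpow_le_rpow_of_exponent_le hd1 (by linarith)
    obtain ⟨h, hdep, hpc, hpb, herr⟩ := exists_net_small_noise_of_exp_le (Q := d ^ m)
      (by omega) (hdn.trans hdm) hdm hd'd hd'm hN (hNc.trans (hpow (by omega))) (hNB.mono hkm)
      hε0 (hε1.le.trans (one_div_mul_sqrt_le_one (by linarith) (by linarith))) hR2
      (hRk.trans hkm) hσQ hexp1 hexp2
    exact ⟨h, hdep, hpc, hpb, herr.trans (ENNReal.ofReal_le_ofReal (by linarith))⟩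
  · have hσ1 : 1 ≤ σ := (one_le_sq_iff₀ hσ0.le).1 (by linarith)
    have hRσ : (R / (1 + σ ^ 2)) ^ 2 ≤ 1 :=
      pow_le_one₀ (by positivity) ((div_le_one (by positivity)).2 hσR.le)
    have hηle : (d : ℝ) ^ (-(9 * C ^ 2)) ≤ η := by
      rw [hη]
      have : 64 * C ≤ C ^ 2 := by
        rw [sq]
        exact mul_le_mul_of_nonneg_right hC (by linarith)
      exact Real.rpow_le_rpow_of_exponent_le hd1 (by linarith)
    have hη1 : 32 * (d : ℝ) ^ 2 * η ≤ 1 := by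
      have : 1 / (d : ℝ) ^ (C / 200) ≤ 1 := by
        rw [div_le_one (by positivity)]
        exact Real.one_le_rpow hd1 (by linarith)
      calc 32 * (d : ℝ) ^ 2 * η ≤ d * d ^ 2 * η := by
            gcongr
            linarith
        _ = d ^ 3 * η := by ring
        _ ≤ 1 := hηd.trans this
    obtain ⟨h, hdep, hpc, hpb, herr⟩ := exists_net_large_noise_of_latticeDecay_le (f := f)
      (Q := d ^ m) (by omega) (hdn.trans hdm) hdm hd'd hd'm hε0 hR0.le (hRk.trans hkm) hσ1
      ((latticeDecay_half_le (by linarith) (by linarith) hε0 hε1).trans hηle) hη1 le_rfl hRσ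
    exact ⟨h, by omega, hpc, hpb, herr.trans (ENNReal.ofReal_le_ofReal (by linarith))⟩

/-- The distributions `scaledHardDist f (C log d) ε` are well-modeled. -/
theorem isWellModeledWith_scaledHardDist {a C : ℝ} (ha : 0 < a) (hC : a + 2 ≤ C) (k : ℕ) :
    ∃ K d₀ : ℕ, ∀ d : ℕ, d₀ ≤ d → ∀ d' : ℕ, d' ≤ k * d →
      ∀ (f : (Fin d → ℤˣ) → Fin d' → ℤˣ) (N : ReLUNet (Fin d') (Fin d)),
        N.Computes f → N.paramCount ≤ d ^ k → N.ParamsBoundedBy ((d : ℝ) ^ k) →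
      ∀ ε : ℝ, 1 / (d : ℝ) ^ k < ε → ε < 1 / (C * √(Real.log d)) →
        IsWellModeledWith (a * C) 10 K (scaledHardDist f (C * Real.log d) ε) := by
  have hC0 : 0 < C := by linarith
  have haC : 0 < a * C := by positivity
  -- Since `n ≤ d²` and `σ ≤ n ^ (a C)`, the admissible error is at least `d ^ (-6 a C)`. The extra
  -- `d⁸` pays for `R² ≤ d²`, for the factor `d⁵` in the error bounds, and for the constant `1314 <
  -- d`.
  obtain ⟨T, hT⟩ : ∃ T, T = 6 * (a * C) + 8 := ⟨_, rfl⟩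
  obtain ⟨d₀, hd₀⟩ := exists_forall_log_le (max 2000 (max (k + 1) (64 * T))) C
  obtain ⟨m₀, hm₀⟩ := exists_nat_ge T
  refine ⟨(k + 2 + m₀) * 26, d₀, fun d hd d' hd' f N hN hNc hNB ε hε hε1 => ?_⟩
  obtain ⟨hdB, hl, hRd⟩ := hd₀ d hd
  have hd2000 : (2000 : ℝ) ≤ d := (le_max_left _ _).trans hdB
  have hl2000 : (2000 : ℝ) ≤ Real.log d := (le_max_left _ _).trans hl
  have hkd : (k : ℝ) + 1 ≤ d := ((le_max_left _ _).trans (le_max_right _ _)).trans hdB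
  have hlT : 64 * T ≤ Real.log d := ((le_max_right _ _).trans (le_max_right _ _)).trans hl
  have hd0 : (0 : ℝ) < d := by linarith
  have hd1 : (1 : ℝ) ≤ d := by linarith
  have hdn : 2000 ≤ d := by exact_mod_cast hd2000
  have hkdn : k + 1 ≤ d := by exact_mod_cast hkd
  obtain ⟨m, hm⟩ : ∃ m, m = k + 2 + m₀ := ⟨_, rfl⟩
  rw [← hm]
  obtain ⟨R, hR⟩ : ∃ R, R = C * Real.log d := ⟨_, rfl⟩
  rw [← hR] at hRd ⊢
  have hpow : ∀ {j : ℕ}, j ≤ m → d ^ j ≤ d ^ m := fun h => Nat.pow_le_pow_right (by omega) h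
  have hdm : d ≤ d ^ m := (pow_one d).symm.le.trans (hpow (by omega))
  have hd'd : d' ≤ d ^ 2 := (hd'.trans (Nat.mul_le_mul_right d (by omega))).trans_eq (sq d).symm
  have hd'm : d' ≤ d ^ m := hd'd.trans (hpow (by omega))
  have hkm : (d : ℝ) ^ k ≤ ((d ^ m : ℕ) : ℝ) := by exact_mod_cast hpow (by omega)
  have hTm : (d : ℝ) ^ T ≤ ((d ^ m : ℕ) : ℝ) := by
    rw [Nat.cast_pow, ← Real.rpow_natCast]
    refine Real.rpow_le_rpow_of_exponent_le hd1 (hm₀.trans ?_)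
    exact_mod_cast (by omega : m₀ ≤ m)
  have hε0 : 0 < ε := lt_trans (by positivity) hε
  have hε1' : ε ≤ 1 := hε1.le.trans (one_div_mul_sqrt_le_one (by linarith) (by linarith))
  have hR2 : 2 ≤ R := by
    rw [hR]
    calc (2 : ℝ) ≤ 1 * Real.log d := by linarith
      _ ≤ C * Real.log d := by gcongr; linarith
  have hR0 : 0 < R := by linarith
  have hRm : R ≤ ((d ^ m : ℕ) : ℝ) := hRd.trans (by exact_mod_cast hdm)
  have hnd : ((Fintype.card (Fin d ⊕ Fin d') : ℕ) : ℝ) ≤ (d : ℝ) ^ (2 : ℝ) := by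
    rw [Real.rpow_two, Fintype.card_sum, Fintype.card_fin, Fintype.card_fin]
    have : d + d' ≤ d ^ 2 := by
      calc d + d' ≤ (k + 1) * d := by linarith
        _ ≤ d * d := Nat.mul_le_mul_right d hkdn
        _ = d ^ 2 := (sq d).symm
    exact_mod_cast this
  have hdn' : d ≤ Fintype.card (Fin d ⊕ Fin d') := by
    rw [Fintype.card_sum, Fintype.card_fin, Fintype.card_fin]
    omega
  obtain ⟨n, hn⟩ : ∃ n, n = Fintype.card (Fin d ⊕ Fin d') := ⟨_, rfl⟩
  rw [← hn] at hnd hdn'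
  have hn0 : (0 : ℝ) < n := by exact_mod_cast (by omega : 0 < n)
  have hnC : (n : ℝ) ^ (a * C) ≤ (d : ℝ) ^ (2 * (a * C)) := by
    rw [Real.rpow_mul hd0.le]
    exact Real.rpow_le_rpow hn0.le hnd haC.le
  have hnm : d ^ (m * 26) ≤ n ^ (m * 26) := Nat.pow_le_pow_left hdn' _
  refine ⟨isProbabilityMeasure_scaledHardDist f R hε0, memLp_eval_scaledHardDist f R hε0,
    norm_covMatrix_scaledHardDist_le f R hε0 hε1' (by linarith), fun σ hσ hσ' => ?_⟩
  rw [← hn] at hσ hσ' ⊢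
  have hσ0 : 0 < σ := lt_of_lt_of_le (by positivity) hσ
  have hσR : 1 / (d : ℝ) ^ (2 * (a * C)) ≤ R * σ := by
    have h1 : 1 / (d : ℝ) ^ (2 * (a * C)) ≤ σ :=
      (one_div_le_one_div_of_le (by positivity) hnC).trans hσ
    exact h1.trans (le_mul_of_one_le_left hσ0.le (by linarith))
  have hσQ : 1 / ((d ^ m : ℕ) : ℝ) ≤ R * σ := by
    refine (one_div_le_one_div_of_le (by positivity) (le_trans ?_ hTm)).trans hσR
    exact Real.rpow_le_rpow_of_exponent_le hd1 (by linarith)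
  obtain ⟨η, hη⟩ : ∃ η, η = (d : ℝ) ^ (-T) := ⟨_, rfl⟩
  have hη0 : 0 < η := hη ▸ by positivity
  have hQη : 1 / ((d ^ m : ℕ) : ℝ) ≤ η := by
    rw [hη, Real.rpow_neg hd0.le, ← one_div]
    exact one_div_le_one_div_of_le (by positivity) hTm
  have hη8 : η * (d : ℝ) ^ 8 = (d : ℝ) ^ (-(6 * (a * C))) := by
    rw [hη, ← Real.rpow_natCast, ← Real.rpow_add hd0, hT]
    push_cast
    ring_nf
  have htarget : (d : ℝ) ^ (-(6 * (a * C))) ≤ 1 / ((n : ℝ) ^ (a * C) * σ ^ 2) := by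
    rw [Real.rpow_neg hd0.le, ← one_div]
    refine one_div_le_one_div_of_le (by positivity) ?_
    calc (n : ℝ) ^ (a * C) * σ ^ 2
        ≤ (d : ℝ) ^ (2 * (a * C)) * ((d : ℝ) ^ (2 * (a * C))) ^ 2 := by
          gcongr
          exact hσ'.trans hnC
      _ = ((d : ℝ) ^ (2 * (a * C))) ^ (3 : ℕ) := by ring
      _ = (d : ℝ) ^ (6 * (a * C)) := by
          rw [← Real.rpow_natCast, ← Real.rpow_mul hd0.le]
          push_cast
          ring_nf
  suffices hsuff : ∃ h : ReLUNet (Fin d ⊕ Fin d') (Fin d ⊕ Fin d'),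
      h.paramCount ≤ (d ^ m) ^ 22 ∧ h.ParamsBoundedBy (((d ^ m : ℕ) : ℝ) ^ 22) ∧
      scoreError (hardDist f R ε) (R * σ) h.eval
        ≤ ENNReal.ofReal (1313 * d ^ 5 * η + 1 / ((d ^ m : ℕ) : ℝ)) by
    obtain ⟨h, hpc, hpb, herr⟩ := hsuff
    obtain ⟨h', hpc', hpb', herr'⟩ := exists_net_scaledHardDist f hε0 (by linarith) hσ0
      (show 1000 ≤ d ^ m by omega) hdm hd'm hRm hpc hpb
    refine ⟨h', ?_, ReLUNet.ParamsBoundedBy.mono ?_ hpb', ?_⟩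
    · rw [← pow_mul] at hpc'
      exact hpc'.trans hnm
    · rw [Nat.cast_pow, ← pow_mul]
      exact_mod_cast hnm
    · rw [herr']
      refine (mul_le_mul_right herr _).trans_lt ?_
      rw [← ENNReal.ofReal_mul (sq_nonneg R)]
      refine (ENNReal.ofReal_lt_ofReal_iff (by positivity)).2 (lt_of_lt_of_le ?_ htarget)
      rw [← hη8]
      have h5 : 1 ≤ (d : ℝ) ^ 5 := one_le_pow₀ hd1
      have h7 : 0 < (d : ℝ) ^ 7 := by positivity
      calc R ^ 2 * (1313 * d ^ 5 * η + 1 / ((d ^ m : ℕ) : ℝ))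
          ≤ (d : ℝ) ^ 2 * (1313 * d ^ 5 * η + d ^ 5 * η) := by
            gcongr
            exact hQη.trans (le_mul_of_one_le_left hη0.le h5)
        _ = η * (1314 * d ^ 7) := by ring
        _ < η * (d * d ^ 7) := by
            gcongr
            linarith
        _ = η * d ^ 8 := by ring
  -- With `R = C log d`, the threshold `1 + σ² = R` would guarantee only an exponent of order `C log
  -- d / 16`, too small for `d ^ (-T)`. At effective noise at most one the exponent is of order
  -- `R²`, hence of order `(log d)²`, and beats every power of `d`.
  rcases le_or_gt (R * σ) 1 with hσ1 | hσ1
  · obtain ⟨σ', hσ'def⟩ : ∃ σ', σ' = R * σ := ⟨_, rfl⟩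
    rw [← hσ'def] at hσR hσQ hσ1 ⊢
    have hσ'0 : 0 < σ' := hσ'def ▸ by positivity
    have hV : 1 + σ' ^ 2 ≤ 2 := by linarith [pow_le_one₀ (n := 2) hσ'0.le hσ1]
    have hRl : 64 * T * Real.log d ≤ R ^ 2 := by
      have hlR : Real.log d ≤ R := hR ▸ le_mul_of_one_le_left (by linarith) (by linarith)
      calc 64 * T * Real.log d ≤ Real.log d * Real.log d := by gcongr
        _ ≤ R * R := by gcongr
        _ = R ^ 2 := (sq R).symm
    have hTl : 0 ≤ T * Real.log d := mul_nonneg (by linarith) (by linarith)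
    have hexp1 : Real.exp (-(R ^ 2 / (16 * (1 + σ' ^ 2)))) ≤ η := by
      rw [hη]
      refine exp_neg_le_rpow hd0 ?_
      calc T * Real.log d ≤ R ^ 2 / (16 * 2) := by
            rw [le_div_iff₀ (by norm_num)]
            linarith
        _ ≤ _ := by gcongr
    have hexp2 : 1 / σ' ^ 4 * Real.exp (-(R ^ 2 / (8 * (1 + σ' ^ 2)))) ≤ η := by
      have hσ4 : 1 / σ' ^ 4 ≤ (d : ℝ) ^ (2 * T) := by
        have : 1 / σ' ≤ (d : ℝ) ^ (2 * (a * C)) := by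
          rw [one_div_le hσ'0 (by positivity)]
          exact hσR
        calc 1 / σ' ^ 4 = (1 / σ') ^ 4 := by rw [one_div_pow]
          _ ≤ ((d : ℝ) ^ (2 * (a * C))) ^ 4 := by gcongr
          _ = (d : ℝ) ^ (8 * (a * C)) := by
            rw [← Real.rpow_natCast, ← Real.rpow_mul hd0.le]
            push_cast
            ring_nf
          _ ≤ (d : ℝ) ^ (2 * T) := Real.rpow_le_rpow_of_exponent_le hd1 (by linarith)
      have he : Real.exp (-(R ^ 2 / (8 * (1 + σ' ^ 2)))) ≤ (d : ℝ) ^ (-(3 * T)) := by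
        refine exp_neg_le_rpow hd0 ?_
        calc 3 * T * Real.log d ≤ R ^ 2 / (8 * 2) := by
              rw [le_div_iff₀ (by norm_num)]
              linarith
          _ ≤ _ := by gcongr
      calc _ ≤ (d : ℝ) ^ (2 * T) * (d : ℝ) ^ (-(3 * T)) := by gcongr
        _ = η := by
          rw [← Real.rpow_add hd0, hη]
          ring_nf
    obtain ⟨h, -, hpc, hpb, herr⟩ := exists_net_small_noise_of_exp_le (Q := d ^ m)
      (by omega) (by omega) hdm hd'd hd'm hN (hNc.trans (hpow (by omega))) (hNB.mono hkm)
      hε0 hε1' hR2 hRm hσQ hexp1 hexp2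
    refine ⟨h, hpc, hpb, herr.trans (ENNReal.ofReal_le_ofReal ?_)⟩
    have : (d : ℝ) ^ 3 ≤ d ^ 5 := pow_le_pow_right₀ hd1 (by norm_num)
    gcongr
    norm_num
  -- Here `R / (1 + (R σ)²)` need not be at most one; the crude bound `d²` is affordable because the
  -- lattice decay is `d ^ (-9 C²)`.
  · have hRσ : (R / (1 + (R * σ) ^ 2)) ^ 2 ≤ (d : ℝ) ^ 2 := by
      have : R / (1 + (R * σ) ^ 2) ≤ R := div_le_self hR0.le (le_add_of_nonneg_right (sq_nonneg _))
      exact pow_le_pow_left₀ (by positivity) (this.trans hRd) 2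
    -- This is where `C ≥ a + 2` enters: `a C ≤ C²` and `4 ≤ C²` give `T = 6 a C + 8 ≤ 8 C²`.
    have hηle : (d : ℝ) ^ (-(9 * C ^ 2)) ≤ η := by
      rw [hη, hT]
      have haC2 : a * C ≤ C ^ 2 := by
        rw [sq]
        exact mul_le_mul_of_nonneg_right (by linarith) hC0.le
      have hC4 : 4 ≤ C ^ 2 := by
        calc (4 : ℝ) = 2 ^ 2 := by norm_num
          _ ≤ C ^ 2 := by gcongr; linarith
      exact Real.rpow_le_rpow_of_exponent_le hd1 (by linarith)
    have hη1 : 32 * (d : ℝ) ^ 2 * η ≤ 1 := by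
      have h1 : η * (d : ℝ) ^ 8 ≤ 1 := by
        rw [hη8]
        exact Real.rpow_le_one_of_one_le_of_nonpos hd1 (by linarith)
      have h6 : 32 ≤ (d : ℝ) ^ 6 := by
        calc (32 : ℝ) ≤ d := by linarith
          _ ≤ d ^ 6 := le_self_pow₀ hd1 (by norm_num)
      calc 32 * (d : ℝ) ^ 2 * η ≤ d ^ 6 * d ^ 2 * η := by gcongr
        _ = η * d ^ 8 := by ring
        _ ≤ 1 := h1
    obtain ⟨h, -, hpc, hpb, herr⟩ := exists_net_large_noise_of_latticeDecay_le (f := f)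
      (Q := d ^ m) (by omega) (by omega) hdm hd'd hd'm hε0 hR0.le hRm hσ1.le
      ((latticeDecay_half_le hC0 (by linarith) hε0 hε1).trans hηle) hη1 (one_le_pow₀ hd1) hRσ
    refine ⟨h, hpc, hpb, herr.trans (ENNReal.ofReal_le_ofReal (le_of_eq ?_))⟩
    ring

end ScoreNetworks

end

theorem mainTheorem4 :
    (∃ M : ℝ, ∀ a : ℝ, 0 < a → ∃ C₀ : ℝ, 0 < C₀ ∧ ∀ C : ℝ, C₀ ≤ C → ∀ k : ℕ,
      ∃ K d₀ : ℕ, ∀ d : ℕ, d₀ ≤ d → ∀ d' : ℕ, d' ≤ k * d →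
        ∀ (f : (Fin d → ℤˣ) → Fin d' → ℤˣ) (N : ReLUNet (Fin d') (Fin d)),
          N.Computes f → N.paramCount ≤ d ^ k → N.ParamsBoundedBy ((d : ℝ) ^ k) →
        ∀ ε : ℝ, 1 / (d : ℝ) ^ k < ε → ε < 1 / (C * √(Real.log d)) →
          IsWellModeledWith (a * C) M K (scaledHardDist f (C * Real.log d) ε)) ∧
    (∃ (A C₀ : ℝ) (L : ℕ), 0 < C₀ ∧ ∀ C : ℝ, C₀ ≤ C → ∀ k : ℕ,
      ∃ K d₀ : ℕ, ∀ d : ℕ, d₀ ≤ d → ∀ d' : ℕ, d' ≤ k * d →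
        ∀ (f : (Fin d → ℤˣ) → Fin d' → ℤˣ) (N : ReLUNet (Fin d') (Fin d)),
          N.Computes f → N.paramCount ≤ d ^ k → N.ParamsBoundedBy ((d : ℝ) ^ k) →
        ∀ ε : ℝ, 1 / (d : ℝ) ^ k < ε → ε < 1 / (C * √(Real.log d)) →
        ∀ R : ℝ, C * Real.log d < R → R ≤ (d : ℝ) ^ k →
        ∀ σ : ℝ, 1 / (d : ℝ) ^ C ≤ σ →
          ∃ h : ReLUNet (Fin d ⊕ Fin d') (Fin d ⊕ Fin d'),
            h.depth ≤ N.depth + L ∧ h.paramCount ≤ d ^ K ∧ h.ParamsBoundedBy ((d : ℝ) ^ K) ∧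
            scoreError (hardDist f R ε) σ h.eval
              ≤ ENNReal.ofReal (A * (1 / (d : ℝ) ^ (C / 200)))) := by
  refine ⟨⟨10, fun a ha => ⟨a + 2, by linarith, fun C hC k =>
    isWellModeledWith_scaledHardDist ha hC k⟩⟩, 1314, 64, 2, by norm_num, fun C hC k =>
    exists_net_hardDist_score hC k⟩
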